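/- \textbf{Model.} Macro base stations (MBSs) and small cell base stations (SBSs) form independent homogeneous Poisson point processes $\Phi_{\rm m},\Phi_{\rm s}$ in $\mathbb R^2$ with densities $\lambda_{\rm m},\lambda_{\rm s}>0$; the typical user is at the origin. For $k\in\{{\rm a},{\rm b}\}$ (access, backhaul), $i\in\{{\rm m},{\rm s}\}$, $s\in\{\ell,{\rm n}\}$ (LOS, NLOS) there are given: pathloss exponents $\alpha_{k_{i,s}}>0$, reference losses $\beta_{k_i}>0$, powers $P_i>0$, biases $T_i>0$, main-lobe gains $G_i,G_{\rm u}>0$ and side-lobe gains $g_i,g_{\rm u}\ge 0$ of tier-$i$ base stations and of the user, beam widths $\theta_i,\theta_{\rm u}\in[0,2\pi]$, an LOS range constant $\mu>0$, noise density ${\tt N}_0>0$ and bandwidth $W>0$. The links considered are those from each base station to the user (access) and from each MBS to each SBS (backhaul). Given all locations, each link of length $r$ is LOS with probability $e^{-r/\mu}$ and NLOS otherwise, independently over links; its pathloss is $L=r^{\alpha_{k_{i,s}}}$, $s$ being its state. Each link has a fading gain $h\sim\exp(1)$; the fading gains are i.i.d. Each SBS $\mathbf x$ has a gain $\psi_{\mathbf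 x}$ towards the user when interfering; the $\psi_{\mathbf x}$ are i.i.d., with values ${\cal G}\in{\cal M}=\{G_{\rm s}G_{\rm u},\,g_{\rm s}G_{\rm u},\,G_{\rm s}g_{\rm u},\,g_{\rm s}g_{\rm u}\}$ taken (as a labelled family) with probabilities $p_{\cal G}=\frac{\theta_{\rm s}\theta_{\rm u}}{4\pi^2},\frac{(2\pi-\theta_{\rm s})\theta_{\rm u}}{4\pi^2},\frac{\theta_{\rm s}(2\pi-\theta_{\rm u})}{4\pi^2},\frac{(2\pi-\theta_{\rm s})(2\pi-\theta_{\rm u})}{4\pi^2}$. Locations and link states, fading gains, and antenna gains are mutually independent. The user is served by the base station $\mathbf x^*$ maximizing $P_iT_i\beta_{{\rm a}_i}G_iG_{\rm u}L_{\rm a}(\mathbf x)^{-1}$ over $\mathbf x\in\Phi_i$, $i\in\{{\rm m},{\rm s}\}$, where $L_{\rm a}(\mathbf x)$ is the access pathloss of $\mathbf x$. If $\mathbf x^*\in\Phi_{\rm s}$, its anchor MBS $\tilde{\mathbf x}$ maximizes $P_{\rm m}\beta_{{\rm b}_{\rm m}}G_{\rm m}G_{\rm s}L_{\rm b}(\mathbf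 x,\mathbf x^*)^{-1}$ over $\mathbf x\in\Phi_{\rm m}$, where $L_{\rm b}(\mathbf x,\mathbf x^*)$ is the backhaul pathloss. Neglecting MBS interference on the access link and all interference on the backhaul link, put, for $\mathbf x^*\in\Phi_i$, $$\mathrm{SINR}_{\rm a}=\frac{P_iG_iG_{\rm u}\beta_{{\rm a}_i}h_{0,\mathbf x^*}L_{\rm a}(\mathbf x^*)^{-1}}{\sum_{\mathbf x\in\Phi_{\rm s}\setminus\{\mathbf x^*\}}P_{\rm s}h_{0,\mathbf x}\beta_{{\rm a}_{\rm s}}\psi_{\mathbf x}L_{\rm a}(\mathbf x)^{-1}+{\tt N}_0W},\qquad \mathrm{SNR}_{\rm b}=\frac{P_{\rm m}G_{\rm m}G_{\rm s}\beta_{{\rm b}_{\rm m}}h_{\mathbf x^*,\tilde{\mathbf x}}L_{\rm b}(\tilde{\mathbf x},\mathbf x^*)^{-1}}{{\tt N}_0W}.$$ \textbf{Notation.} $\Omega_{j,i}=\frac{P_jT_j\beta_{{\rm a}_j}G_j}{P_iT_i\beta_{{\rm a}_i}G_i}$; for $l>0$, $$\Lambda_{{\rm a}_i}((0,l])=2\pi\lambda_i\Big[\mu\big(\mu-e^{-u/\mu}(u+\mu)\big)+\tfrac{v^2}{2}-\mu\big(\mu-e^{-v/\mu}(v+\mu)\big)\Big],\quad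 u=l^{1/\alpha_{{\rm a}_{i,\ell}}},\ v=l^{1/\alpha_{{\rm a}_{i,{\rm n}}}};$$ $\lambda_{{\rm a}_{i,t}}(l)=\frac{2\pi\lambda_i}{\alpha}l^{2/\alpha-1}q_t(l^{1/\alpha})$ with $\alpha=\alpha_{{\rm a}_{i,t}}$, $q_\ell(r)=e^{-r/\mu}$, $q_{\rm n}(r)=1-e^{-r/\mu}$; $\lambda_{{\rm a}_i}=\lambda_{{\rm a}_{i,\ell}}+\lambda_{{\rm a}_{i,{\rm n}}}$; and ${\cal A}_i=\int_0^\infty e^{-\sum_{j}\Lambda_{{\rm a}_j}((0,\Omega_{j,i}l])}\lambda_{{\rm a}_i}(l)\,dl$, $j$ ranging over $\{{\rm m},{\rm s}\}$. For $L>0$ let $\tilde\lambda'_{\rm m}(r;L)=\lambda_{\rm m}\sum_{s\in\{\ell,{\rm n}\}}q_s(r)\mathbf 1\big(r>(\Omega_{{\rm m},{\rm s}}L)^{1/\alpha_{{\rm a}_{{\rm m},s}}}\big)$ and, for $t\in\{\ell,{\rm n}\}$, with $x=L^{1/\alpha_{{\rm a}_{{\rm s},t}}}$, $\tilde\lambda_{{\rm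 m},t}(r,\theta;L)=\tilde\lambda'_{\rm m}\big((r^2+x^2-2rx\cos\theta)^{1/2};L\big)$, $$\tilde\Lambda_{{\rm b}_t}((0,l];L)=\int_0^{2\pi}\sum_{s\in\{\ell,{\rm n}\}}\int_0^{l^{1/\alpha_{{\rm b}_{{\rm m},s}}}}\tilde\lambda_{{\rm m},t}(r,\theta;L)\,q_s(r)\,r\,dr\,d\theta,$$ $$\tilde\lambda_{{\rm b}_t}(l;L)=\int_0^{2\pi}\sum_{s\in\{\ell,{\rm n}\}}\tilde\lambda_{{\rm m},t}(l^{1/\alpha_{{\rm b}_{{\rm m},s}}},\theta;L)\,\tfrac{1}{\alpha_{{\rm b}_{{\rm m},s}}}\,l^{\frac{2}{\alpha_{{\rm b}_{{\rm m},s}}}-1}\,q_s(l^{1/\alpha_{{\rm b}_{{\rm m},s}}})\,d\theta .$$ \textbf{Statement.} $\mathbb P(\mathbf x^*\in\Phi_i)={\cal A}_i>0$ for $i\in\{{\rm m},{\rm s}\}$, and for all $\tau,\tau_1,\tau_2>0$ (with $e^{-\infty}=0$): $$\mathbb P(\mathrm{SINR}_{\rm a}>\tau\mid\mathbf x^*\in\Phi_{\rm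 m})=\frac1{{\cal A}_{\rm m}}\int_0^\infty\exp\Big(-\sum_{{\cal G}\in{\cal M}}\int_{\Omega_{{\rm s},{\rm m}}l}^\infty\Big(1-\frac1{1+\frac{\tau P_{\rm s}\beta_{{\rm a}_{\rm s}}{\cal G}l}{P_{\rm m}\beta_{{\rm a}_{\rm m}}G_{\rm m}G_{\rm u}z}}\Big)p_{\cal G}\lambda_{{\rm a}_{\rm s}}(z)\,dz-\frac{\tau{\tt N}_0Wl}{P_{\rm m}\beta_{{\rm a}_{\rm m}}G_{\rm m}G_{\rm u}}-\sum_{j}\Lambda_{{\rm a}_j}((0,\Omega_{j,{\rm m}}l])\Big)\lambda_{{\rm a}_{\rm m}}(l)\,dl,$$ $$\mathbb P(\mathrm{SINR}_{\rm a}>\tau_1,\mathrm{SNR}_{\rm b}>\tau_2\mid\mathbf x^*\in\Phi_{\rm s})=\frac1{{\cal A}_{\rm s}}\sum_{t\in\{\ell,{\rm n}\}}\int_0^\infty\!\!\int_0^\infty\exp\Big(-\sum_{{\cal G}\in{\cal M}}\int_{l_1}^\infty\Big(1-\frac1{1+\frac{\tau_1{\cal G}l_1}{G_{\rm s}G_{\rm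 u}z}}\Big)p_{\cal G}\lambda_{{\rm a}_{\rm s}}(z)\,dz$$ $$-\frac{\tau_1{\tt N}_0Wl_1}{P_{\rm s}\beta_{{\rm a}_{\rm s}}G_{\rm s}G_{\rm u}}-\frac{\tau_2{\tt N}_0Wl_2}{P_{\rm m}\beta_{{\rm b}_{\rm m}}G_{\rm m}G_{\rm s}}-\tilde\Lambda_{{\rm b}_t}((0,l_2];l_1)-\sum_{j}\Lambda_{{\rm a}_j}((0,\Omega_{j,{\rm s}}l_1])\Big)\tilde\lambda_{{\rm b}_t}(l_2;l_1)\,\lambda_{{\rm a}_{{\rm s},t}}(l_1)\,dl_2\,dl_1 .$$ -/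

import Mathlib

open MeasureTheory ProbabilityTheory Set
open scoped ENNReal

noncomputable section

namespace IAB

/-- The two tiers of base stations: macro base stations and small cell base stations. -/
inductive Tier
  | mbs
  | sbs
  deriving DecidableEq

/-- Type of a link: access (base station to typical user) or backhaul (base station to SBS). -/
inductive LinkType
  | access
  | backhaul
  deriving DecidableEq

/-- State of a link: line of sight or blocked. -/
inductive LinkState
  | los
  | nlos
  deriving DecidableEq

instance : Inhabited Tier := ⟨Tier.mbs⟩

instance : Fintype Tier where
  elems := {Tier.mbs, Tier.sbs}
  complete := by intro i; cases i <;> simp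

instance : Fintype LinkState where
  elems := {LinkState.los, LinkState.nlos}
  complete := by intro s; cases s <;> simp

/-- The plane with the Euclidean norm and Lebesgue measure. -/
abbrev Plane : Type := EuclideanSpace ℝ (Fin 2)

/-- Deterministic parameters of the two-tier network. -/
structure Params where
  /-- density of the point process of base stations of each tier -/
  density : Tier → ℝ
  /-- transmit power over the system bandwidth -/
  power : Tier → ℝ
  /-- association bias factor -/
  bias : Tier → ℝ
  /-- propagation loss at the reference distance -/
  refLoss : LinkType → Tier → ℝ
  /-- pathloss exponents -/
  pathlossExp : LinkType → Tier → LinkState → ℝ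
  /-- main lobe gain of the base stations -/
  mainGain : Tier → ℝ
  /-- side lobe gain of the base stations -/
  sideGain : Tier → ℝ
  /-- beam width of the base stations -/
  beamwidth : Tier → ℝ
  /-- main lobe gain of the user -/
  ueMainGain : ℝ
  /-- side lobe gain of the user -/
  ueSideGain : ℝ
  /-- beam width of the user -/
  ueBeamwidth : ℝ
  /-- LOS range constant -/
  losRange : ℝ
  /-- noise power spectral density -/
  noiseDensity : ℝ
  /-- system bandwidth -/
  bandwidth : ℝ
  density_pos : ∀ i, 0 < density i
  power_pos : ∀ i, 0 < power i
  bias_pos : ∀ i, 0 < bias i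
  refLoss_pos : ∀ k i, 0 < refLoss k i
  pathlossExp_pos : ∀ k i s, 0 < pathlossExp k i s
  mainGain_pos : ∀ i, 0 < mainGain i
  sideGain_nonneg : ∀ i, 0 ≤ sideGain i
  beamwidth_mem : ∀ i, beamwidth i ∈ Icc 0 (2 * Real.pi)
  ueMainGain_pos : 0 < ueMainGain
  ueSideGain_nonneg : 0 ≤ ueSideGain
  ueBeamwidth_mem : ueBeamwidth ∈ Icc 0 (2 * Real.pi)
  losRange_pos : 0 < losRange
  noiseDensity_pos : 0 < noiseDensity
  bandwidth_pos : 0 < bandwidth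

namespace Params

variable (p : Params)

/-- Noise power over the system bandwidth. -/
def noise : ℝ := p.noiseDensity * p.bandwidth

/-- LOS probability of a link of length `r`. -/
def losProb (r : ℝ) : ℝ := Real.exp (-r / p.losRange)

/-- Effective antenna gain of an interfering access link from an SBS. The first component tells
whether the user lies in the main lobe of the SBS, the second whether the SBS lies in the main lobe
of the user. -/
def lobeGain (d : Bool × Bool) : ℝ :=
  (if d.1 then p.mainGain .sbs else p.sideGain .sbs) *
    (if d.2 then p.ueMainGain else p.ueSideGain)

/-- Probability of each of the four alignments, for uniform beam directions. -/
def lobeProb (d : Bool × Bool) : ℝ :=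
  (if d.1 then p.beamwidth .sbs else 2 * Real.pi - p.beamwidth .sbs) *
    (if d.2 then p.ueBeamwidth else 2 * Real.pi - p.ueBeamwidth) / (4 * Real.pi ^ 2)

/-- The ratio `Ω_{j,i}` of biased transmit powers on access links. -/
def powerRatio (j i : Tier) : ℝ :=
  (p.power j * p.bias j * p.refLoss .access j * p.mainGain j) /
    (p.power i * p.bias i * p.refLoss .access i * p.mainGain i)

/-- Mass of `(0, l]` under the intensity measure of the access pathloss process of tier `i`. -/
def pathlossMeasure (i : Tier) (l : ℝ) : ℝ :=
  let μ := p.losRange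
  let rL := l ^ (1 / p.pathlossExp .access i .los)
  let rN := l ^ (1 / p.pathlossExp .access i .nlos)
  2 * Real.pi * p.density i *
    (μ * (μ - Real.exp (-rL / μ) * (rL + μ))
      + (l ^ (2 / p.pathlossExp .access i .nlos) / 2 - μ * (μ - Real.exp (-rN / μ) * (rN + μ))))

/-- Density of the pathloss process of the access links of tier `i` that are in state `s`. -/
def pathlossDensityState (i : Tier) (s : LinkState) (l : ℝ) : ℝ :=
  let α := p.pathlossExp .access i s
  2 * Real.pi * p.density i * (1 / α * l ^ (2 / α - 1) *
    (match s with
      | .los => p.losProb (l ^ (1 / α))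
      | .nlos => 1 - p.losProb (l ^ (1 / α))))

/-- Density of the access pathloss process of tier `i`. -/
def pathlossDensity (i : Tier) (l : ℝ) : ℝ :=
  p.pathlossDensityState i .los l + p.pathlossDensityState i .nlos l

/-- Exponent `∑_j Λ_{a_j}((0, Ω_{j,i} l])`. -/
def assocExponent (i : Tier) (l : ℝ) : ℝ :=
  ∑ j : Tier, p.pathlossMeasure j (p.powerRatio j i * l)

/-- Association probability integral of tier `i`. -/
def assocProb (i : Tier) : ℝ≥0∞ :=
  ∫⁻ l in Ioi (0 : ℝ), ENNReal.ofReal (Real.exp (-p.assocExponent i l) * p.pathlossDensity i l)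

/-- Density, at distance `r` from the typical user, of the MBSs given that the user is served by an
SBS with access pathloss `L`. -/
def condDensityUser (L r : ℝ) : ℝ :=
  let c := p.powerRatio .mbs .sbs * L
  p.density .mbs * p.losProb r *
      (if c ^ (1 / p.pathlossExp .access .mbs .los) < r then 1 else 0)
    + p.density .mbs * (1 - p.losProb r) *
      (if c ^ (1 / p.pathlossExp .access .mbs .nlos) < r then 1 else 0)

/-- The same density in polar coordinates `(r, θ)` seen from the serving SBS, which is at polar
coordinates `(x, θs)` with respect to the user. -/
def condDensity (L r θ x θs : ℝ) : ℝ :=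
  p.condDensityUser L (Real.sqrt (r ^ 2 + x ^ 2 - 2 * r * x * Real.cos (θ - θs)))

/-- Mass of `(0, l]` under the intensity measure of the pathloss process of the MBSs seen by the
tagged SBS, given the state `t` and pathloss `L` of the access link and the direction `θs`. -/
def condPathlossMeasure (t : LinkState) (l L θs : ℝ) : ℝ :=
  let x := L ^ (1 / p.pathlossExp .access .sbs t)
  ∫ θ in (0 : ℝ)..(2 * Real.pi),
    ((∫ r in (0 : ℝ)..(l ^ (1 / p.pathlossExp .backhaul .mbs .los)),
        p.condDensity L r θ x θs * p.losProb r * r)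
      + ∫ r in (0 : ℝ)..(l ^ (1 / p.pathlossExp .backhaul .mbs .nlos)),
        p.condDensity L r θ x θs * (1 - p.losProb r) * r)

/-- Density of the pathloss process of the MBSs seen by the tagged SBS. -/
def condPathlossDensity (t : LinkState) (l L θs : ℝ) : ℝ :=
  let x := L ^ (1 / p.pathlossExp .access .sbs t)
  let αL := p.pathlossExp .backhaul .mbs .los
  let αN := p.pathlossExp .backhaul .mbs .nlos
  ∫ θ in (0 : ℝ)..(2 * Real.pi),
    (p.condDensity L (l ^ (1 / αL)) θ x θs * (1 / αL * l ^ (2 / αL - 1)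
        * p.losProb (l ^ (1 / αL)))
      + p.condDensity L (l ^ (1 / αN)) θ x θs * (1 / αN * l ^ (2 / αN - 1)
        * (1 - p.losProb (l ^ (1 / αN)))))

end Params

/-- The links of the model: `access i n` joins the `n`-th base station of tier `i` to the typical
user at the origin, and `backhaul n k` joins the `n`-th MBS to the `k`-th SBS. -/
inductive Link
  | access (i : Tier) (n : ℕ)
  | backhaul (n k : ℕ)

variable {Ω : Type*} [MeasurableSpace Ω]

/-- The counting measure of a sequence of random points. -/
def countingMeasure (X : ℕ → Ω → Plane) (ω : Ω) : Measure Plane :=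
  Measure.sum fun n => Measure.dirac (X n ω)

/-- `X` enumerates the points of a homogeneous Poisson point process of density `lam`. -/
structure IsPoissonProcess (X : ℕ → Ω → Plane) (lam : ℝ) (P : Measure Ω) : Prop where
  measurable : ∀ n, Measurable (X n)
  law : ∀ B : Set Plane, MeasurableSet B → volume B ≠ ∞ → ∀ k : ℕ,
    P {ω | countingMeasure X ω B = k} =
      ENNReal.ofReal (Real.exp (-(lam * (volume B).toReal)) * (lam * (volume B).toReal) ^ k
        / (k.factorial : ℝ))
  indep : ∀ (m : ℕ) (B : Fin m → Set Plane), (∀ i, MeasurableSet (B i)) →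
    Pairwise (fun i j => Disjoint (B i) (B j)) →
    iIndepFun (fun i ω => countingMeasure X ω (B i)) P

/-- The random network: locations, blocking, fading and antenna alignment. -/
structure Network (p : Params) (P : Measure Ω) where
  /-- location of the `n`-th base station of tier `i` -/
  loc : Tier → ℕ → Ω → Plane
  /-- uniform mark deciding whether a link is blocked -/
  blockMark : Link → Ω → ℝ
  /-- Rayleigh fading power gain of a link -/
  fading : Link → Ω → ℝ
  /-- alignment of the beams of the `n`-th SBS and of the user, when that SBS interferes -/
  lobe : ℕ → Ω → Bool × Bool
  poisson : ∀ i, IsPoissonProcess (loc i) (p.density i) P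
  blockMark_measurable : ∀ e, Measurable (blockMark e)
  blockMark_law : ∀ e, P.map (blockMark e) = volume.restrict (Icc (0 : ℝ) 1)
  blockMark_indep : iIndepFun blockMark P
  fading_measurable : ∀ e, Measurable (fading e)
  fading_law : ∀ e, P.map (fading e) = expMeasure 1
  fading_indep : iIndepFun fading P
  lobe_measurable : ∀ n, Measurable (lobe n)
  lobe_law : ∀ n d, P {ω | lobe n ω = d} = ENNReal.ofReal (p.lobeProb d)
  lobe_indep : iIndepFun lobe P
  /- Together the next four say that the MBS locations, the SBS locations, the blocking marks, the
  fading gains and the alignments are mutually independent. -/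
  indep_loc : IndepFun (fun ω n => loc .mbs n ω) (fun ω n => loc .sbs n ω) P
  indep_blockMark : IndepFun (fun ω (i : Tier) n => loc i n ω) (fun ω e => blockMark e ω) P
  indep_fading : IndepFun (fun ω => ((fun (i : Tier) n => loc i n ω), fun e => blockMark e ω))
    (fun ω e => fading e ω) P
  indep_lobe : IndepFun
    (fun ω => ((fun (i : Tier) n => loc i n ω), (fun e => blockMark e ω), fun e => fading e ω))
    (fun ω n => lobe n ω) P

/-- An index maximizing `f` (arbitrary if there is none). -/
def argmax {ι : Type*} [Nonempty ι] (f : ι → ℝ) : ι :=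
  Classical.epsilon fun b => ∀ c, f c ≤ f b

namespace Network

variable {p : Params} {P : Measure Ω} (N : Network p P)

/-- Length of a link. -/
def length (ω : Ω) : Link → ℝ
  | .access i n => ‖N.loc i n ω‖
  | .backhaul n k => ‖N.loc .mbs n ω - N.loc .sbs k ω‖

/-- Given the locations, the links are independently in LOS with probability `exp (-r / μ)`. -/
def state (ω : Ω) (e : Link) : LinkState :=
  if N.blockMark e ω ≤ p.losProb (N.length ω e) then .los else .nlos

/-- Pathloss of a link. -/
def pathloss (ω : Ω) : Link → ℝ
  | .access i n => N.length ω (.access i n) ^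
      p.pathlossExp .access i (N.state ω (.access i n))
  | .backhaul n k => N.length ω (.backhaul n k) ^
      p.pathlossExp .backhaul .mbs (N.state ω (.backhaul n k))

/-- The base station offering the user the maximum biased average received power. -/
def serving (ω : Ω) : Tier × ℕ :=
  argmax fun b : Tier × ℕ =>
    p.power b.1 * p.bias b.1 * p.refLoss .access b.1 * p.mainGain b.1 * p.ueMainGain *
      (N.pathloss ω (.access b.1 b.2))⁻¹

/-- The event that the serving base station belongs to tier `i`. -/
def servedBy (i : Tier) : Set Ω := {ω | (N.serving ω).1 = i}

/-- The MBS offering maximum average power at the serving SBS (used when the user is served by an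
SBS). -/
def anchor (ω : Ω) : ℕ :=
  argmax fun n : ℕ =>
    p.power .mbs * p.refLoss .backhaul .mbs * p.mainGain .mbs * p.mainGain .sbs *
      (N.pathloss ω (.backhaul n (N.serving ω).2))⁻¹

/-- Interference power at the user from all SBSs other than the serving base station. -/
def interference (ω : Ω) : ℝ≥0∞ :=
  ∑' k : ℕ, if (Tier.sbs, k) = N.serving ω then 0 else
    ENNReal.ofReal (p.power .sbs * N.fading (.access .sbs k) ω * p.refLoss .access .sbs *
      p.lobeGain (N.lobe k ω) * (N.pathloss ω (.access .sbs k))⁻¹)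

/-- SINR of the access link of the typical user, MBS interference being neglected. -/
def sinrAccess (ω : Ω) : ℝ≥0∞ :=
  let b := N.serving ω
  ENNReal.ofReal (p.power b.1 * p.mainGain b.1 * p.ueMainGain * p.refLoss .access b.1 *
      N.fading (.access b.1 b.2) ω * (N.pathloss ω (.access b.1 b.2))⁻¹) /
    (N.interference ω + ENNReal.ofReal p.noise)

/-- SNR of the backhaul link from the anchor MBS to the serving SBS. -/
def snrBackhaul (ω : Ω) : ℝ≥0∞ :=
  let e := Link.backhaul (N.anchor ω) (N.serving ω).2
  ENNReal.ofReal (p.power .mbs * p.mainGain .mbs * p.mainGain .sbs * p.refLoss .backhaul .mbs *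
      N.fading e ω * (N.pathloss ω e)⁻¹) / ENNReal.ofReal p.noise

end Network

end IAB

end

/-! Almost surely exactly one station serves the user. The indicator of "served by tier i, link
above threshold" is then a sum over the stations of that tier, each summand being the indicator that
the station wins the association times that of coverage. For a small cell the sum runs over pairs
(small cell, anchor). Probabilities thus become sums of means, and each summand is a product over
links, integrated one source of randomness at a time.

Fading comes first (`lintegral_coverage`): the exponential tail of the serving gain turns the SINR
condition into exp(-noise) times a product of factors exp(-a h), whose means are 1/(1+a). Then come
the antenna alignments (`lintegral_coverInd`) and the blocking marks (`lintegral_marks_serving`,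
`lintegral_marks_anchor`): given the tagged marks the other marks are independent, so every other
station contributes one averaged factor. What remains has the form Σ_n w(X_n) ∏_{m≠n} F(ℓ(X_n), X_m)
for a Poisson process X of density λ. By Mecke's formula its mean is λ ∫ w(x) exp(-λ ∫ (1 - F(ℓ(x),
y)) dy) dx, while the other tier contributes a Laplace functional. Polar coordinates and the
substitution of pathloss for distance give the stated integrals.

Only the laws and the independence of the counts of the process are available, so both formulas are
derived from E c^N = e^{-a(1-c)} and E N c^{N-1} = a e^{-a(1-c)} for a Poisson variable N of mean a.
They pass from step functions to simple functions (`IsPoissonProcess.simple_formulas`) and by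
monotone limits to measurable functions (`laplace`, `mecke_const`). A real level ℓ(X_n) is rounded
down and up to a grid; as F decreases in the level, the two roundings bracket the sum
(`mecke_level`). The bracket closes because the exponent is continuous in the level
(`continuousAt_levelE`), even where it is infinite.

For the anchor, fix a small cell at y with access pathloss L. With F the factor of a macro station
in the association and B its factor in the choice of the anchor, 1 - BF = (1 - F) + F(1 - B). The
first part integrates to the association exponent, the second to the mass seen from y of the macro
process thinned by F. Isotropy (`lintegral_two_norms`) leaves only the norm of y, so the sum over
anchors is a function of L and of the link state (`anchorMean_eq`), and serves as weight in Mecke's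
formula for the small cells.

Uniqueness of the winner comes from the same computation. It is carried out for a comparison R that
is either < or ≤, with the same value in both cases. Strict indicators are below weak ones, so equal
finite means force almost sure equality, i.e. no ties. Existence of a maximizer comes from local
finiteness. This also settles the measurability of events defined through an arbitrary maximizer. -/

noncomputable section

namespace IAB

open Filter Topology

/-! ### The function `exp (-x)` on `[0, ∞]` -/

/-- `exp (-x)` for `x ∈ [0, ∞]`, with `exp (-∞) = 0`. -/
def expNeg (x : ℝ≥0∞) : ℝ≥0∞ := EReal.exp (-(x : EReal))

lemma expNeg_zero : expNeg 0 = 1 := by simp [expNeg]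

lemma expNeg_top : expNeg ∞ = 0 := by simp [expNeg]

lemma expNeg_ofReal {x : ℝ} (hx : 0 ≤ x) :
    expNeg (ENNReal.ofReal x) = ENNReal.ofReal (Real.exp (-x)) := by
  rw [expNeg, EReal.coe_ennreal_ofReal, max_eq_left hx, ← EReal.coe_neg, EReal.exp_coe]

lemma expNeg_add (x y : ℝ≥0∞) : expNeg (x + y) = expNeg x * expNeg y := by
  rw [expNeg, expNeg, expNeg, ← EReal.exp_add, EReal.coe_ennreal_add,
    EReal.neg_add (by simp) (by simp), sub_eq_add_neg]

lemma expNeg_le_one (x : ℝ≥0∞) : expNeg x ≤ 1 := by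
  rw [expNeg, EReal.exp_le_one_iff, EReal.neg_le_zero]
  exact EReal.coe_ennreal_nonneg x

lemma continuous_expNeg : Continuous expNeg :=
  EReal.expHomeomorph.continuous.comp (continuous_neg.comp continuous_coe_ennreal_ereal)

lemma measurable_expNeg : Measurable expNeg := continuous_expNeg.measurable

lemma expNeg_sum {ι : Type*} (s : Finset ι) (f : ι → ℝ≥0∞) :
    expNeg (∑ i ∈ s, f i) = ∏ i ∈ s, expNeg (f i) := by
  classical
  induction s using Finset.induction_on with
  | empty => simp [expNeg_zero]
  | insert a s ha ih => rw [Finset.sum_insert ha, Finset.prod_insert ha, expNeg_add, ih]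

/-! ### Infinite products of numbers in `[0, 1]` -/

/-- Infinite product of a sequence with values in `[0, 1]`. -/
def iprod (f : ℕ → ℝ≥0∞) : ℝ≥0∞ := ⨅ N, ∏ m ∈ Finset.range N, f m

lemma antitone_prod_range {f : ℕ → ℝ≥0∞} (hf : ∀ m, f m ≤ 1) :
    Antitone fun N => ∏ m ∈ Finset.range N, f m :=
  antitone_nat_of_succ_le fun N => by
    rw [Finset.prod_range_succ]; exact mul_le_of_le_one_right' (hf N)

lemma prod_le_one_ennreal {ι : Type*} (s : Finset ι) {f : ι → ℝ≥0∞} (hf : ∀ m, f m ≤ 1) :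
    ∏ m ∈ s, f m ≤ 1 := Finset.prod_le_one' fun m _ => hf m

lemma iprod_le_one {f : ℕ → ℝ≥0∞} : iprod f ≤ 1 := (iInf_le _ 0).trans (by simp)

lemma tendsto_iprod {f : ℕ → ℝ≥0∞} (hf : ∀ m, f m ≤ 1) :
    Tendsto (fun N => ∏ m ∈ Finset.range N, f m) atTop (𝓝 (iprod f)) :=
  tendsto_atTop_iInf (antitone_prod_range hf)

lemma iprod_mono {f g : ℕ → ℝ≥0∞} (h : ∀ m, f m ≤ g m) : iprod f ≤ iprod g :=
  iInf_mono fun _ => Finset.prod_le_prod' fun m _ => h m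

lemma iprod_mul {f g : ℕ → ℝ≥0∞} (hf : ∀ m, f m ≤ 1) (hg : ∀ m, g m ≤ 1) :
    iprod (fun m => f m * g m) = iprod f * iprod g := by
  refine tendsto_nhds_unique (tendsto_iprod fun m => mul_le_one' (hf m) (hg m)) ?_
  simp_rw [Finset.prod_mul_distrib]
  exact ENNReal.Tendsto.mul (tendsto_iprod hf)
    (Or.inr (iprod_le_one.trans_lt ENNReal.one_lt_top).ne) (tendsto_iprod hg)
    (Or.inr (iprod_le_one.trans_lt ENNReal.one_lt_top).ne)

lemma iprod_one : iprod (fun _ => 1) = 1 := by simp [iprod]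

open Classical in
/-- Indicator of a proposition. -/
def ind (q : Prop) : ℝ≥0∞ := if q then 1 else 0

lemma ind_le_one (q : Prop) : ind q ≤ 1 := by unfold ind; split_ifs <;> simp

lemma ind_true {q : Prop} (h : q) : ind q = 1 := if_pos h

lemma ind_false {q : Prop} (h : ¬ q) : ind q = 0 := if_neg h

lemma ind_mono {q r : Prop} (h : q → r) : ind q ≤ ind r := by
  by_cases hq : q
  · rw [ind_true hq, ind_true (h hq)]
  · rw [ind_false hq]; exact zero_le

lemma ind_and (q r : Prop) : ind (q ∧ r) = ind q * ind r := by
  by_cases hq : q <;> by_cases hr : r <;> simp [ind, hq, hr]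

lemma iprod_ind (q : ℕ → Prop) : iprod (fun m => ind (q m)) = ind (∀ m, q m) := by
  by_cases h : ∀ m, q m
  · simp [ind_true h, ind_true (h _), iprod_one]
  · rw [ind_false h]
    push Not at h
    obtain ⟨m, hm⟩ := h
    refine le_antisymm ((iInf_le _ (m + 1)).trans ?_) (zero_le)
    rw [Finset.prod_eq_zero (Finset.self_mem_range_succ m) (ind_false hm)]

/-- Continuity of `expNeg` at ∞ is what lets this hold for divergent sums too: an infinite
interference gives a vanishing product. -/
lemma expNeg_tsum (f : ℕ → ℝ≥0∞) : expNeg (∑' m, f m) = iprod fun m => expNeg (f m) := by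
  refine tendsto_nhds_unique ?_ (tendsto_iprod fun m => expNeg_le_one _)
  simp_rw [← expNeg_sum]
  exact (continuous_expNeg.tendsto _).comp (ENNReal.tendsto_nat_tsum f)

/-- A product all but finitely many of whose factors are `1` is a finite product. -/
lemma iprod_eq_prod {f : ℕ → ℝ≥0∞} (hf : ∀ m, f m ≤ 1) (s : Finset ℕ) (h : ∀ m ∉ s, f m = 1) :
    iprod f = ∏ m ∈ s, f m := by
  refine tendsto_nhds_unique (tendsto_iprod hf) (tendsto_atTop_of_eventually_const
    (i₀ := s.sup id + 1) fun N hN => ?_)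
  symm
  refine Finset.prod_subset (fun m hm => Finset.mem_range.2 ?_) fun m _ hm => h m hm
  have := Finset.le_sup (f := id) hm
  simp only [id] at this
  lia

/-- Infinite products commute with decreasing limits. -/
lemma iprod_iInf {f : ℕ → ℕ → ℝ≥0∞} (hf : ∀ j m, f j m ≤ 1) (hanti : Antitone f) :
    iprod (fun m => ⨅ j, f j m) = ⨅ j, iprod (f j) := by
  simp only [iprod]
  rw [iInf_comm]
  refine iInf_congr fun N => ?_
  refine tendsto_nhds_unique (ENNReal.tendsto_finsetProd_of_ne_top _ (fun m _ =>
    tendsto_atTop_iInf fun i j hij => hanti hij m) fun m _ =>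
      ((iInf_le (fun j => f j m) 0).trans_lt ((hf 0 m).trans_lt ENNReal.one_lt_top)).ne) ?_
  exact tendsto_atTop_iInf fun i j hij => Finset.prod_le_prod' fun m _ => hanti hij m

@[fun_prop]
lemma _root_.Measurable.iprod {α : Type*} [MeasurableSpace α] {f : ℕ → α → ℝ≥0∞}
    (hf : ∀ m, Measurable (f m)) : Measurable fun a => IAB.iprod fun m => f m a :=
  Measurable.iInf fun _ => Finset.measurable_prod _ fun m _ => hf m

@[fun_prop]
lemma _root_.Measurable.expNeg {α : Type*} [MeasurableSpace α] {f : α → ℝ≥0∞}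
    (hf : Measurable f) : Measurable fun a => IAB.expNeg (f a) := measurable_expNeg.comp hf

lemma measurable_ind {α : Type*} [MeasurableSpace α] {q : α → Prop}
    (hq : MeasurableSet {a | q a}) : Measurable fun a => ind (q a) := by
  classical
  exact Measurable.ite hq measurable_const measurable_const

lemma lintegral_ind {α : Type*} [MeasurableSpace α] (μ : Measure α) {q : α → Prop}
    (hq : MeasurableSet {a | q a}) : ∫⁻ a, ind (q a) ∂μ = μ {a | q a} := by
  have : (fun a => ind (q a)) = {a | q a}.indicator 1 := by
    ext a; by_cases h : q a <;> simp [ind, h]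
  rw [this, lintegral_indicator_one hq]

lemma lintegral_iprod_eq_iInf {α : Type*} [MeasurableSpace α] (μ : Measure α) [IsFiniteMeasure μ]
    {f : ℕ → α → ℝ≥0∞} (hf : ∀ m, Measurable (f m)) (hf1 : ∀ m a, f m a ≤ 1) :
    ∫⁻ a, iprod (fun m => f m a) ∂μ = ⨅ N, ∫⁻ a, ∏ m ∈ Finset.range N, f m a ∂μ := by
  simp only [iprod]
  rw [lintegral_iInf (fun N => Finset.measurable_prod _ fun m _ => hf m)
    (fun i j hij a => antitone_prod_range (fun m => hf1 m a) hij)]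
  simp

/-! ### Independence -/

section indep

variable {Ω : Type*} [MeasurableSpace Ω] {P : Measure Ω} [IsProbabilityMeasure P]

/-- The joint law is the product of the marginals, so `B` may be resampled on an independent copy
`ω'` of the probability space. All integrals stay over `P`. -/
lemma lintegral_comp_indepFun {α β : Type*} [MeasurableSpace α] [MeasurableSpace β]
    {A : Ω → α} {B : Ω → β} (hA : Measurable A) (hB : Measurable B) (h : IndepFun A B P)
    {f : α → β → ℝ≥0∞} (hf : Measurable (Function.uncurry f)) :
    ∫⁻ ω, f (A ω) (B ω) ∂P = ∫⁻ ω, ∫⁻ ω', f (A ω) (B ω') ∂P ∂P := by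
  have h1 := (indepFun_iff_map_prod_eq_prod_map_map hA.aemeasurable hB.aemeasurable).1 h
  have : IsProbabilityMeasure (P.map A) := Measure.isProbabilityMeasure_map hA.aemeasurable
  have : IsProbabilityMeasure (P.map B) := Measure.isProbabilityMeasure_map hB.aemeasurable
  calc ∫⁻ ω, f (A ω) (B ω) ∂P = ∫⁻ z, Function.uncurry f z ∂(P.map fun ω => (A ω, B ω)) := by
        rw [lintegral_map hf (hA.prodMk hB)]; rfl
    _ = ∫⁻ a, ∫⁻ b, f a b ∂(P.map B) ∂(P.map A) := by
        rw [h1, lintegral_prod _ hf.aemeasurable]; rfl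
    _ = _ := by
        rw [lintegral_map (Measurable.lintegral_prod_right hf) hA]
        refine lintegral_congr fun ω => ?_
        exact lintegral_map (f := f (A ω)) (hf.comp measurable_prodMk_left) hB

/-- Suprema of independent σ-algebras over disjoint index sets, possibly infinite, are independent.
-/
lemma indepFun_restrict_compl {Ω : Type*} [MeasurableSpace Ω] {P : Measure Ω} {ι β : Type*} [MeasurableSpace β] {Z : ι → Ω → β}
    (hZ : ∀ i, Measurable (Z i)) (h : iIndepFun Z P) (S : Set ι) :
    IndepFun (fun ω (i : S) => Z i ω) (fun ω (i : (Sᶜ : Set ι)) => Z i ω) P := by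
  have key := indep_iSup_of_disjoint (fun i => (hZ i).comap_le) h.iIndep
    (disjoint_compl_right (a := S))
  rw [IndepFun_iff_Indep]
  convert key using 1
  · simp only [MeasurableSpace.pi, MeasurableSpace.comap_iSup, MeasurableSpace.comap_comp,
      iSup_subtype']; rfl
  · simp only [MeasurableSpace.pi, MeasurableSpace.comap_iSup, MeasurableSpace.comap_comp,
      iSup_subtype']; rfl

/-- Independent factors of an infinite product may be averaged separately, given `W`. -/
lemma lintegral_mul_prod_iprod_indep {ι β γ κ : Type*} [Fintype κ] [MeasurableSpace β]
    [MeasurableSpace γ]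
    {Z : ι → Ω → β} (hZ : ∀ i, Measurable (Z i)) (h : iIndepFun Z P) (S : Set ι)
    {W : (S → β) → γ} (hW : Measurable W) (e : κ × ℕ → ι) (he : Function.Injective e)
    {G : γ → ℝ≥0∞} (hG : Measurable G) (hG1 : ∀ w, G w ≤ 1)
    {f : κ → ℕ → γ → β → ℝ≥0∞} (hf : ∀ c m, Measurable (Function.uncurry (f c m)))
    (hf1 : ∀ c m w z, f c m w z ≤ 1) (hfS : ∀ c m, e (c, m) ∈ S → ∀ w z, f c m w z = 1) :
    ∫⁻ ω, G (W fun i => Z i ω) *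
        ∏ c, iprod (fun m => f c m (W fun i => Z i ω) (Z (e (c, m)) ω)) ∂P =
      ∫⁻ ω, G (W fun i => Z i ω) *
        ∏ c, iprod (fun m => ∫⁻ ω', f c m (W fun i => Z i ω) (Z (e (c, m)) ω') ∂P) ∂P := by
  classical
  set V : Ω → γ := fun ω => W fun i => Z i ω with hV
  have hVm : Measurable V := hW.comp (measurable_pi_iff.2 fun i => hZ i)
  -- Factors lie in [0, 1], so each infinite product is a decreasing limit of finite ones. The
  -- identity is proved for finite products and passed to the limit on both sides.
  have hprod : ∀ (g : κ → ℕ → ℝ≥0∞), (∀ c m, g c m ≤ 1) → ∀ a : ℝ≥0∞, a ≤ 1 →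
      a * ∏ c, iprod (g c) = ⨅ N, a * ∏ c, ∏ m ∈ Finset.range N, g c m := by
    intro g hg a ha
    refine tendsto_nhds_unique (ENNReal.Tendsto.const_mul (ENNReal.tendsto_finsetProd_of_ne_top _
      (fun c _ => tendsto_iprod (hg c)) fun c _ => (iprod_le_one.trans_lt ENNReal.one_lt_top).ne)
      (Or.inr (ha.trans_lt ENNReal.one_lt_top).ne)) (tendsto_atTop_iInf fun i j hij => ?_)
    exact mul_le_mul_right (Finset.prod_le_prod' fun c _ => antitone_prod_range (hg c) hij) _
  have hf1' : ∀ c m w, ∫⁻ ω', f c m w (Z (e (c, m)) ω') ∂P ≤ 1 := fun c m w =>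
    (lintegral_mono fun _ => hf1 c m w _).trans (by simp)
  have hmeas' : ∀ c m, Measurable fun w => ∫⁻ ω', f c m w (Z (e (c, m)) ω') ∂P := fun c m =>
    Measurable.lintegral_prod_right' (f := fun z : γ × Ω => f c m z.1 (Z (e (c, m)) z.2))
      ((hf c m).comp (measurable_fst.prodMk ((hZ _).comp measurable_snd)))
  have e1 : ∀ ω, G (V ω) * ∏ c, iprod (fun m => f c m (V ω) (Z (e (c, m)) ω)) =
      ⨅ N, G (V ω) * ∏ c, ∏ m ∈ Finset.range N, f c m (V ω) (Z (e (c, m)) ω) := fun ω =>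
    hprod (fun c m => f c m (V ω) (Z (e (c, m)) ω)) (fun c m => hf1 _ _ _ _) _ (hG1 _)
  have e2 : ∀ ω, G (V ω) * ∏ c, iprod (fun m => ∫⁻ ω', f c m (V ω) (Z (e (c, m)) ω') ∂P) =
      ⨅ N, G (V ω) * ∏ c, ∏ m ∈ Finset.range N, ∫⁻ ω', f c m (V ω) (Z (e (c, m)) ω') ∂P :=
    fun ω => hprod (fun c m => ∫⁻ ω', f c m (V ω) (Z (e (c, m)) ω') ∂P)
      (fun c m => hf1' _ _ _) _ (hG1 _)
  have hm1 : ∀ c m, Measurable fun ω => f c m (V ω) (Z (e (c, m)) ω) := fun c m =>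
    (hf c m).comp (hVm.prodMk (hZ _))
  have hfin : ∀ (a : ℝ≥0∞) (g : κ → ℕ → ℝ≥0∞) (N : ℕ), a ≤ 1 → (∀ c m, g c m ≤ 1) →
      a * ∏ c, ∏ m ∈ Finset.range N, g c m ≤ 1 := fun a g N ha hg =>
    mul_le_one' ha (Finset.prod_le_one' fun c _ => prod_le_one_ennreal _ (hg c))
  have hanti : ∀ (a : ℝ≥0∞) (g : κ → ℕ → ℝ≥0∞), (∀ c m, g c m ≤ 1) →
      Antitone fun N => a * ∏ c, ∏ m ∈ Finset.range N, g c m := fun a g hg i j hij =>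
    mul_le_mul_right (Finset.prod_le_prod' fun c _ => antitone_prod_range (hg c) hij) _
  change ∫⁻ ω, G (V ω) * ∏ c, iprod (fun m => f c m (V ω) (Z (e (c, m)) ω)) ∂P =
    ∫⁻ ω, G (V ω) * ∏ c, iprod (fun m => ∫⁻ ω', f c m (V ω) (Z (e (c, m)) ω') ∂P) ∂P
  rw [lintegral_congr e1, lintegral_congr e2]
  rw [lintegral_iInf (f := fun N ω => G (V ω) * ∏ c, ∏ m ∈ Finset.range N,
        f c m (V ω) (Z (e (c, m)) ω)) (fun N => (hG.comp hVm).mul (Finset.measurable_prod _ fun c _ =>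
      Finset.measurable_prod _ fun m _ => hm1 c m)) (fun i j hij ω => hanti (G (V ω))
        (fun c m => f c m (V ω) (Z (e (c, m)) ω)) (fun c m => hf1 _ _ _ _) hij)
      (((lintegral_mono fun ω => hfin _ _ _ (hG1 _) fun c m => hf1 _ _ _ _).trans_lt
        (by simp)).ne),
    lintegral_iInf (f := fun N ω => G (V ω) * ∏ c, ∏ m ∈ Finset.range N,
        ∫⁻ ω', f c m (V ω) (Z (e (c, m)) ω') ∂P) (fun N => (hG.comp hVm).mul (Finset.measurable_prod _ fun c _ =>
      Finset.measurable_prod _ fun m _ => (hmeas' c m).comp hVm)) (fun i j hij ω => hanti (G (V ω))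
        (fun c m => ∫⁻ ω', f c m (V ω) (Z (e (c, m)) ω') ∂P) (fun c m => hf1' _ _ _) hij)
      (((lintegral_mono fun ω => hfin _ _ _ (hG1 _) fun c m => hf1' _ _ _).trans_lt
        (by simp)).ne)]
  refine iInf_congr fun N => ?_
  let J : Finset (κ × ℕ) := Finset.univ ×ˢ Finset.range N
  have hJ : ∀ g : κ → ℕ → ℝ≥0∞, ∏ c, ∏ m ∈ Finset.range N, g c m = ∏ j ∈ J, g j.1 j.2 := fun g =>
    (Finset.prod_product' Finset.univ (Finset.range N) g).symm
  simp_rw [hJ]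
  -- rewrite the factors in terms of the coordinates outside `S`
  let F : κ × ℕ → γ → ((Sᶜ : Set ι) → β) → ℝ≥0∞ := fun j w z =>
    if hj : e j ∈ S then 1 else f j.1 j.2 w (z ⟨e j, hj⟩)
  have hF : ∀ j w ω, f j.1 j.2 w (Z (e j) ω) = F j w fun i => Z i ω := by
    intro j w ω
    by_cases hj : e j ∈ S
    · simp only [F, hj, dite_true]; exact hfS _ _ hj _ _
    · simp [F, hj]
  have hFm : ∀ j, Measurable (Function.uncurry (F j)) := by
    intro j
    by_cases hj : e j ∈ S
    · simp only [F, hj, dite_true]; exact measurable_const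
    · have : Function.uncurry (F j) = fun p => f j.1 j.2 p.1 (p.2 ⟨e j, hj⟩) := by
        ext p; simp [F, hj, Function.uncurry]
      rw [this]
      exact (hf j.1 j.2).comp (measurable_fst.prodMk ((measurable_pi_apply _).comp measurable_snd))
  -- `V` depends only on the coordinates in `S`, and the functions `F j` only on those outside.
  have hind : IndepFun V (fun ω (i : (Sᶜ : Set ι)) => Z i ω) P :=
    (indepFun_restrict_compl hZ h S).comp hW measurable_id
  have step : ∫⁻ ω, G (V ω) * ∏ j ∈ J, f j.1 j.2 (V ω) (Z (e j) ω) ∂P =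
      ∫⁻ ω, ∫⁻ ω', G (V ω) * ∏ j ∈ J, F j (V ω) (fun i => Z i ω') ∂P ∂P := by
    simp_rw [hF]
    refine lintegral_comp_indepFun (B := fun ω (i : (Sᶜ : Set ι)) => Z i ω) hVm
      (measurable_pi_iff.2 fun i => hZ i) hind
      (f := fun w z => G w * ∏ j ∈ J, F j w z) ?_
    exact (hG.comp measurable_fst).mul (Finset.measurable_prod _ fun j _ => hFm j)
  refine step.trans (lintegral_congr fun ω => ?_)
  simp_rw [← hF]
  rw [lintegral_const_mul _ (Finset.measurable_prod _ fun j _ =>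
    (hf j.1 j.2).comp (measurable_const.prodMk (hZ _)))]
  congr 1
  refine lintegral_prod_eq_prod_lintegral_of_indepFun J
    (fun j ω' => f j.1 j.2 (V ω) (Z (e j) ω')) ?_
    (fun j => (hf j.1 j.2).comp (measurable_const.prodMk (hZ _)))
  -- Injectivity of `e` attaches distinct, hence independent, coordinates to distinct factors.
  exact (h.precomp he).comp (fun j => f j.1 j.2 (V ω))
    fun j => (hf j.1 j.2).comp measurable_prodMk_left

lemma lintegral_iprod_indep {β : Type*} [MeasurableSpace β]
    {Z : ℕ → Ω → β} (hZ : ∀ i, Measurable (Z i)) (h : iIndepFun Z P)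
    {f : ℕ → β → ℝ≥0∞} (hf : ∀ m, Measurable (f m)) (hf1 : ∀ m z, f m z ≤ 1) :
    ∫⁻ ω, iprod (fun m => f m (Z m ω)) ∂P = iprod fun m => ∫⁻ ω, f m (Z m ω) ∂P := by
  rw [lintegral_iprod_eq_iInf P (f := fun m ω => f m (Z m ω)) (fun m => (hf m).comp (hZ m))
    fun m ω => hf1 m _]
  refine iInf_congr fun N => ?_
  exact lintegral_prod_eq_prod_lintegral_of_indepFun _ (fun m ω => f m (Z m ω))
    (h.comp f hf) fun m => (hf m).comp (hZ m)

end indep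

end IAB

namespace IAB

open Filter Topology

/-! ### Point counts -/

lemma iprod_finset_prod {ι : Type*} (s : Finset ι) {f : ι → ℕ → ℝ≥0∞} (hf : ∀ i m, f i m ≤ 1) :
    iprod (fun m => ∏ i ∈ s, f i m) = ∏ i ∈ s, iprod (f i) := by
  classical
  induction s using Finset.induction_on with
  | empty => simp [iprod_one]
  | insert a s ha ih =>
    simp_rw [Finset.prod_insert ha]
    rw [iprod_mul (hf a) fun m => prod_le_one_ennreal s fun i => hf i m, ih]

lemma iprod_ite_mem {S : Set ℕ} [DecidablePred (· ∈ S)] (hS : S.Finite) {c : ℝ≥0∞} (hc : c ≤ 1) :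
    iprod (fun m => if m ∈ S then c else 1) = c ^ S.ncard := by
  rw [iprod_eq_prod (fun m => by split_ifs <;> simp [hc]) hS.toFinset fun m hm => by
    simp at hm; simp [hm]]
  rw [Finset.prod_congr rfl (g := fun _ => c) fun m hm => by simp at hm; simp [hm]]
  rw [Finset.prod_const, Set.ncard_eq_toFinset_card _ hS]

lemma measurable_ind_mem {α : Type*} [MeasurableSpace α] {B : Set α} (hB : MeasurableSet B) :
    Measurable fun a => ind (a ∈ B) := measurable_ind (q := fun a => a ∈ B) hB

lemma lintegral_ind_mem {α : Type*} [MeasurableSpace α] (μ : Measure α) {B : Set α}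
    (hB : MeasurableSet B) : ∫⁻ a, ind (a ∈ B) ∂μ = μ B :=
  (lintegral_ind μ (q := fun a => a ∈ B) hB).trans rfl

lemma countingMeasure_apply {Ω : Type*} (X : ℕ → Ω → Plane) (ω : Ω) {B : Set Plane}
    (hB : MeasurableSet B) : countingMeasure X ω B = ∑' n, ind (X n ω ∈ B) := by
  rw [countingMeasure, Measure.sum_apply _ hB]
  congr 1; ext n
  rw [Measure.dirac_apply' _ hB]
  by_cases h : X n ω ∈ B <;> simp [ind, h]

lemma countingMeasure_of_finite {Ω : Type*} (X : ℕ → Ω → Plane) (ω : Ω) {B : Set Plane}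
    (hB : MeasurableSet B) (h : {n | X n ω ∈ B}.Finite) :
    countingMeasure X ω B = ({n | X n ω ∈ B}.ncard : ℝ≥0∞) := by
  rw [countingMeasure_apply X ω hB, tsum_eq_sum (s := h.toFinset) fun n hn => by
    simp at hn; simp [ind, hn]]
  rw [Finset.sum_congr rfl (g := fun _ => 1) fun m hm => by simp at hm; simp [ind, hm]]
  rw [Finset.sum_const, Set.ncard_eq_toFinset_card _ h]; simp

lemma finite_of_countingMeasure_ne_top {Ω : Type*} (X : ℕ → Ω → Plane) (ω : Ω) {B : Set Plane}
    (hB : MeasurableSet B) (h : countingMeasure X ω B ≠ ∞) : {n | X n ω ∈ B}.Finite := by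
  rw [countingMeasure_apply X ω hB] at h
  refine (ENNReal.finite_const_le_of_tsum_ne_top h one_ne_zero).subset fun n hn => ?_
  simp only [mem_ofPred_eq] at hn ⊢
  rw [ind_true hn]

/-! ### Poisson sums -/

lemma hasSum_poisson_pow (a c : ℝ) :
    HasSum (fun k : ℕ => c ^ k * (Real.exp (-a) * a ^ k / (k.factorial : ℝ)))
      (Real.exp (-(a * (1 - c)))) := by
  have h := (NormedSpace.expSeries_div_hasSum_exp (c * a)).mul_left (Real.exp (-a))
  rw [← Real.exp_eq_exp_ℝ, ← Real.exp_add] at h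
  have e : -a + c * a = -(a * (1 - c)) := by ring
  rw [e] at h
  refine h.congr_fun fun k => ?_
  rw [mul_pow]; ring

/-- The derivative in `c` of the generating function. The weight k c^(k-1) comes from choosing one
of k points and multiplying over the others. The term k = 0 vanishes, so the series is the previous
one shifted by one. -/
lemma hasSum_poisson_deriv (a c : ℝ) :
    HasSum (fun k : ℕ => (k * c ^ (k - 1)) * (Real.exp (-a) * a ^ k / (k.factorial : ℝ)))
      (a * Real.exp (-(a * (1 - c)))) := by
  rw [← hasSum_nat_add_iff' 1]
  simp only [Finset.range_one, Finset.sum_singleton, Nat.cast_zero, zero_mul, sub_zero]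
  refine ((hasSum_poisson_pow a c).mul_left a).congr_fun fun k => ?_
  rw [Nat.factorial_succ, pow_succ]
  have : ((k : ℝ) + 1) ≠ 0 := by positivity
  have : (k.factorial : ℝ) ≠ 0 := by positivity
  push_cast
  field_simp

variable {Ω : Type*} [MeasurableSpace Ω] {P : Measure Ω} {X : ℕ → Ω → Plane} {lam : ℝ}

section poisson

lemma IsPoissonProcess.measurable_count (h : IsPoissonProcess X lam P) {B : Set Plane}
    (hB : MeasurableSet B) : Measurable fun ω => countingMeasure X ω B := by
  simp_rw [countingMeasure_apply X _ hB]
  exact Measurable.tsum fun n => measurable_ind (h.measurable n hB)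

/-- The natural number underlying a point count. -/
def natCount (N : ℝ≥0∞) : ℕ := ⌊N.toReal⌋₊

lemma natCount_natCast (k : ℕ) : natCount k = k := by simp [natCount]

lemma measurable_natCount : Measurable natCount :=
  Nat.measurable_floor.comp ENNReal.measurable_toReal

variable [IsProbabilityMeasure P]

/-- The Poisson weights sum to one, which leaves no mass for an infinite count. -/
lemma IsPoissonProcess.ae_count (h : IsPoissonProcess X lam P) (hlam : 0 ≤ lam) {B : Set Plane}
    (hB : MeasurableSet B) (hv : volume B ≠ ∞) :
    ∀ᵐ ω ∂P, ∃ k : ℕ, countingMeasure X ω B = k := by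
  have hm := h.measurable_count hB
  have hk : ∀ k : ℕ, MeasurableSet {ω | countingMeasure X ω B = k} := fun k =>
    hm (measurableSet_singleton _)
  have : P (⋃ k : ℕ, {ω | countingMeasure X ω B = k}) = 1 := by
    rw [measure_iUnion ?_ hk]
    · simp_rw [h.law B hB hv]
      have hs := hasSum_poisson_pow (lam * (volume B).toReal) 1
      rw [← ENNReal.ofReal_tsum_of_nonneg (fun k => by positivity) (by simpa using hs.summable)]
      have := hs.tsum_eq
      simp only [one_pow, one_mul, sub_self, mul_zero, neg_zero, Real.exp_zero] at this
      rw [this, ENNReal.ofReal_one]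
    · intro i j hij
      refine Set.disjoint_left.2 fun ω h1 h2 => hij ?_
      simp only [mem_ofPred_eq] at h1 h2
      exact_mod_cast h1.symm.trans h2
  rw [← prob_compl_eq_zero_iff (MeasurableSet.iUnion hk)] at this
  rw [ae_iff]
  convert this using 2
  ext ω; simp

lemma IsPoissonProcess.lintegral_count (h : IsPoissonProcess X lam P) (hlam : 0 ≤ lam)
    {B : Set Plane} (hB : MeasurableSet B) (hv : volume B ≠ ∞) (φ : ℕ → ℝ≥0∞) :
    ∫⁻ ω, φ (natCount (countingMeasure X ω B)) ∂P =
      ∑' k : ℕ, φ k * ENNReal.ofReal (Real.exp (-(lam * (volume B).toReal)) *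
        (lam * (volume B).toReal) ^ k / (k.factorial : ℝ)) := by
  have hm := h.measurable_count hB
  have hk : ∀ k : ℕ, MeasurableSet {ω | countingMeasure X ω B = k} := fun k =>
    hm (measurableSet_singleton _)
  have e : ∀ᵐ ω ∂P, φ (natCount (countingMeasure X ω B)) =
      ∑' k : ℕ, φ k * ind (countingMeasure X ω B = k) := by
    filter_upwards [h.ae_count hlam hB hv] with ω hω
    obtain ⟨k, hk⟩ := hω
    rw [hk, natCount_natCast, tsum_eq_single k, ind_true rfl, mul_one]
    intro j hj
    rw [ind_false (fun hjk => hj (by exact_mod_cast hjk.symm)), mul_zero]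
  rw [lintegral_congr_ae e, lintegral_tsum fun k => ((measurable_ind (hk k)).const_mul _).aemeasurable]
  refine tsum_congr fun k => ?_
  rw [lintegral_const_mul _ (measurable_ind (hk k)), lintegral_ind _ (hk k), h.law B hB hv]

/-- These are the Laplace functional and the Mecke formula in the simplest case, a constant factor
`c` for each point of `B` and a tagged point in `B`. -/
lemma IsPoissonProcess.lintegral_pow (h : IsPoissonProcess X lam P) (hlam : 0 ≤ lam)
    {B : Set Plane} (hB : MeasurableSet B) (hv : volume B ≠ ∞) {c : ℝ≥0∞} (hc : c ≤ 1) :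
    ∫⁻ ω, c ^ natCount (countingMeasure X ω B) ∂P =
        expNeg (ENNReal.ofReal lam * (volume B * (1 - c))) ∧
    ∫⁻ ω, natCount (countingMeasure X ω B) * c ^ (natCount (countingMeasure X ω B) - 1) ∂P =
      ENNReal.ofReal lam * volume B * expNeg (ENNReal.ofReal lam * (volume B * (1 - c))) := by
  have hct : c ≠ ∞ := (hc.trans_lt ENNReal.one_lt_top).ne
  obtain ⟨c, rfl⟩ : ∃ r : ℝ, c = ENNReal.ofReal r := ⟨c.toReal, (ENNReal.ofReal_toReal hct).symm⟩
  wlog hc0 : 0 ≤ c generalizing c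
  · have := this 0 (by simp) (by simp) le_rfl
    rw [ENNReal.ofReal_of_nonpos (not_le.1 hc0).le]
    simpa using this
  have hc1 : c ≤ 1 := by simpa using hc
  set v := (volume B).toReal with hvdef
  have hvol : volume B = ENNReal.ofReal v := (ENNReal.ofReal_toReal hv).symm
  have hv0 : 0 ≤ v := ENNReal.toReal_nonneg
  have e1 : ENNReal.ofReal lam * (volume B * (1 - ENNReal.ofReal c)) =
      ENNReal.ofReal (lam * v * (1 - c)) := by
    rw [hvol, ← ENNReal.ofReal_one, ← ENNReal.ofReal_sub _ hc0, ← ENNReal.ofReal_mul hv0,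
      ← ENNReal.ofReal_mul hlam, mul_assoc]
  have hnn : 0 ≤ lam * v * (1 - c) := by
    have := sub_nonneg.2 hc1; positivity
  rw [e1, expNeg_ofReal hnn]
  constructor
  · rw [h.lintegral_count hlam hB hv fun k => ENNReal.ofReal c ^ k]
    have hs := hasSum_poisson_pow (lam * v) c
    rw [← hs.tsum_eq, ENNReal.ofReal_tsum_of_nonneg (fun k => by positivity) hs.summable]
    refine tsum_congr fun k => ?_
    rw [← ENNReal.ofReal_pow hc0, ← ENNReal.ofReal_mul (by positivity)]
  · rw [h.lintegral_count hlam hB hv fun k => k * ENNReal.ofReal c ^ (k - 1)]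
    have hs := hasSum_poisson_deriv (lam * v) c
    rw [← hvdef, hvol, ← ENNReal.ofReal_mul hlam, ← ENNReal.ofReal_mul (by positivity), ← hs.tsum_eq,
      ENNReal.ofReal_tsum_of_nonneg (fun k => by positivity) hs.summable]
    refine tsum_congr fun k => ?_
    rw [← ENNReal.ofReal_pow hc0, ← ENNReal.ofReal_natCast, ← ENNReal.ofReal_mul (by positivity),
      ← ENNReal.ofReal_mul (by positivity)]

lemma IsPoissonProcess.iIndepFun_count {P : Measure Ω} (h : IsPoissonProcess X lam P) {ι : Type*} [Fintype ι]
    {D : ι → Set Plane} (hD : ∀ i, MeasurableSet (D i))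
    (hdisj : Pairwise fun i j => Disjoint (D i) (D j)) :
    iIndepFun (fun i ω => countingMeasure X ω (D i)) P := by
  let e := Fintype.equivFin ι
  have := (h.indep (Fintype.card ι) (fun i => D (e.symm i)) (fun i => hD _)
    fun i j hij => hdisj fun hh => hij (e.symm.injective hh)).precomp e.injective
  simpa using this

/-- A step function equal to `c i` on `D i` and to `1` elsewhere. -/
def stepFun {ι : Type*} [Fintype ι] (D : ι → Set Plane) (c : ι → ℝ≥0∞) (y : Plane) : ℝ≥0∞ :=
  open Classical in ∏ i, if y ∈ D i then c i else 1

/-- With N_i the count of `D i`, the product over all points is ∏ c_i^{N_i}. The sum over tagged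
points of `D i₀` replaces the factor of `i₀` by N c^(N-1). Counts of disjoint sets are independent,
so both means factor into those of `lintegral_pow`. -/
lemma IsPoissonProcess.stepFun_formulas (h : IsPoissonProcess X lam P) (hlam : 0 ≤ lam)
    {ι : Type*} [Fintype ι] {D : ι → Set Plane} (hD : ∀ i, MeasurableSet (D i))
    (hdisj : Pairwise fun i j => Disjoint (D i) (D j)) (hv : ∀ i, volume (D i) ≠ ∞)
    {c : ι → ℝ≥0∞} (hc : ∀ i, c i ≤ 1) :
    ∫⁻ ω, iprod (fun m => stepFun D c (X m ω)) ∂P =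
        expNeg (ENNReal.ofReal lam * ∑ i, volume (D i) * (1 - c i)) ∧
    ∀ i₀, ∫⁻ ω, ∑' n, ind (X n ω ∈ D i₀) *
          iprod (fun m => if m = n then 1 else stepFun D c (X m ω)) ∂P =
        ENNReal.ofReal lam * volume (D i₀) *
          expNeg (ENNReal.ofReal lam * ∑ i, volume (D i) * (1 - c i)) := by
  classical
  have hfin : ∀ᵐ ω ∂P, ∀ i, {n | X n ω ∈ D i}.Finite := by
    rw [ae_all_iff]
    intro i
    filter_upwards [h.ae_count hlam (hD i) (hv i)] with ω ⟨k, hk⟩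
    exact finite_of_countingMeasure_ne_top X ω (hD i) (by rw [hk]; simp)
  have hcount : ∀ ω, (∀ i, {n | X n ω ∈ D i}.Finite) → ∀ i,
      natCount (countingMeasure X ω (D i)) = {n | X n ω ∈ D i}.ncard := fun ω hω i => by
    rw [countingMeasure_of_finite X ω (hD i) (hω i), natCount_natCast]
  have hind : ∀ φ : ι → ℕ → ℝ≥0∞,
      ∫⁻ ω, ∏ i, φ i (natCount (countingMeasure X ω (D i))) ∂P =
        ∏ i, ∫⁻ ω, φ i (natCount (countingMeasure X ω (D i))) ∂P := fun φ =>
    lintegral_prod_eq_prod_lintegral_of_indepFun Finset.univ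
      (fun i ω => φ i (natCount (countingMeasure X ω (D i))))
      ((h.iIndepFun_count hD hdisj).comp (fun i N => φ i (natCount N))
        fun i => (measurable_from_nat (f := φ i)).comp measurable_natCount)
      fun i => (measurable_from_nat (f := φ i)).comp
        (measurable_natCount.comp (h.measurable_count (hD i)))
  have hle : ∀ i y, (if y ∈ D i then c i else 1) ≤ 1 := fun i y => by
    split_ifs <;> simp [hc]
  constructor
  · rw [Finset.mul_sum, expNeg_sum]
    simp_rw [← fun i => (h.lintegral_pow hlam (hD i) (hv i) (hc i)).1]
    rw [← hind fun i k => c i ^ k]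
    refine lintegral_congr_ae ?_
    filter_upwards [hfin] with ω hω
    simp only [stepFun]
    rw [iprod_finset_prod _ fun i m => hle i (X m ω)]
    refine Finset.prod_congr rfl fun i _ => ?_
    rw [hcount ω hω i, ← iprod_ite_mem (hω i) (hc i)]
    rfl
  · intro i₀
    let φ : ι → ℕ → ℝ≥0∞ := fun i k => if i = i₀ then k * c i ^ (k - 1) else c i ^ k
    have hφ : ∀ i, ∫⁻ ω, φ i (natCount (countingMeasure X ω (D i))) ∂P =
        (if i = i₀ then ENNReal.ofReal lam * volume (D i₀) else 1) *
          expNeg (ENNReal.ofReal lam * (volume (D i) * (1 - c i))) := by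
      intro i
      by_cases hi : i = i₀
      · subst hi
        simp only [φ, if_true]
        exact (h.lintegral_pow hlam (hD i) (hv i) (hc i)).2
      · simp only [φ, hi, if_false, one_mul]
        exact (h.lintegral_pow hlam (hD i) (hv i) (hc i)).1
    have e2 := hind φ
    simp_rw [hφ] at e2
    rw [Finset.prod_mul_distrib, Finset.prod_ite_eq' Finset.univ i₀, if_pos (Finset.mem_univ _),
      ← expNeg_sum, ← Finset.mul_sum] at e2
    rw [← e2]
    refine lintegral_congr_ae ?_
    filter_upwards [hfin] with ω hω
    have hprod : ∀ n, X n ω ∈ D i₀ →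
        iprod (fun m => if m = n then 1 else stepFun D c (X m ω)) =
          ∏ i, if i = i₀ then c i ^ ({n | X n ω ∈ D i}.ncard - 1) else
            c i ^ {n | X n ω ∈ D i}.ncard := by
      intro n hn
      have : (fun m => if m = n then 1 else stepFun D c (X m ω)) = fun m => ∏ i,
          if m ∈ {k | X k ω ∈ D i} \ {n} then c i else 1 := by
        ext m
        by_cases hm : m = n <;> simp [hm, stepFun]
      rw [this, iprod_finset_prod _ fun i m => by split_ifs <;> simp [hc]]
      refine Finset.prod_congr rfl fun i _ => ?_
      rw [iprod_ite_mem ((hω i).sdiff) (hc i)]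
      -- Removing the tagged point lowers the count of `D i₀` by one; by disjointness the point lies
      -- in no other piece.
      by_cases hi : i = i₀
      · subst hi
        rw [if_pos rfl, Set.ncard_sdiff_singleton_of_mem (show n ∈ {n | X n ω ∈ D i} from hn)]
      · rw [if_neg hi, Set.sdiff_singleton_eq_self]
        exact fun hni => Set.disjoint_left.1 (hdisj hi) hni hn
    have e3 : ∀ n, ind (X n ω ∈ D i₀) *
          iprod (fun m => if m = n then 1 else stepFun D c (X m ω)) =
        ind (X n ω ∈ D i₀) * ∏ i, if i = i₀ then c i ^ ({n | X n ω ∈ D i}.ncard - 1) else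
            c i ^ {n | X n ω ∈ D i}.ncard := by
      intro n
      by_cases hn : X n ω ∈ D i₀
      · rw [hprod n hn]
      · rw [ind_false hn, zero_mul, zero_mul]
    simp_rw [e3]
    rw [ENNReal.tsum_mul_right, ← countingMeasure_apply X ω (hD i₀),
      countingMeasure_of_finite X ω (hD i₀) (hω i₀)]
    have e4 : ∀ i, φ i (natCount (countingMeasure X ω (D i))) =
        (if i = i₀ then ({n | X n ω ∈ D i₀}.ncard : ℝ≥0∞) else 1) *
        (if i = i₀ then c i ^ ({n | X n ω ∈ D i}.ncard - 1) else
            c i ^ {n | X n ω ∈ D i}.ncard) := by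
      intro i
      rw [hcount ω hω i]
      by_cases hi : i = i₀
      · subst hi; simp [φ]
      · simp [φ, hi]
    simp_rw [e4]
    rw [Finset.prod_mul_distrib, Finset.prod_ite_eq' Finset.univ i₀, if_pos (Finset.mem_univ _)]

/-- The level sets of `g`, cut by `B` and by `K`, are disjoint pieces of finite volume on which 1 -
`g` is constant. Outside `K` the factor is 1, so other points do not matter. -/
lemma IsPoissonProcess.simple_formulas (h : IsPoissonProcess X lam P) (hlam : 0 ≤ lam)
    (g : SimpleFunc Plane ℝ≥0∞) (hg : ∀ y, g y ≤ 1) {K : Set Plane} (hK : MeasurableSet K)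
    (hKv : volume K ≠ ∞) (hgK : ∀ y ∉ K, g y = 0) {B : Set Plane} (hB : MeasurableSet B)
    (hBK : B ⊆ K) :
    ∫⁻ ω, iprod (fun m => 1 - g (X m ω)) ∂P = expNeg (ENNReal.ofReal lam * ∫⁻ y, g y) ∧
    ∫⁻ ω, ∑' n, ind (X n ω ∈ B) * iprod (fun m => if m = n then 1 else 1 - g (X m ω)) ∂P =
      ENNReal.ofReal lam * volume B * expNeg (ENNReal.ofReal lam * ∫⁻ y, g y) := by
  classical
  let ι := g.range × Bool
  let D : ι → Set Plane := fun i => (g ⁻¹' {i.1.1} ∩ (if i.2 then B else Bᶜ)) ∩ K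
  let c : ι → ℝ≥0∞ := fun i => 1 - i.1.1
  have hD : ∀ i, MeasurableSet (D i) := by
    rintro ⟨v, b⟩
    refine ((g.measurableSet_preimage _).inter ?_).inter hK
    cases b <;> simp [hB]
  have hdisj : Pairwise fun i j => Disjoint (D i) (D j) := by
    rintro ⟨v, b⟩ ⟨v', b'⟩ hij
    refine Set.disjoint_left.2 fun y h1 h2 => hij ?_
    have hv : v.1 = v'.1 := h1.1.1.symm.trans h2.1.1
    have hb : b = b' := by
      have h3 := h1.1.2; have h4 := h2.1.2
      cases b <;> cases b' <;> simp_all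
    rw [Subtype.ext hv, hb]
  have hv : ∀ i, volume (D i) ≠ ∞ := fun i => measure_ne_top_of_subset inter_subset_right hKv
  have hc : ∀ i, c i ≤ 1 := fun i => tsub_le_self
  have hmem : ∀ y ∈ K, ∀ i : ι, y ∈ D i ↔ i = (⟨g y, g.mem_range_self y⟩, decide (y ∈ B)) := by
    rintro y hy ⟨⟨v, hv⟩, b⟩
    simp only [D, mem_inter_iff, mem_preimage, mem_singleton_iff, hy, and_true]
    rw [Prod.mk.injEq, Subtype.mk.injEq]
    refine and_congr eq_comm ?_
    cases b <;> simp
  have hstep : ∀ y, stepFun D c y = 1 - g y := by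
    intro y
    by_cases hy : y ∈ K
    · simp only [stepFun]
      simp_rw [hmem y hy]
      rw [Finset.prod_ite_eq' Finset.univ, if_pos (Finset.mem_univ _)]
    · have : ∀ i, y ∉ D i := fun i hi => hy hi.2
      simp [stepFun, this, hgK y hy]
  have hgle : ∀ i : ι, (i.1.1 : ℝ≥0∞) ≤ 1 := by
    rintro ⟨⟨v, hv⟩, b⟩
    obtain ⟨y, rfl⟩ := SimpleFunc.mem_range.1 hv
    exact hg y
  have hsum : ∑ i, volume (D i) * (1 - c i) = ∫⁻ y, g y := by
    have e : ∀ y, (g y : ℝ≥0∞) = ∑ i : ι, i.1.1 * (D i).indicator 1 y := by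
      intro y
      by_cases hy : y ∈ K
      · simp only [indicator_apply, hmem y hy, mul_ite, Pi.one_apply, mul_one, mul_zero]
        rw [Finset.sum_ite_eq' Finset.univ, if_pos (Finset.mem_univ _)]
      · have : ∀ i, y ∉ D i := fun i hi => hy hi.2
        simp [this, hgK y hy]
    rw [lintegral_congr e, lintegral_finsetSum _ fun i _ =>
      (measurable_one.indicator (hD i)).const_mul _]
    refine Finset.sum_congr rfl fun i _ => ?_
    rw [lintegral_const_mul _ (measurable_one.indicator (hD i)), lintegral_indicator_one (hD i),
      mul_comm, ENNReal.sub_sub_cancel ENNReal.one_ne_top (hgle i)]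
  obtain ⟨h1, h2⟩ := h.stepFun_formulas hlam hD hdisj hv hc
  simp_rw [hstep, hsum] at h1 h2
  refine ⟨h1, ?_⟩
  -- `B` is the disjoint union of the pieces flagged `true`; the formula for a tagged point in `B`
  -- is the sum of those for the pieces.
  have hBsum : ∀ y, ind (y ∈ B) = ∑ v : g.range, ind (y ∈ D (v, true)) := by
    intro y
    by_cases hy : y ∈ B
    · simp only [hmem y (hBK hy), ind_true hy]
      rw [Finset.sum_eq_single ⟨g y, g.mem_range_self y⟩]
      · rw [ind_true]
        rw [Prod.mk.injEq]
        exact ⟨rfl, (decide_eq_true hy).symm⟩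
      · intro v _ hv
        rw [ind_false]
        rw [Prod.mk.injEq]
        exact fun hh => hv hh.1
      · simp
    · rw [ind_false hy, Finset.sum_eq_zero]
      intro v _
      exact ind_false fun hyD => hy (by simpa using hyD.1.2)
  have hBvol : volume B = ∑ v : g.range, volume (D (v, true)) := by
    rw [← lintegral_ind_mem volume hB]
    simp_rw [hBsum]
    rw [lintegral_finsetSum _ fun v _ => measurable_ind_mem (hD (v, true))]
    exact Finset.sum_congr rfl fun v _ => lintegral_ind_mem volume (hD (v, true))
  rw [hBvol, Finset.mul_sum, Finset.sum_mul]
  simp_rw [← h2]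
  have hm : ∀ n, Measurable fun ω => iprod fun m => if m = n then 1 else 1 - g (X m ω) := by
    intro n
    refine Measurable.iprod fun m => ?_
    by_cases hmn : m = n
    · simp [hmn]
    · simp only [hmn, if_false]
      exact measurable_const.sub (g.measurable.comp (h.measurable m))
  rw [← lintegral_finsetSum _ fun v _ => Measurable.tsum fun n =>
    (measurable_ind (h.measurable n (hD (v, true)))).fun_mul (hm n)]
  refine lintegral_congr fun ω => ?_
  rw [← Summable.tsum_finsetSum fun v _ => ENNReal.summable]
  refine tsum_congr fun n => ?_
  rw [← Finset.sum_mul, ← hBsum]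

end poisson

end IAB

namespace IAB

open Filter Topology

variable {Ω : Type*} [MeasurableSpace Ω] {P : Measure Ω} {X : ℕ → Ω → Plane} {lam : ℝ}

/-! ### Laplace functional and Mecke formula -/

lemma IsPoissonProcess.measurable_iprod_ne (h : IsPoissonProcess X lam P) {f : Plane → ℝ≥0∞}
    (hf : Measurable f) (n : ℕ) :
    Measurable fun ω => iprod fun m => if m = n then 1 else f (X m ω) := by
  refine Measurable.iprod fun m => ?_
  by_cases hmn : m = n
  · simp [hmn]
  · simp only [hmn, if_false]
    exact hf.comp (h.measurable m)

/-- Approximation of a function with values in `[0, 1]` by simple functions of bounded support. -/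
lemma exists_simpleFunc_approx {g : Plane → ℝ≥0∞} (hg : Measurable g) :
    ∃ s : ℕ → SimpleFunc Plane ℝ≥0∞, Monotone (fun j y => s j y) ∧ (∀ y, ⨆ j, s j y = g y) ∧
      ∀ j : ℕ, ∀ y ∉ Metric.closedBall (0 : Plane) j, s j y = 0 := by
  refine ⟨fun j => (SimpleFunc.eapprox g j).restrict (Metric.closedBall 0 j), ?_, ?_, ?_⟩
  · intro i j hij y
    simp only [SimpleFunc.restrict_apply _ Metric.isClosed_closedBall.measurableSet]
    by_cases hy : y ∈ Metric.closedBall (0 : Plane) i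
    · have hy' : y ∈ Metric.closedBall (0 : Plane) j :=
        Metric.closedBall_subset_closedBall (by exact_mod_cast hij) hy
      rw [indicator_of_mem hy, indicator_of_mem hy']
      exact SimpleFunc.monotone_eapprox g hij y
    · rw [indicator_of_notMem hy]; exact zero_le
  · intro y
    simp only [SimpleFunc.restrict_apply _ Metric.isClosed_closedBall.measurableSet]
    refine le_antisymm (iSup_le fun j => ?_) ?_
    · refine (indicator_le_self' (fun _ _ => zero_le) y).trans ?_
      rw [← SimpleFunc.iSup_eapprox_apply hg y]
      exact le_iSup (fun n => SimpleFunc.eapprox g n y) j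
    · rw [← SimpleFunc.iSup_eapprox_apply hg y]
      refine iSup_le fun j => ?_
      obtain ⟨k, hk⟩ := exists_nat_ge ‖y‖
      refine le_iSup_of_le (max j k) ?_
      rw [indicator_of_mem]
      · exact SimpleFunc.monotone_eapprox g (le_max_left j k) y
      · rw [mem_closedBall_zero_iff]
        exact hk.trans (by exact_mod_cast le_max_right j k)
  · intro j y hy
    rw [SimpleFunc.restrict_apply _ Metric.isClosed_closedBall.measurableSet,
      indicator_of_notMem hy]

lemma tendsto_expNeg_lintegral {s : ℕ → SimpleFunc Plane ℝ≥0∞}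
    (hs : Monotone fun j y => s j y) {g : Plane → ℝ≥0∞} (hsg : ∀ y, ⨆ j, s j y = g y) (lam : ℝ) :
    Tendsto (fun j => expNeg (ENNReal.ofReal lam * ∫⁻ y, s j y)) atTop
      (𝓝 (expNeg (ENNReal.ofReal lam * ∫⁻ y, g y))) := by
  refine (continuous_expNeg.tendsto _).comp (ENNReal.Tendsto.const_mul ?_ (Or.inr (by simp)))
  simp_rw [← hsg]
  rw [lintegral_iSup (fun j => (s j).measurable) hs]
  exact tendsto_atTop_iSup fun i j hij => lintegral_mono (hs hij)

variable [IsProbabilityMeasure P]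

/-- Approximate 1 - `f` from below by simple functions of bounded support. The products decrease,
the exponents increase, and continuity of `expNeg` allows an infinite limiting exponent. -/
lemma IsPoissonProcess.laplace (h : IsPoissonProcess X lam P) (hlam : 0 ≤ lam)
    {f : Plane → ℝ≥0∞} (hf : Measurable f) (hf1 : ∀ y, f y ≤ 1) :
    ∫⁻ ω, iprod (fun m => f (X m ω)) ∂P = expNeg (ENNReal.ofReal lam * ∫⁻ y, (1 - f y)) := by
  obtain ⟨s, hs, hsg, hsK⟩ := exists_simpleFunc_approx (g := fun y => 1 - f y)
    (measurable_const.sub hf)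
  have hs1 : ∀ j y, s j y ≤ 1 := fun j y =>
    ((le_iSup (fun j => s j y) j).trans (hsg y).le).trans tsub_le_self
  have hf' : ∀ y, f y = ⨅ j, (1 - s j y) := fun y => by
    rw [← ENNReal.sub_iSup ENNReal.one_ne_top, hsg, ENNReal.sub_sub_cancel ENNReal.one_ne_top (hf1 y)]
  have hanti : ∀ ω, Antitone fun j m => 1 - s j (X m ω) := fun ω i j hij m =>
    tsub_le_tsub_left (hs hij _) _
  simp_rw [hf']
  simp_rw [fun ω => iprod_iInf (f := fun j m => 1 - s j (X m ω)) (fun j m => tsub_le_self)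
    (hanti ω)]
  rw [lintegral_iInf (f := fun j ω => iprod fun m => 1 - s j (X m ω))
    (fun j => Measurable.iprod fun m =>
      measurable_const.sub ((s j).measurable.comp (h.measurable m)))
    (fun i j hij ω => iprod_mono (hanti ω hij))
    ((lintegral_mono fun ω => iprod_le_one).trans_lt (by simp)).ne]
  have := tendsto_expNeg_lintegral hs hsg lam
  simp_rw [← hf']
  refine tendsto_nhds_unique (tendsto_atTop_iInf fun i j hij =>
    lintegral_mono fun ω => iprod_mono (hanti ω hij)) (this.congr fun j => ?_)
  exact ((h.simple_formulas hlam (s j) (hs1 j) Metric.isClosed_closedBall.measurableSet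
    measure_closedBall_lt_top.ne (hsK j) MeasurableSet.empty (empty_subset _)).1).symm

/-- The approximation of `laplace`, with the tagged point confined to a set of finite volume. The
sum over `n` is then finite at the first stage, as a decreasing limit requires. -/
lemma IsPoissonProcess.mecke_set (h : IsPoissonProcess X lam P) (hlam : 0 ≤ lam)
    {f : Plane → ℝ≥0∞} (hf : Measurable f) (hf1 : ∀ y, f y ≤ 1) {B : Set Plane}
    (hB : MeasurableSet B) (hBv : volume B ≠ ∞) :
    ∑' n, ∫⁻ ω, ind (X n ω ∈ B) * iprod (fun m => if m = n then 1 else f (X m ω)) ∂P =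
      ENNReal.ofReal lam * volume B * expNeg (ENNReal.ofReal lam * ∫⁻ y, (1 - f y)) := by
  obtain ⟨s, hs, hsg, hsK⟩ := exists_simpleFunc_approx (g := fun y => 1 - f y)
    (measurable_const.sub hf)
  have hs1 : ∀ j y, s j y ≤ 1 := fun j y =>
    ((le_iSup (fun j => s j y) j).trans (hsg y).le).trans tsub_le_self
  have hf' : ∀ y, f y = ⨅ j, (1 - s j y) := fun y => by
    rw [← ENNReal.sub_iSup ENNReal.one_ne_top, hsg, ENNReal.sub_sub_cancel ENNReal.one_ne_top (hf1 y)]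
  let Q : ℕ → ℕ → Ω → ℝ≥0∞ := fun j n ω =>
    ind (X n ω ∈ B) * iprod fun m => if m = n then 1 else 1 - s j (X m ω)
  have hQm : ∀ j n, Measurable (Q j n) := fun j n =>
    (measurable_ind_mem (h.measurable n hB)).mul
      (h.measurable_iprod_ne (measurable_const.sub (s j).measurable) n)
  have hanti : ∀ n ω, Antitone fun j m => if m = n then 1 else 1 - s j (X m ω) := by
    intro n ω i j hij m
    by_cases hmn : m = n
    · simp [hmn]
    · simp only [hmn, if_false]
      exact tsub_le_tsub_left (hs hij _) _
  have hQanti : ∀ n, Antitone fun j => Q j n := fun n i j hij ω =>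
    mul_le_mul_right (iprod_mono (hanti n ω hij)) _
  have hQle : ∀ j n ω, Q j n ω ≤ 1 := fun j n ω => mul_le_one' (ind_le_one _) iprod_le_one
  have hQinf : ∀ n ω, ind (X n ω ∈ B) * iprod (fun m => if m = n then 1 else f (X m ω)) =
      ⨅ j, Q j n ω := by
    intro n ω
    have e : (fun m => if m = n then 1 else f (X m ω)) =
        fun m => ⨅ j, if m = n then 1 else 1 - s j (X m ω) := by
      ext m
      by_cases hmn : m = n
      · simp [hmn]
      · simp only [hmn, if_false]; exact hf' _
    rw [e, iprod_iInf (fun j m => by split_ifs <;> simp) (hanti n ω)]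
    exact ENNReal.mul_iInf' (fun h => absurd h ((ind_le_one _).trans_lt ENNReal.one_lt_top).ne)
      fun _ => inferInstance
  have hval : ∀ j, ∑' n, ∫⁻ ω, Q j n ω ∂P =
      ENNReal.ofReal lam * volume B * expNeg (ENNReal.ofReal lam * ∫⁻ y, s j y) := by
    intro j
    rw [← lintegral_tsum fun n => (hQm j n).aemeasurable]
    exact (h.simple_formulas hlam (s j) (hs1 j)
      -- The ball supporting the simple function is enlarged by `B`, so that the tagged set lies
      -- inside the region of finite volume.
      (hB.union (Metric.isClosed_closedBall (x := (0 : Plane)) (ε := j)).measurableSet)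
      (measure_union_ne_top hBv measure_closedBall_lt_top.ne)
      (fun y hy => hsK j y fun hh => hy (Or.inr hh)) hB subset_union_left).2
  have hfin : ∀ j, ∑' n, ∫⁻ ω, Q j n ω ∂P ≠ ∞ := fun j => by
    rw [hval]
    exact ENNReal.mul_ne_top (ENNReal.mul_ne_top (by simp) hBv)
      ((expNeg_le_one _).trans_lt ENNReal.one_lt_top).ne
  simp_rw [hQinf]
  simp_rw [fun n => lintegral_iInf (hQm · n) (hQanti n)
    ((lintegral_mono (hQle 0 n)).trans_lt (by simp : ∫⁻ _, (1 : ℝ≥0∞) ∂P < ∞)).ne]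
  -- The sum is an integral against the counting measure on ℕ, so infimum and sum commute by
  -- monotone convergence for decreasing sequences.
  have hsum : ∑' n, ⨅ j, ∫⁻ ω, Q j n ω ∂P = ⨅ j, ∑' n, ∫⁻ ω, Q j n ω ∂P := by
    simp_rw [← MeasureTheory.lintegral_count]
    refine lintegral_iInf (fun j => measurable_from_nat) (fun i j hij n =>
      lintegral_mono (hQanti n hij)) ?_
    rw [MeasureTheory.lintegral_count]
    exact hfin 0
  rw [hsum]
  refine tendsto_nhds_unique (tendsto_atTop_iInf fun i j hij =>
    ENNReal.tsum_le_tsum fun n => lintegral_mono (hQanti n hij)) ?_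
  simp_rw [hval]
  exact ENNReal.Tendsto.const_mul (tendsto_expNeg_lintegral hs hsg lam)
    (Or.inr (ENNReal.mul_ne_top (by simp) hBv))

/-- Both sides are integrals of `w` against measures on the plane. By `mecke_set` the measures agree
on bounded sets, hence everywhere, and no integrability of `w` is needed. -/
lemma IsPoissonProcess.mecke_const (h : IsPoissonProcess X lam P) (hlam : 0 ≤ lam)
    {f : Plane → ℝ≥0∞} (hf : Measurable f) (hf1 : ∀ y, f y ≤ 1) {w : Plane → ℝ≥0∞}
    (hw : Measurable w) :
    ∑' n, ∫⁻ ω, w (X n ω) * iprod (fun m => if m = n then 1 else f (X m ω)) ∂P =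
      ENNReal.ofReal lam * ∫⁻ x, w x * expNeg (ENNReal.ofReal lam * ∫⁻ y, (1 - f y)) := by
  set E := expNeg (ENNReal.ofReal lam * ∫⁻ y, (1 - f y)) with hE
  let Q : ℕ → Ω → ℝ≥0∞ := fun n ω => iprod fun m => if m = n then 1 else f (X m ω)
  have hQ : ∀ n, Measurable (Q n) := fun n => h.measurable_iprod_ne hf n
  let ν : Measure Plane := Measure.sum fun n => (P.withDensity (Q n)).map (X n)
  have hνs : ∀ s, MeasurableSet s → ν s = ∑' n, ∫⁻ ω, ind (X n ω ∈ s) * Q n ω ∂P := by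
    intro s hs
    rw [Measure.sum_apply _ hs]
    refine tsum_congr fun n => ?_
    rw [Measure.map_apply (h.measurable n) hs, withDensity_apply _ (h.measurable n hs),
      ← lintegral_indicator (h.measurable n hs)]
    refine lintegral_congr fun ω => ?_
    by_cases hω : X n ω ∈ s
    · rw [indicator_of_mem (show ω ∈ X n ⁻¹' s from hω), ind_true hω, one_mul]
    · rw [indicator_of_notMem (show ω ∉ X n ⁻¹' s from hω), ind_false hω, zero_mul]
  have hν : ν = (ENNReal.ofReal lam * E) • volume := by
    refine Measure.ext fun s hs => ?_
    have hU : s = ⋃ j : ℕ, s ∩ Metric.closedBall (0 : Plane) j := by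
      rw [← inter_iUnion, Metric.iUnion_closedBall_nat, inter_univ]
    have hmono : Monotone fun j : ℕ => s ∩ Metric.closedBall (0 : Plane) j := fun i j hij =>
      inter_subset_inter_right _ (Metric.closedBall_subset_closedBall (by exact_mod_cast hij))
    rw [hU, hmono.measure_iUnion, hmono.measure_iUnion]
    refine iSup_congr fun j => ?_
    have hm : MeasurableSet (s ∩ Metric.closedBall (0 : Plane) j) :=
      hs.inter Metric.isClosed_closedBall.measurableSet
    rw [hνs _ hm, h.mecke_set hlam hf hf1 hm
      (measure_ne_top_of_subset inter_subset_right measure_closedBall_lt_top.ne),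
      Measure.smul_apply, smul_eq_mul]
    ring
  have hi : ∫⁻ x, w x ∂ν = ∑' n, ∫⁻ ω, w (X n ω) * Q n ω ∂P := by
    rw [lintegral_sum_measure]
    refine tsum_congr fun n => ?_
    rw [lintegral_map hw (h.measurable n),
      lintegral_withDensity_eq_lintegral_mul _ (hQ n) (g := fun ω => w (X n ω))
        (hw.comp (h.measurable n))]
    exact lintegral_congr fun ω => mul_comm _ _
  change ∑' n, ∫⁻ ω, w (X n ω) * Q n ω ∂P = _
  rw [← hi, hν, lintegral_smul_measure, smul_eq_mul, lintegral_mul_const _ hw]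
  ring

lemma tsum_ind_eq {ι : Type*} (k : ι) (a : ι → ℝ≥0∞) : ∑' z, ind (k = z) * a z = a k := by
  rw [tsum_eq_single k fun z hz => by rw [ind_false (Ne.symm hz), zero_mul], ind_true rfl, one_mul]

/-- Splitting the tagged points according to the value of `κ` freezes the test function in each
part. -/
lemma IsPoissonProcess.mecke_discrete (h : IsPoissonProcess X lam P) (hlam : 0 ≤ lam)
    {κ : Plane → ℤ} (hκ : Measurable κ)
    {f : ℤ → Plane → ℝ≥0∞} (hf : ∀ z, Measurable (f z)) (hf1 : ∀ z y, f z y ≤ 1)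
    {w : Plane → ℝ≥0∞} (hw : Measurable w) :
    ∑' n, ∫⁻ ω, w (X n ω) * iprod (fun m => if m = n then 1 else f (κ (X n ω)) (X m ω)) ∂P =
      ENNReal.ofReal lam * ∫⁻ x, w x * expNeg (ENNReal.ofReal lam * ∫⁻ y, (1 - f (κ x) y)) := by
  have hi : ∀ z, Measurable fun x => ind (κ x = z) := fun z =>
    measurable_ind (hκ (measurableSet_singleton z))
  have e1 : ∀ n ω, w (X n ω) * iprod (fun m => if m = n then 1 else f (κ (X n ω)) (X m ω)) =
      ∑' z, ind (κ (X n ω) = z) * w (X n ω) *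
        iprod (fun m => if m = n then 1 else f z (X m ω)) := fun n ω => by
    simp_rw [mul_assoc]
    rw [tsum_ind_eq (κ (X n ω)) fun z => w (X n ω) *
      iprod (fun m => if m = n then 1 else f z (X m ω))]
  have e2 : ∀ x, w x * expNeg (ENNReal.ofReal lam * ∫⁻ y, (1 - f (κ x) y)) =
      ∑' z, ind (κ x = z) * w x * expNeg (ENNReal.ofReal lam * ∫⁻ y, (1 - f z y)) := fun x => by
    simp_rw [mul_assoc]
    rw [tsum_ind_eq (κ x) fun z => w x * expNeg (ENNReal.ofReal lam * ∫⁻ y, (1 - f z y))]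
  simp_rw [e1, e2]
  rw [lintegral_tsum fun z => (((hi z).fun_mul hw).mul_const _).aemeasurable,
    ← ENNReal.tsum_mul_left]
  have hm : ∀ n z, Measurable fun ω => ind (κ (X n ω) = z) * w (X n ω) := fun n z =>
    ((hi z).fun_mul hw).comp (h.measurable n)
  simp_rw [fun n => lintegral_tsum (μ := P) fun z =>
    ((hm n z).fun_mul (h.measurable_iprod_ne (hf z) n)).aemeasurable]
  rw [ENNReal.tsum_comm]
  exact tsum_congr fun z => h.mecke_const hlam (hf z) (hf1 z) ((hi z).fun_mul hw)

lemma measurable_expNeg_lintegral {F : ℝ → Plane → ℝ≥0∞} (hF : Measurable (Function.uncurry F))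
    (lam : ℝ) : Measurable fun l => expNeg (ENNReal.ofReal lam * ∫⁻ y, (1 - F l y)) :=
  ((Measurable.lintegral_prod_right' (f := fun z : ℝ × Plane => 1 - F z.1 z.2)
    (measurable_const.sub hF)).const_mul _).expNeg

/-- Rounding the level to a grid of mesh 1/(j+1) reduces to `mecke_discrete`. Since `F` decreases in
the level, rounding down bounds the sum from above and rounding up from below. Both bounds converge
to the right-hand side by continuity of the exponent and domination by `w`. -/
lemma IsPoissonProcess.mecke_level_finite (h : IsPoissonProcess X lam P) (hlam : 0 ≤ lam)
    {ℓ : Plane → ℝ} (hℓ : Measurable ℓ) {F : ℝ → Plane → ℝ≥0∞}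
    (hF : Measurable (Function.uncurry F)) (hF1 : ∀ l y, F l y ≤ 1)
    (hanti : ∀ y, Antitone fun l => F l y) {w : Plane → ℝ≥0∞} (hw : Measurable w)
    (hwi : ∫⁻ x, w x ≠ ∞)
    (hc : ∀ᵐ x, w x ≠ 0 → ContinuousAt (fun l => ∫⁻ y, (1 - F l y)) (ℓ x)) :
    ∑' n, ∫⁻ ω, w (X n ω) * iprod (fun m => if m = n then 1 else F (ℓ (X n ω)) (X m ω)) ∂P =
      ENNReal.ofReal lam * ∫⁻ x, w x * expNeg (ENNReal.ofReal lam * ∫⁻ y, (1 - F (ℓ x) y)) := by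
  have hFm : ∀ l, Measurable (F l) := fun l => hF.comp measurable_prodMk_left
  -- The shift `d` is 0 for rounding down and 1 for rounding up.
  have key : ∀ (d : ℝ), ∀ j : ℕ,
      ∑' n, ∫⁻ ω, w (X n ω) * iprod (fun m => if m = n then 1 else
          F ((⌊((j : ℝ) + 1) * ℓ (X n ω)⌋ + d) / (j + 1)) (X m ω)) ∂P =
        ENNReal.ofReal lam * ∫⁻ x, w x *
          expNeg (ENNReal.ofReal lam * ∫⁻ y, (1 - F ((⌊((j : ℝ) + 1) * ℓ x⌋ + d) / (j + 1)) y)) :=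
    fun d j => h.mecke_discrete hlam (κ := fun x => ⌊((j : ℝ) + 1) * ℓ x⌋)
      (Int.measurable_floor.comp (hℓ.const_mul _))
      (f := fun z => F ((z + d) / (j + 1))) (fun z => hFm _) (fun z y => hF1 _ _) hw
  have lim : ∀ d : ℝ, Tendsto (fun j : ℕ => ENNReal.ofReal lam * ∫⁻ x, w x *
      expNeg (ENNReal.ofReal lam * ∫⁻ y, (1 - F ((⌊((j : ℝ) + 1) * ℓ x⌋ + d) / (j + 1)) y))) atTop
      (𝓝 (ENNReal.ofReal lam *
        ∫⁻ x, w x * expNeg (ENNReal.ofReal lam * ∫⁻ y, (1 - F (ℓ x) y)))) := by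
    intro d
    refine ENNReal.Tendsto.const_mul ?_ (Or.inr (by simp))
    refine tendsto_lintegral_of_dominated_convergence w (fun j => ?_)
      (fun j => Eventually.of_forall fun x => mul_le_of_le_one_right' (expNeg_le_one _)) hwi ?_
    · refine hw.mul ((measurable_expNeg_lintegral hF lam).comp
        (f := fun x => ((⌊((j : ℝ) + 1) * ℓ x⌋ : ℝ) + d) / (j + 1)) ?_)
      exact ((Measurable.add_const ((measurable_from_top (f := fun z : ℤ => (z : ℝ))).comp
        (Int.measurable_floor.comp (hℓ.const_mul _))) d).div_const _)
    · filter_upwards [hc, ae_lt_top hw hwi] with x hx hwt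
      by_cases hwx : w x = 0
      · simp [hwx]
      have ht : Tendsto (fun j : ℕ => ((⌊((j : ℝ) + 1) * ℓ x⌋ : ℝ) + d) / (j + 1)) atTop
          (𝓝 (ℓ x)) := by
        have h1 : Tendsto (fun j : ℕ => (1 : ℝ) / ((j : ℝ) + 1)) atTop (𝓝 0) :=
          tendsto_one_div_add_atTop_nhds_zero_nat
        -- The rounded level differs from `ℓ x` by a bounded quantity divided by j+1.
        have h2 : Tendsto (fun j : ℕ => ℓ x + (d - Int.fract (((j : ℝ) + 1) * ℓ x)) *
            (1 / ((j : ℝ) + 1))) atTop (𝓝 (ℓ x + 0)) := by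
          refine tendsto_const_nhds.add (bdd_le_mul_tendsto_zero' (|d| + 1) ?_ h1)
          refine Eventually.of_forall fun j => ?_
          have ha := Int.fract_nonneg (((j : ℝ) + 1) * ℓ x)
          have hb := (Int.fract_lt_one (((j : ℝ) + 1) * ℓ x)).le
          rw [abs_le]
          constructor <;> [linarith [neg_abs_le d]; linarith [le_abs_self d]]
        rw [add_zero] at h2
        refine h2.congr fun j => ?_
        have hj : (j : ℝ) + 1 ≠ 0 := by positivity
        rw [Int.fract]
        field_simp
        ring
      refine ENNReal.Tendsto.const_mul ((continuous_expNeg.tendsto _).comp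
        (ENNReal.Tendsto.const_mul ((hx hwx).tendsto.comp ht) (Or.inr (by simp)))) (Or.inr hwt.ne)
  refine le_antisymm ?_ ?_
  · refine ge_of_tendsto' (lim 0) fun j => ?_
    rw [← key 0 j]
    refine ENNReal.tsum_le_tsum fun n => lintegral_mono fun ω =>
      mul_le_mul_right (iprod_mono fun m => ?_) _
    split_ifs
    · exact le_rfl
    · refine hanti _ ?_
      rw [add_zero, div_le_iff₀ (by positivity), mul_comm]
      exact Int.floor_le _
  · refine le_of_tendsto' (lim 1) fun j => ?_
    rw [← key 1 j]
    refine ENNReal.tsum_le_tsum fun n => lintegral_mono fun ω =>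
      mul_le_mul_right (iprod_mono fun m => ?_) _
    split_ifs
    · exact le_rfl
    · refine hanti _ ?_
      rw [le_div_iff₀ (by positivity), mul_comm]
      exact (Int.lt_floor_add_one _).le

lemma lintegral_sum_annuli (w : Plane → ℝ≥0∞) (x : Plane) :
    w x = ∑' j : ℕ, ind (⌊‖x‖⌋₊ = j) * w x := by
  rw [tsum_ind_eq _ fun _ => w x]

/-- Mecke formula for a product over the other points that depends on a level of the tagged one. -/
lemma IsPoissonProcess.mecke_level (h : IsPoissonProcess X lam P) (hlam : 0 ≤ lam)
    {ℓ : Plane → ℝ} (hℓ : Measurable ℓ) {F : ℝ → Plane → ℝ≥0∞}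
    (hF : Measurable (Function.uncurry F)) (hF1 : ∀ l y, F l y ≤ 1)
    (hanti : ∀ y, Antitone fun l => F l y) {w : Plane → ℝ≥0∞} (hw : Measurable w)
    (hw1 : ∀ x, w x ≤ 1)
    (hc : ∀ᵐ x, ContinuousAt (fun l => ∫⁻ y, (1 - F l y)) (ℓ x)) :
    ∑' n, ∫⁻ ω, w (X n ω) * iprod (fun m => if m = n then 1 else F (ℓ (X n ω)) (X m ω)) ∂P =
      ENNReal.ofReal lam * ∫⁻ x, w x * expNeg (ENNReal.ofReal lam * ∫⁻ y, (1 - F (ℓ x) y)) := by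
  -- Cutting `w` into the annuli of integer width makes each piece bounded with bounded support,
  -- hence integrable.
  let wj : ℕ → Plane → ℝ≥0∞ := fun j x => ind (⌊‖x‖⌋₊ = j) * w x
  have hwj : ∀ j, Measurable (wj j) := fun j =>
    (measurable_ind ((Nat.measurable_floor.comp measurable_norm)
      (measurableSet_singleton j))).mul hw
  have hwe : ∀ x, w x = ∑' j, wj j x := lintegral_sum_annuli w
  have hprod : ∀ n, Measurable fun ω =>
      iprod fun m => if m = n then 1 else F (ℓ (X n ω)) (X m ω) := by
    intro n
    refine Measurable.iprod fun m => ?_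
    by_cases hmn : m = n
    · simp [hmn]
    · simp only [hmn, if_false]
      exact hF.comp ((hℓ.comp (h.measurable n)).prodMk (h.measurable m))
  simp_rw [fun n ω => congrArg (fun a => a *
    iprod (fun m => if m = n then 1 else F (ℓ (X n ω)) (X m ω))) (hwe (X n ω)),
    fun x => congrArg (fun a => a *
      expNeg (ENNReal.ofReal lam * ∫⁻ y, (1 - F (ℓ x) y))) (hwe x), ← ENNReal.tsum_mul_right]
  have hm1 : Measurable fun x => expNeg (ENNReal.ofReal lam * ∫⁻ y, (1 - F (ℓ x) y)) :=
    (measurable_expNeg_lintegral hF lam).comp hℓ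
  have hm2 : ∀ n j, Measurable fun ω => wj j (X n ω) := fun n j => (hwj j).comp (h.measurable n)
  rw [lintegral_tsum fun j => ((hwj j).fun_mul hm1).aemeasurable, ← ENNReal.tsum_mul_left]
  simp_rw [fun n => lintegral_tsum (μ := P) fun j =>
    ((hm2 n j).fun_mul (hprod n)).aemeasurable]
  rw [ENNReal.tsum_comm]
  refine tsum_congr fun j => h.mecke_level_finite hlam hℓ hF hF1 hanti (hwj j) ?_
    (hc.mono fun x hx _ => hx)
  have hle : ∀ x, wj j x ≤ ind (x ∈ Metric.closedBall (0 : Plane) (j + 1)) := by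
    intro x
    refine (mul_le_of_le_one_right' (hw1 x)).trans (ind_mono fun hx => ?_)
    rw [mem_closedBall_zero_iff, ← hx]
    exact (Nat.lt_floor_add_one _).le
  refine ((lintegral_mono hle).trans_lt ?_).ne
  rw [lintegral_ind_mem _ Metric.isClosed_closedBall.measurableSet]
  exact measure_closedBall_lt_top

end IAB

namespace IAB

open Filter Topology

/-! ### Polar coordinates and power substitution -/

lemma lintegral_plane_polar {f : Plane → ℝ≥0∞} (hf : Measurable f) :
    ∫⁻ x, f x = ∫⁻ θ in Ioo (-Real.pi) Real.pi, ∫⁻ r in Ioi (0 : ℝ),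
      ENNReal.ofReal r * f !₂[r * Real.cos θ, r * Real.sin θ] := by
  have mp1 := (PiLp.volume_preserving_toLp (Fin 2))
  have mp2 := (volume_preserving_finTwoArrow ℝ).symm
  have hm : Measurable fun z : ℝ × ℝ => f (WithLp.toLp 2 (MeasurableEquiv.finTwoArrow.symm z)) :=
    hf.comp (mp1.measurable.comp mp2.measurable)
  have e1 : ∫⁻ x, f x = ∫⁻ z : ℝ × ℝ, f (WithLp.toLp 2 (MeasurableEquiv.finTwoArrow.symm z)) := by
    rw [← mp1.lintegral_comp hf]
    exact (mp2.lintegral_comp (hf.comp mp1.measurable)).symm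
  rw [e1, ← lintegral_comp_polarCoord_symm, polarCoord_target, Measure.volume_eq_prod,
    ← Measure.prod_restrict]
  have hm2 : Measurable fun z : ℝ × ℝ => ENNReal.ofReal z.1 •
      f (WithLp.toLp 2 (MeasurableEquiv.finTwoArrow.symm (polarCoord.symm z))) :=
    (ENNReal.measurable_ofReal.comp measurable_fst).smul
      (hm.comp continuous_polarCoord_symm.measurable)
  rw [lintegral_prod_symm _ hm2.aemeasurable]
  rfl

lemma norm_polar_add (r a θ : ℝ) :
    ‖(!₂[r * Real.cos θ, r * Real.sin θ] : Plane) + !₂[a, 0]‖ =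
      Real.sqrt (r ^ 2 + a ^ 2 + 2 * r * a * Real.cos θ) := by
  rw [EuclideanSpace.norm_eq]
  congr 1
  simp only [Fin.sum_univ_two, PiLp.add_apply, Real.norm_eq_abs, sq_abs]
  simp
  nlinarith [Real.sin_sq_add_cos_sq θ]

lemma norm_polar {r : ℝ} (hr : 0 ≤ r) (θ : ℝ) :
    ‖(!₂[r * Real.cos θ, r * Real.sin θ] : Plane)‖ = r := by
  have := norm_polar_add r 0 θ
  have h0 : (!₂[(0 : ℝ), 0] : Plane) = 0 := by ext i; fin_cases i <;> simp
  rw [h0, add_zero] at this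
  rw [this]
  simp [Real.sqrt_sq hr]

/-- Translating by `y` and reflecting (‖y‖, 0) onto `y` reduces to a point on the axis, so only ‖y‖
matters. Polar angles in (-π, π) give the law of cosines with a plus sign; a shift by π moves them
to (0, 2π) and changes the sign. -/
lemma lintegral_two_norms {G : ℝ → ℝ → ℝ≥0∞} (hG : Measurable (Function.uncurry G)) (y : Plane) :
    ∫⁻ x : Plane, G ‖x‖ ‖x - y‖ =
      ∫⁻ θ in Ioo 0 (2 * Real.pi), ∫⁻ r in Ioi (0 : ℝ), ENNReal.ofReal r *
        G (Real.sqrt (r ^ 2 + ‖y‖ ^ 2 - 2 * r * ‖y‖ * Real.cos θ)) r := by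
  set y₀ : Plane := !₂[‖y‖, 0] with hy₀
  have hn : ‖y₀‖ = ‖y‖ := by
    rw [hy₀, EuclideanSpace.norm_eq]; simp
  let e : Plane ≃ₗᵢ[ℝ] Plane := Submodule.reflection (Submodule.span ℝ {y₀ - y})ᗮ
  have he : e y₀ = y := Submodule.reflection_sub hn
  have e1 : ∫⁻ x : Plane, G ‖x‖ ‖x - y‖ = ∫⁻ x : Plane, G ‖x + y₀‖ ‖x‖ := by
    rw [← lintegral_add_right_eq_self (fun x : Plane => G ‖x‖ ‖x - y‖) y]
    rw [← e.measurePreserving.lintegral_comp_emb e.toHomeomorph.measurableEmbedding]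
    refine lintegral_congr fun x => ?_
    rw [add_sub_cancel_right, e.norm_map]
    have h2 : e x + y = e (x + y₀) := by rw [map_add, he]
    rw [h2, e.norm_map]
  rw [e1, lintegral_plane_polar (f := fun x : Plane => G ‖x + y₀‖ ‖x‖) (hG.comp
    ((measurable_id.add_const _).norm.prodMk measurable_norm))]
  have e2 : ∀ θ : ℝ, ∫⁻ r in Ioi (0 : ℝ), ENNReal.ofReal r *
      G ‖(!₂[r * Real.cos θ, r * Real.sin θ] : Plane) + y₀‖
        ‖(!₂[r * Real.cos θ, r * Real.sin θ] : Plane)‖ =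
      ∫⁻ r in Ioi (0 : ℝ), ENNReal.ofReal r *
        G (Real.sqrt (r ^ 2 + ‖y‖ ^ 2 - 2 * r * ‖y‖ * Real.cos (θ + Real.pi))) r := by
    intro θ
    refine setLIntegral_congr_fun measurableSet_Ioi fun r hr => ?_
    rw [norm_polar (le_of_lt hr), hy₀, norm_polar_add, Real.cos_add_pi]
    congr 3; ring
  simp_rw [e2]
  have mp := measurePreserving_add_right (volume : Measure ℝ) Real.pi
  have hpre : Ioo (-Real.pi) Real.pi = (fun θ => θ + Real.pi) ⁻¹' Ioo 0 (2 * Real.pi) := by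
    ext θ; simp only [mem_Ioo, mem_preimage]; constructor <;> rintro ⟨h1, h2⟩ <;>
      constructor <;> linarith
  rw [hpre]
  exact mp.setLIntegral_comp_preimage_emb (measurableEmbedding_addRight Real.pi)
    (fun θ => ∫⁻ r in Ioi (0 : ℝ), ENNReal.ofReal r *
        G (Real.sqrt (r ^ 2 + ‖y‖ ^ 2 - 2 * r * ‖y‖ * Real.cos θ)) r) _

lemma lintegral_norm {g : ℝ → ℝ≥0∞} (hg : Measurable g) :
    ∫⁻ x : Plane, g ‖x‖ =
      ENNReal.ofReal (2 * Real.pi) * ∫⁻ r in Ioi (0 : ℝ), ENNReal.ofReal r * g r := by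
  have := lintegral_two_norms (G := fun _ r => g r) (hg.comp measurable_snd) 0
  simp only [sub_zero] at this
  rw [this, lintegral_const]
  simp [mul_comm]

lemma lintegral_Ioi_rpow {α : ℝ} (hα : 0 < α) (f : ℝ → ℝ≥0∞) :
    ∫⁻ r in Ioi (0 : ℝ), f r =
      ∫⁻ l in Ioi (0 : ℝ), ENNReal.ofReal (1 / α * l ^ (1 / α - 1)) * f (l ^ (1 / α)) := by
  have h1 : 0 < 1 / α := by positivity
  have him : (fun l : ℝ => l ^ (1 / α)) '' Ioi 0 = Ioi 0 := by
    ext r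
    simp only [mem_image, mem_Ioi]
    constructor
    · rintro ⟨l, hl, rfl⟩; exact Real.rpow_pos_of_pos hl _
    · intro hr
      refine ⟨r ^ α, Real.rpow_pos_of_pos hr _, ?_⟩
      rw [← Real.rpow_mul hr.le, mul_one_div_cancel hα.ne', Real.rpow_one]
  have hinj : InjOn (fun l : ℝ => l ^ (1 / α)) (Ioi 0) := fun a ha b hb hab =>
    (Real.rpow_left_injOn h1.ne') (mem_Ici.2 (le_of_lt ha)) (mem_Ici.2 (le_of_lt hb)) hab
  have key := lintegral_image_eq_lintegral_abs_deriv_mul measurableSet_Ioi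
    (fun l hl => (Real.hasDerivAt_rpow_const (p := 1 / α)
      (Or.inl (ne_of_gt hl))).hasDerivWithinAt) hinj f
  rw [him] at key
  rw [key]
  refine setLIntegral_congr_fun measurableSet_Ioi fun l hl => ?_
  have : 0 < l := hl
  rw [abs_of_nonneg (by positivity)]

/-- Substitution of the pathloss for the distance in a radial integral. -/
lemma lintegral_Ioi_pathloss {α : ℝ} (hα : 0 < α) (φ h : ℝ → ℝ≥0∞) :
    ∫⁻ r in Ioi (0 : ℝ), ENNReal.ofReal r * (h r * φ (r ^ α)) =
      ∫⁻ l in Ioi (0 : ℝ), φ l * (ENNReal.ofReal (1 / α * l ^ (2 / α - 1)) * h (l ^ (1 / α))) := by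
  rw [lintegral_Ioi_rpow hα]
  refine setLIntegral_congr_fun measurableSet_Ioi fun l hl => ?_
  have hl' : 0 < l := hl
  rw [← Real.rpow_mul hl'.le, one_div_mul_cancel hα.ne', Real.rpow_one, ← mul_assoc,
    ← ENNReal.ofReal_mul (by positivity)]
  have : 1 / α * l ^ (1 / α - 1) * l ^ (1 / α) = 1 / α * l ^ (2 / α - 1) := by
    rw [mul_assoc, ← Real.rpow_add hl']; congr 2; ring
  rw [this]; ring

/-! ### Pathloss processes -/

namespace Params

variable (p : Params)

/-- Probability that a link of length `r` is in state `s`. -/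
def stateProb (s : LinkState) (r : ℝ) : ℝ :=
  match s with
  | .los => p.losProb r
  | .nlos => 1 - p.losProb r

lemma losProb_le_one {r : ℝ} (hr : 0 ≤ r) : p.losProb r ≤ 1 := by
  rw [losProb, Real.exp_le_one_iff, neg_div, neg_nonpos]
  exact div_nonneg hr p.losRange_pos.le

lemma losProb_nonneg (r : ℝ) : 0 ≤ p.losProb r := (Real.exp_pos _).le

lemma continuous_losProb : Continuous p.losProb := by unfold losProb; fun_prop

lemma continuous_stateProb (s : LinkState) : Continuous (p.stateProb s) := by
  cases s
  · exact p.continuous_losProb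
  · exact continuous_const.sub p.continuous_losProb

lemma stateProb_nonneg (s : LinkState) {r : ℝ} (hr : 0 ≤ r) : 0 ≤ p.stateProb s r := by
  cases s
  · exact p.losProb_nonneg r
  · exact sub_nonneg.2 (p.losProb_le_one hr)

lemma stateProb_le_one (s : LinkState) {r : ℝ} (hr : 0 ≤ r) : p.stateProb s r ≤ 1 := by
  cases s
  · exact p.losProb_le_one hr
  · exact sub_le_self _ (p.losProb_nonneg r)

end Params

lemma sum_linkState {M : Type*} [AddCommMonoid M] (f : LinkState → M) :
    ∑ s, f s = f .los + f .nlos := by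
  rw [show (Finset.univ : Finset LinkState) = {.los, .nlos} from rfl, Finset.sum_pair (by simp)]

lemma sum_tier {M : Type*} [AddCommMonoid M] (f : Tier → M) : ∑ s, f s = f .mbs + f .sbs := by
  rw [show (Finset.univ : Finset Tier) = {.mbs, .sbs} from rfl, Finset.sum_pair (by simp)]

lemma prod_tier {M : Type*} [CommMonoid M] (f : Tier → M) : ∏ s, f s = f .mbs * f .sbs := by
  rw [show (Finset.univ : Finset Tier) = {.mbs, .sbs} from rfl, Finset.prod_pair (by simp)]

namespace Params

variable (p : Params)

lemma sum_stateProb {r : ℝ} (hr : 0 ≤ r) : ∑ s, ENNReal.ofReal (p.stateProb s r) = 1 := by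
  rw [sum_linkState, ← ENNReal.ofReal_add (p.stateProb_nonneg _ hr) (p.stateProb_nonneg _ hr)]
  simp [stateProb]

/-- The state probabilities sum to one, so the complement of an average is the average of the
complements. -/
lemma one_sub_sum_stateProb {r : ℝ} (hr : 0 ≤ r) {a : LinkState → ℝ≥0∞} (ha : ∀ s, a s ≤ 1) :
    1 - ∑ s, ENNReal.ofReal (p.stateProb s r) * a s =
      ∑ s, ENNReal.ofReal (p.stateProb s r) * (1 - a s) := by
  have hle : ∑ s, ENNReal.ofReal (p.stateProb s r) * a s ≤ 1 :=
    (Finset.sum_le_sum fun s _ => mul_le_of_le_one_right' (ha s)).trans (p.sum_stateProb hr).le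
  symm
  refine ENNReal.eq_sub_of_add_eq (hle.trans_lt ENNReal.one_lt_top).ne ?_
  rw [← Finset.sum_add_distrib]
  refine Eq.trans ?_ (p.sum_stateProb hr)
  exact Finset.sum_congr rfl fun s _ => by rw [← mul_add, tsub_add_cancel_of_le (ha s), mul_one]

lemma pathlossDensityState_eq (i : Tier) (s : LinkState) (l : ℝ) :
    p.pathlossDensityState i s l = 2 * Real.pi * p.density i *
      (1 / p.pathlossExp .access i s * l ^ (2 / p.pathlossExp .access i s - 1) *
        p.stateProb s (l ^ (1 / p.pathlossExp .access i s))) := by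
  cases s <;> rfl

lemma pathlossDensityState_nonneg (i : Tier) (s : LinkState) {l : ℝ} (hl : 0 ≤ l) :
    0 ≤ p.pathlossDensityState i s l := by
  rw [pathlossDensityState_eq]
  have := p.pathlossExp_pos .access i s
  have := p.density_pos i
  have := p.stateProb_nonneg s (Real.rpow_nonneg hl (1 / p.pathlossExp .access i s))
  positivity

lemma measurable_pathlossDensityState (i : Tier) (s : LinkState) :
    Measurable (p.pathlossDensityState i s) := by
  have h := (p.continuous_stateProb s).measurable
  simp_rw [funext (p.pathlossDensityState_eq i s)]
  fun_prop

lemma pathlossDensity_eq_sum (i : Tier) (l : ℝ) :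
    p.pathlossDensity i l = ∑ s, p.pathlossDensityState i s l := by
  rw [sum_linkState]; rfl

lemma measurable_pathlossDensity (i : Tier) : Measurable (p.pathlossDensity i) :=
  (p.measurable_pathlossDensityState i .los).add (p.measurable_pathlossDensityState i .nlos)

lemma ofReal_pathlossDensity (i : Tier) {l : ℝ} (hl : 0 ≤ l) :
    ENNReal.ofReal (p.pathlossDensity i l) = ∑ s, ENNReal.ofReal (p.pathlossDensityState i s l) := by
  rw [pathlossDensity_eq_sum,
    ENNReal.ofReal_sum_of_nonneg fun s _ => p.pathlossDensityState_nonneg i s hl]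

/-- Intensity of the pathloss process of the access links of tier `i` in state `s`. -/
lemma lintegral_pathloss_state (i : Tier) (s : LinkState) {φ : ℝ → ℝ≥0∞} (hφ : Measurable φ) :
    ENNReal.ofReal (p.density i) * ∫⁻ x : Plane, ENNReal.ofReal (p.stateProb s ‖x‖) *
        φ (‖x‖ ^ p.pathlossExp .access i s) =
      ∫⁻ l in Ioi (0 : ℝ), φ l * ENNReal.ofReal (p.pathlossDensityState i s l) := by
  have hq := (p.continuous_stateProb s).measurable
  rw [lintegral_norm (g := fun r => ENNReal.ofReal (p.stateProb s r) *
    φ (r ^ p.pathlossExp .access i s)) (by fun_prop),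
    lintegral_Ioi_pathloss (p.pathlossExp_pos _ _ _) φ fun r => ENNReal.ofReal (p.stateProb s r),
    ← mul_assoc, ← lintegral_const_mul _ (by fun_prop)]
  refine setLIntegral_congr_fun measurableSet_Ioi fun l hl => ?_
  have hl' : 0 < l := hl
  have h1 := p.pathlossExp_pos .access i s
  have h2 := p.density_pos i
  have h3 := p.stateProb_nonneg s (Real.rpow_nonneg hl'.le (1 / p.pathlossExp .access i s))
  set A := 1 / p.pathlossExp .access i s * l ^ (2 / p.pathlossExp .access i s - 1)
  have hA : 0 ≤ A := by positivity
  rw [pathlossDensityState_eq, mul_comm (2 * Real.pi) (p.density i), mul_assoc (p.density i),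
    ENNReal.ofReal_mul h2.le, ENNReal.ofReal_mul (p := 2 * Real.pi) (by positivity),
    ENNReal.ofReal_mul hA]
  ring

lemma lintegral_pathloss (i : Tier) {φ : ℝ → ℝ≥0∞} (hφ : Measurable φ) :
    ENNReal.ofReal (p.density i) * ∫⁻ x : Plane, ∑ s, ENNReal.ofReal (p.stateProb s ‖x‖) *
        φ (‖x‖ ^ p.pathlossExp .access i s) =
      ∫⁻ l in Ioi (0 : ℝ), φ l * ENNReal.ofReal (p.pathlossDensity i l) := by
  have hq := fun s => (p.continuous_stateProb s).measurable
  rw [lintegral_finsetSum _ fun s _ => by have := hq s; fun_prop, Finset.mul_sum]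
  simp_rw [p.lintegral_pathloss_state i _ hφ]
  have hm := p.measurable_pathlossDensityState i
  rw [← lintegral_finsetSum _ fun s _ => by have := hm s; fun_prop]
  refine setLIntegral_congr_fun measurableSet_Ioi fun l hl => ?_
  rw [p.ofReal_pathlossDensity i (le_of_lt hl), Finset.mul_sum]

/-- This is the origin of the closed form of the pathloss measure: the bracket is the primitive of r
e^(-r/μ) vanishing at 0. The NLOS part is r²/2 minus the same primitive. -/
lemma hasDerivAt_losMass (r : ℝ) :
    HasDerivAt (fun r => p.losRange * (p.losRange - Real.exp (-r / p.losRange) * (r + p.losRange)))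
      (r * p.losProb r) r := by
  have hμ := p.losRange_pos.ne'
  have h1 : HasDerivAt (fun r => Real.exp (-r / p.losRange))
      (Real.exp (-r / p.losRange) * (-1 / p.losRange)) r :=
    (((hasDerivAt_id r).neg).div_const p.losRange).exp
  have h2 := ((h1.mul ((hasDerivAt_id r).add_const p.losRange)).const_sub p.losRange).const_mul
    p.losRange
  refine h2.congr_deriv ?_
  simp only [losProb, id]
  field_simp
  ring

lemma lintegral_mass_aux {f F : ℝ → ℝ} (hf : Continuous f) (hd : ∀ r, HasDerivAt F (f r) r)
    (hF : F 0 = 0) {R : ℝ} (hR : 0 ≤ R) (hf0 : ∀ r, 0 ≤ r → 0 ≤ f r) :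
    0 ≤ F R ∧ ∫⁻ r in Ioc 0 R, ENNReal.ofReal (f r) = ENNReal.ofReal (F R) := by
  have hint : ∫ r in Ioc 0 R, f r = F R := by
    rw [← intervalIntegral.integral_of_le hR,
      intervalIntegral.integral_eq_sub_of_hasDerivAt (fun r _ => hd r) (hf.intervalIntegrable _ _),
      hF, sub_zero]
  have hnn : ∀ᵐ r ∂(volume.restrict (Ioc 0 R)), 0 ≤ f r :=
    (ae_restrict_mem measurableSet_Ioc).mono fun r hr => hf0 r hr.1.le
  refine ⟨hint ▸ integral_nonneg_of_ae hnn, ?_⟩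
  rw [← ofReal_integral_eq_lintegral_ofReal _ hnn, hint]
  exact (hf.intervalIntegrable 0 R).1

lemma rpow_le_iff_le {α r L : ℝ} (hα : 0 < α) (hr : 0 ≤ r) (hL : 0 ≤ L) :
    r ^ α ≤ L ↔ r ≤ L ^ (1 / α) := by
  rw [one_div, Real.le_rpow_inv_iff_of_pos hr hL hα]

lemma lintegral_radial_le {α L : ℝ} (hα : 0 < α) (hL : 0 ≤ L) (h : ℝ → ℝ≥0∞) :
    ∫⁻ r in Ioi (0 : ℝ), ENNReal.ofReal r * (h r * ind (r ^ α ≤ L)) =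
      ∫⁻ r in Ioc 0 (L ^ (1 / α)), ENNReal.ofReal r * h r := by
  rw [← lintegral_indicator measurableSet_Ioi, ← lintegral_indicator measurableSet_Ioc]
  refine lintegral_congr fun r => ?_
  by_cases hr : 0 < r
  · rw [indicator_of_mem (mem_Ioi.2 hr)]
    by_cases h2 : r ^ α ≤ L
    · rw [ind_true h2, mul_one, indicator_of_mem (s := Ioc _ _) ⟨hr, (rpow_le_iff_le hα hr.le hL).1 h2⟩]
    · rw [ind_false h2, indicator_of_notMem (s := Ioc _ _) fun hh => h2 ((rpow_le_iff_le hα hr.le hL).2 hh.2)]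
      simp
  · rw [indicator_of_notMem (by simpa using hr), indicator_of_notMem (s := Ioc _ _) fun hh => hr hh.1]

/-- A link in state s has pathloss at most L exactly up to radius L^(1/α_s), and r q_s(r) is
integrated up to there. Nonnegativity is recorded because `ENNReal.ofReal` would turn a negative
value into 0. -/
lemma pathlossMeasure_spec (i : Tier) {L : ℝ} (hL : 0 ≤ L) :
    0 ≤ p.pathlossMeasure i L ∧
      ∫⁻ l in Ioi (0 : ℝ), ind (l ≤ L) * ENNReal.ofReal (p.pathlossDensity i l) =
        ENNReal.ofReal (p.pathlossMeasure i L) := by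
  have hμ := p.losRange_pos
  have hd := p.density_pos i
  have hm : Measurable fun l => ind (l ≤ L) := measurable_ind measurableSet_Iic
  obtain ⟨n1, e1⟩ := lintegral_mass_aux (f := fun r => r * p.losProb r)
    (continuous_id.mul p.continuous_losProb) p.hasDerivAt_losMass (by simp)
    (Real.rpow_nonneg hL (1 / p.pathlossExp .access i .los))
    fun r hr => mul_nonneg hr (p.losProb_nonneg r)
  obtain ⟨n2, e2⟩ := lintegral_mass_aux (f := fun r => r * (1 - p.losProb r))
    (F := fun r => r ^ 2 / 2 - p.losRange * (p.losRange - Real.exp (-r / p.losRange) *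
      (r + p.losRange))) (continuous_id.mul (continuous_const.sub p.continuous_losProb))
    (fun r => by
      have h2 : HasDerivAt (fun r : ℝ => r ^ 2 / 2) r r := by
        have := (hasDerivAt_pow 2 r).div_const 2
        simpa using this
      exact (h2.sub (p.hasDerivAt_losMass r)).congr_deriv (by ring)) (by simp)
    (Real.rpow_nonneg hL (1 / p.pathlossExp .access i .nlos))
    fun r hr => mul_nonneg hr (sub_nonneg.2 (p.losProb_le_one hr))
  have hsq : (L ^ (1 / p.pathlossExp .access i .nlos)) ^ 2 =
      L ^ (2 / p.pathlossExp .access i .nlos) := by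
    rw [← Real.rpow_natCast, ← Real.rpow_mul hL]; congr 1; push_cast; ring
  rw [hsq] at n2 e2
  have hnn : 0 ≤ p.pathlossMeasure i L := by
    simp only [pathlossMeasure]
    exact mul_nonneg (by positivity) (add_nonneg n1 n2)
  refine ⟨hnn, ?_⟩
  rw [← p.lintegral_pathloss i hm]
  have hq := fun s => (p.continuous_stateProb s).measurable
  have hterm : ∀ s, ∫⁻ x : Plane, ENNReal.ofReal (p.stateProb s ‖x‖) *
      ind (‖x‖ ^ p.pathlossExp .access i s ≤ L) = ENNReal.ofReal (2 * Real.pi) *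
        ∫⁻ r in Ioc 0 (L ^ (1 / p.pathlossExp .access i s)),
          ENNReal.ofReal (r * p.stateProb s r) := by
    intro s
    have := hq s
    have hm' : Measurable fun r : ℝ => ind (r ^ p.pathlossExp .access i s ≤ L) :=
      hm.comp (by fun_prop : Measurable fun r : ℝ => r ^ p.pathlossExp .access i s)
    rw [lintegral_norm (g := fun r => ENNReal.ofReal (p.stateProb s r) *
      ind (r ^ p.pathlossExp .access i s ≤ L)) (by fun_prop),
      lintegral_radial_le (p.pathlossExp_pos _ _ _) hL fun r => ENNReal.ofReal (p.stateProb s r)]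
    congr 1
    refine setLIntegral_congr_fun measurableSet_Ioc fun r hr => ?_
    rw [ENNReal.ofReal_mul hr.1.le]
  rw [lintegral_finsetSum _ fun s _ => by
    have := hq s
    exact (by fun_prop : Measurable fun x : Plane => ENNReal.ofReal (p.stateProb s ‖x‖)).mul
      (hm.comp (by fun_prop : Measurable fun x : Plane => ‖x‖ ^ p.pathlossExp .access i s))]
  simp_rw [hterm]
  rw [sum_linkState]
  simp only [stateProb]
  rw [e1, e2, ← mul_add, ← ENNReal.ofReal_add n1 n2, ← ENNReal.ofReal_mul (by positivity),
    ← ENNReal.ofReal_mul hd.le]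
  congr 1
  simp only [pathlossMeasure]
  ring

end Params

end IAB

namespace IAB

open Filter Topology

namespace Params

variable (p : Params)

/-! ### The pathloss process seen by the tagged small cell -/

lemma powerRatio_pos (j i : Tier) : 0 < p.powerRatio j i := by
  have h := fun k => mul_pos (mul_pos (mul_pos (p.power_pos k) (p.bias_pos k))
    (p.refLoss_pos .access k)) (p.mainGain_pos k)
  exact div_pos (h j) (h i)

lemma condDensityUser_eq (L r : ℝ) : p.condDensityUser L r = p.density .mbs *
    ∑ s, p.stateProb s r *
      if (p.powerRatio .mbs .sbs * L) ^ (1 / p.pathlossExp .access .mbs s) < r then 1 else 0 := by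
  rw [sum_linkState]
  simp only [condDensityUser, stateProb]
  ring

lemma condDensityUser_nonneg (L : ℝ) {r : ℝ} (hr : 0 ≤ r) : 0 ≤ p.condDensityUser L r := by
  rw [condDensityUser_eq]
  exact mul_nonneg (p.density_pos _).le (Finset.sum_nonneg fun s _ =>
    mul_nonneg (p.stateProb_nonneg s hr) (by split_ifs <;> norm_num))

lemma condDensityUser_le (L : ℝ) {r : ℝ} (hr : 0 ≤ r) :
    p.condDensityUser L r ≤ p.density .mbs * 2 := by
  rw [condDensityUser_eq]
  refine mul_le_mul_of_nonneg_left ?_ (p.density_pos _).le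
  have h : ∀ s, (p.stateProb s r *
      if (p.powerRatio .mbs .sbs * L) ^ (1 / p.pathlossExp .access .mbs s) < r then 1 else 0) ≤ 1 :=
    fun s => mul_le_one₀ (p.stateProb_le_one s hr) (by split_ifs <;> norm_num)
      (by split_ifs <;> norm_num)
  rw [sum_linkState]
  linarith [h .los, h .nlos]

lemma measurable_condDensityUser (L : ℝ) : Measurable (p.condDensityUser L) := by
  have h := p.continuous_losProb.measurable
  unfold condDensityUser
  refine ((h.const_mul _).mul (Measurable.ite measurableSet_Ioi measurable_const
    measurable_const)).add (((measurable_const.sub h).const_mul _).mul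
      (Measurable.ite measurableSet_Ioi measurable_const measurable_const))

lemma measurable_condDensity (L x : ℝ) :
    Measurable fun z : ℝ × ℝ => p.condDensity L z.2 z.1 x 0 := by
  unfold condDensity
  exact (p.measurable_condDensityUser L).comp (by fun_prop)

lemma condDensity_nonneg (L r θ x : ℝ) : 0 ≤ p.condDensity L r θ x 0 :=
  p.condDensityUser_nonneg L (Real.sqrt_nonneg _)

lemma condDensity_le (L r θ x : ℝ) : p.condDensity L r θ x 0 ≤ p.density .mbs * 2 :=
  p.condDensityUser_le L (Real.sqrt_nonneg _)

/-- Integration against the density of macro base stations, in polar coordinates around `y`. -/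
lemma lintegral_condDensity (L : ℝ) {φ : ℝ → ℝ≥0∞} (hφ : Measurable φ) (y : Plane) :
    ∫⁻ x : Plane, ENNReal.ofReal (p.condDensityUser L ‖x‖) *
        ∑ s, ENNReal.ofReal (p.stateProb s ‖x - y‖) *
          φ (‖x - y‖ ^ p.pathlossExp .backhaul .mbs s) =
      ∑ s, ∫⁻ θ in Ioc 0 (2 * Real.pi), ∫⁻ r in Ioi (0 : ℝ), ENNReal.ofReal r *
        ((ENNReal.ofReal (p.condDensity L r θ ‖y‖ 0) * ENNReal.ofReal (p.stateProb s r)) *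
          φ (r ^ p.pathlossExp .backhaul .mbs s)) := by
  have hq := fun s => (p.continuous_stateProb s).measurable
  have hc := p.measurable_condDensityUser L
  have hd := p.measurable_condDensity L ‖y‖
  have hterm : ∀ s, Measurable fun z : ℝ × ℝ => ENNReal.ofReal z.2 *
      ((ENNReal.ofReal (p.condDensity L z.2 z.1 ‖y‖ 0) * ENNReal.ofReal (p.stateProb s z.2)) *
          φ (z.2 ^ p.pathlossExp .backhaul .mbs s)) := fun s => by
    have := hq s
    fun_prop
  have hG : Measurable (Function.uncurry fun a b : ℝ => ENNReal.ofReal (p.condDensityUser L a) *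
      ∑ s, ENNReal.ofReal (p.stateProb s b) * φ (b ^ p.pathlossExp .backhaul .mbs s)) := by
    refine (hc.ennreal_ofReal.comp measurable_fst).mul
      (Finset.measurable_sum _ fun s _ => ?_)
    have := hq s
    fun_prop
  rw [lintegral_two_norms hG y, ← restrict_Ioo_eq_restrict_Ioc,
    ← lintegral_finsetSum _ fun s _ => (hterm s).lintegral_prod_right']
  refine lintegral_congr fun θ => ?_
  have hterm2 : ∀ s, Measurable fun r : ℝ => ENNReal.ofReal r *
      ((ENNReal.ofReal (p.condDensity L r θ ‖y‖ 0) * ENNReal.ofReal (p.stateProb s r)) *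
          φ (r ^ p.pathlossExp .backhaul .mbs s)) := fun s =>
    (hterm s).comp (measurable_prodMk_left (x := θ))
  refine Eq.trans ?_ (lintegral_finsetSum _ fun s _ => hterm2 s)
  refine lintegral_congr fun r => ?_
  rw [Finset.mul_sum, Finset.mul_sum]
  refine Finset.sum_congr rfl fun s _ => ?_
  rw [condDensity, sub_zero]
  ring

/-- Bridge between the real iterated integrals in the definitions and the extended nonnegative ones
of the proof: a bounded function is integrable for a finite product measure. -/
lemma lintegral_ofReal_prod {μ ν : Measure ℝ} [IsFiniteMeasure μ] [IsFiniteMeasure ν]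
    {g : ℝ × ℝ → ℝ} (hg : Measurable g) {C : ℝ} (h0 : ∀ᵐ z ∂(μ.prod ν), 0 ≤ g z)
    (hC : ∀ᵐ z ∂(μ.prod ν), g z ≤ C) :
    Integrable (fun θ => ∫ r, g (θ, r) ∂ν) μ ∧ 0 ≤ ∫ θ, ∫ r, g (θ, r) ∂ν ∂μ ∧
      ∫⁻ θ, ∫⁻ r, ENNReal.ofReal (g (θ, r)) ∂ν ∂μ =
        ENNReal.ofReal (∫ θ, ∫ r, g (θ, r) ∂ν ∂μ) := by
  have hi : Integrable g (μ.prod ν) := by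
    refine Integrable.of_bound hg.aestronglyMeasurable C ?_
    filter_upwards [h0, hC] with z h1 h2
    rwa [Real.norm_of_nonneg h1]
  refine ⟨hi.integral_prod_left, ?_, ?_⟩
  · rw [← integral_prod _ hi]; exact integral_nonneg_of_ae h0
  · rw [← integral_prod _ hi, ofReal_integral_eq_lintegral_ofReal hi h0,
      lintegral_prod _ hg.ennreal_ofReal.aemeasurable]

/-- Polar coordinates around the small cell turn the mass into the defining integral, over a bounded
region. The mass is therefore finite, which the continuity needed for the anchor relies on. -/
lemma condPathlossMeasure_spec (t : LinkState) {l : ℝ} (hl : 0 ≤ l) {L : ℝ} {y : Plane}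
    (hy : ‖y‖ = L ^ (1 / p.pathlossExp .access .sbs t)) :
    0 ≤ p.condPathlossMeasure t l L 0 ∧
    ∫⁻ x : Plane, ENNReal.ofReal (p.condDensityUser L ‖x‖) *
        ∑ s, ENNReal.ofReal (p.stateProb s ‖x - y‖) *
          ind (‖x - y‖ ^ p.pathlossExp .backhaul .mbs s ≤ l) =
      ENNReal.ofReal (p.condPathlossMeasure t l L 0) := by
  set R : LinkState → ℝ := fun s => l ^ (1 / p.pathlossExp .backhaul .mbs s) with hR
  have hR0 : ∀ s, 0 ≤ R s := fun s => Real.rpow_nonneg hl _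
  let g : LinkState → ℝ × ℝ → ℝ := fun s z => p.condDensity L z.2 z.1 ‖y‖ 0 * p.stateProb s z.2 * z.2
  have hgm : ∀ s, Measurable (g s) := fun s =>
    ((p.measurable_condDensity L ‖y‖).mul
      ((p.continuous_stateProb s).measurable.comp measurable_snd)).mul measurable_snd
  have hpi : (0 : ℝ) ≤ 2 * Real.pi := by positivity
  have hmem : ∀ s, ∀ᵐ z ∂((volume.restrict (Ioc 0 (2 * Real.pi))).prod
      (volume.restrict (Ioc 0 (R s)))), z.2 ∈ Ioc 0 (R s) := fun s => by
    rw [Measure.prod_restrict]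
    exact (ae_restrict_mem (measurableSet_Ioc.prod measurableSet_Ioc)).mono fun z hz => hz.2
  -- The factor 2 in the bound is crude: each of the two link states contributes at most the full
  -- density.
  have key := fun s => lintegral_ofReal_prod (μ := volume.restrict (Ioc 0 (2 * Real.pi)))
    (ν := volume.restrict (Ioc 0 (R s))) (hgm s) (C := p.density .mbs * 2 * R s)
    ((hmem s).mono fun z hz => mul_nonneg (mul_nonneg (p.condDensity_nonneg _ _ _ _)
      (p.stateProb_nonneg s hz.1.le)) hz.1.le)
    ((hmem s).mono fun z hz => by
      refine mul_le_mul ?_ hz.2 hz.1.le (mul_nonneg (p.density_pos _).le zero_le_two)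
      exact (mul_le_of_le_one_right (p.condDensity_nonneg _ _ _ _)
        (p.stateProb_le_one s hz.1.le)).trans (p.condDensity_le _ _ _ _))
  have hval : p.condPathlossMeasure t l L 0 =
      ∑ s, ∫ θ in Ioc 0 (2 * Real.pi), ∫ r in Ioc 0 (R s), g s (θ, r) := by
    rw [sum_linkState, ← integral_add (key .los).1 (key .nlos).1]
    simp only [condPathlossMeasure]
    rw [intervalIntegral.integral_of_le hpi, ← hy]
    refine integral_congr_ae (Eventually.of_forall fun θ => ?_)
    simp only
    rw [intervalIntegral.integral_of_le (hR0 .los), intervalIntegral.integral_of_le (hR0 .nlos)]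
    rfl
  refine ⟨hval ▸ Finset.sum_nonneg fun s _ => (key s).2.1, ?_⟩
  rw [p.lintegral_condDensity L (φ := fun z => ind (z ≤ l)) (measurable_ind measurableSet_Iic) y,
    hval, ENNReal.ofReal_sum_of_nonneg fun s _ => (key s).2.1]
  refine Finset.sum_congr rfl fun s _ => ?_
  rw [← (key s).2.2]
  refine lintegral_congr fun θ => ?_
  rw [lintegral_radial_le (p.pathlossExp_pos _ _ _) hl fun r =>
    ENNReal.ofReal (p.condDensity L r θ ‖y‖ 0) * ENNReal.ofReal (p.stateProb s r)]
  refine setLIntegral_congr_fun measurableSet_Ioc fun r hr => ?_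
  have h1 := p.condDensity_nonneg L r θ ‖y‖
  rw [ENNReal.ofReal_mul (mul_nonneg h1 (p.stateProb_nonneg s hr.1.le)), ENNReal.ofReal_mul h1,
    mul_comm]

/-- Contribution to `condPathlossDensity` of the direction `θ` and the link state `s`, the tagged
small cell being at distance `x`. -/
def condIntegrand (L x : ℝ) (s : LinkState) (l θ : ℝ) : ℝ :=
  p.condDensity L (l ^ (1 / p.pathlossExp .backhaul .mbs s)) θ x 0 *
    (1 / p.pathlossExp .backhaul .mbs s * l ^ (2 / p.pathlossExp .backhaul .mbs s - 1) *
      p.stateProb s (l ^ (1 / p.pathlossExp .backhaul .mbs s)))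

lemma measurable_condIntegrand (L x : ℝ) (s : LinkState) :
    Measurable (Function.uncurry (p.condIntegrand L x s)) := by
  have := (p.continuous_stateProb s).measurable
  have h2 : Measurable fun z : ℝ × ℝ =>
      p.condDensity L (z.1 ^ (1 / p.pathlossExp .backhaul .mbs s)) z.2 x 0 :=
    (p.measurable_condDensity L x).comp
      (f := fun z : ℝ × ℝ => (z.2, z.1 ^ (1 / p.pathlossExp .backhaul .mbs s))) (by fun_prop)
  unfold condIntegrand Function.uncurry
  fun_prop

lemma condIntegrand_factor_nonneg (s : LinkState) {l : ℝ} (hl : 0 < l) :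
    0 ≤ 1 / p.pathlossExp .backhaul .mbs s * l ^ (2 / p.pathlossExp .backhaul .mbs s - 1) := by
  have := p.pathlossExp_pos .backhaul .mbs s
  positivity

lemma condIntegrand_nonneg (L x : ℝ) (s : LinkState) {l : ℝ} (hl : 0 < l) (θ : ℝ) :
    0 ≤ p.condIntegrand L x s l θ :=
  mul_nonneg (p.condDensity_nonneg _ _ _ _) (mul_nonneg (p.condIntegrand_factor_nonneg s hl)
    (p.stateProb_nonneg s (Real.rpow_nonneg hl.le _)))

lemma integrable_condIntegrand (L x : ℝ) (s : LinkState) {l : ℝ} (hl : 0 < l) :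
    Integrable (p.condIntegrand L x s l) (volume.restrict (Ioc 0 (2 * Real.pi))) := by
  refine Integrable.of_bound
    (p.measurable_condIntegrand L x s).of_uncurry_left.aestronglyMeasurable
    (p.density .mbs * 2 * (1 / p.pathlossExp .backhaul .mbs s *
      l ^ (2 / p.pathlossExp .backhaul .mbs s - 1) * 1)) (Eventually.of_forall fun θ => ?_)
  rw [Real.norm_of_nonneg (p.condIntegrand_nonneg L x s hl θ)]
  have h0 := Real.rpow_nonneg hl.le (1 / p.pathlossExp .backhaul .mbs s)
  have h3 := p.condIntegrand_factor_nonneg s hl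
  exact mul_le_mul (p.condDensity_le _ _ _ _)
    (mul_le_mul_of_nonneg_left (p.stateProb_le_one s h0) h3)
    (mul_nonneg h3 (p.stateProb_nonneg s h0)) (mul_nonneg (p.density_pos .mbs).le zero_le_two)

lemma ofReal_condPathlossDensity (t : LinkState) {L x : ℝ}
    (hx : x = L ^ (1 / p.pathlossExp .access .sbs t)) {l : ℝ} (hl : 0 < l) :
    ENNReal.ofReal (p.condPathlossDensity t l L 0) =
      ∑ s, ∫⁻ θ in Ioc 0 (2 * Real.pi), ENNReal.ofReal (p.condIntegrand L x s l θ) := by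
  have hi := fun s => p.integrable_condIntegrand L x s hl
  have e : p.condPathlossDensity t l L 0 =
      ∑ s, ∫ θ in Ioc 0 (2 * Real.pi), p.condIntegrand L x s l θ := by
    rw [sum_linkState, ← integral_add (hi .los) (hi .nlos)]
    simp only [condPathlossDensity]
    rw [intervalIntegral.integral_of_le (by positivity), ← hx]
    rfl
  rw [e, ENNReal.ofReal_sum_of_nonneg fun s _ => integral_nonneg fun θ =>
    p.condIntegrand_nonneg L x s hl θ]
  exact Finset.sum_congr rfl fun s _ => ofReal_integral_eq_lintegral_ofReal (hi s)
    (Eventually.of_forall fun θ => p.condIntegrand_nonneg L x s hl θ)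

lemma condPathlossDensity_spec (t : LinkState) {L : ℝ} {y : Plane}
    (hy : ‖y‖ = L ^ (1 / p.pathlossExp .access .sbs t)) {φ : ℝ → ℝ≥0∞} (hφ : Measurable φ) :
    ∫⁻ x : Plane, ENNReal.ofReal (p.condDensityUser L ‖x‖) *
        ∑ s, ENNReal.ofReal (p.stateProb s ‖x - y‖) *
          φ (‖x - y‖ ^ p.pathlossExp .backhaul .mbs s) =
      ∫⁻ l in Ioi (0 : ℝ), φ l * ENNReal.ofReal (p.condPathlossDensity t l L 0) := by
  have hgm := p.measurable_condIntegrand L ‖y‖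
  have hgm1 : ∀ s, Measurable (Function.uncurry fun θ l : ℝ =>
      φ l * ENNReal.ofReal (p.condIntegrand L ‖y‖ s l θ)) := fun s =>
    (hφ.comp measurable_snd).mul ((hgm s).comp measurable_swap).ennreal_ofReal
  rw [p.lintegral_condDensity L hφ y]
  have hsub : ∀ s θ, ∫⁻ r in Ioi (0 : ℝ), ENNReal.ofReal r *
        ((ENNReal.ofReal (p.condDensity L r θ ‖y‖ 0) * ENNReal.ofReal (p.stateProb s r)) *
          φ (r ^ p.pathlossExp .backhaul .mbs s)) =
      ∫⁻ l in Ioi (0 : ℝ), φ l * ENNReal.ofReal (p.condIntegrand L ‖y‖ s l θ) := by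
    intro s θ
    rw [lintegral_Ioi_pathloss (p.pathlossExp_pos _ _ _) φ fun r =>
      ENNReal.ofReal (p.condDensity L r θ ‖y‖ 0) * ENNReal.ofReal (p.stateProb s r)]
    refine setLIntegral_congr_fun measurableSet_Ioi fun l hl => ?_
    rw [condIntegrand, ENNReal.ofReal_mul (p.condDensity_nonneg _ _ _ _),
      ENNReal.ofReal_mul (p.condIntegrand_factor_nonneg s hl)]
    ring
  simp_rw [hsub]
  have hswap : ∀ s, ∫⁻ θ in Ioc 0 (2 * Real.pi), ∫⁻ l in Ioi (0 : ℝ),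
      φ l * ENNReal.ofReal (p.condIntegrand L ‖y‖ s l θ) = ∫⁻ l in Ioi (0 : ℝ), φ l *
        ∫⁻ θ in Ioc 0 (2 * Real.pi), ENNReal.ofReal (p.condIntegrand L ‖y‖ s l θ) := by
    intro s
    rw [lintegral_lintegral_swap (hgm1 s).aemeasurable]
    exact lintegral_congr fun l => lintegral_const_mul _ (hgm s).of_uncurry_left.ennreal_ofReal
  simp_rw [hswap]
  have hm3 : ∀ s, Measurable fun l => φ l *
      ∫⁻ θ in Ioc 0 (2 * Real.pi), ENNReal.ofReal (p.condIntegrand L ‖y‖ s l θ) := fun s =>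
    hφ.mul (Measurable.lintegral_prod_right (f := fun l θ =>
      ENNReal.ofReal (p.condIntegrand L ‖y‖ s l θ)) (hgm s).ennreal_ofReal)
  rw [← lintegral_finsetSum _ fun s _ => hm3 s]
  refine setLIntegral_congr_fun measurableSet_Ioi fun l hl => ?_
  rw [p.ofReal_condPathlossDensity t hy hl, Finset.mul_sum]

end Params

end IAB

/-! ### Comparisons, interference factors and the exponent as a function of the serving level -/

namespace IAB

open Filter Topology

/-- A measurable comparison of real numbers, strict or not. -/
structure IsCmp (R : ℝ → ℝ → Prop) : Prop where
  of_lt : ∀ {a b}, a < b → R a b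
  le : ∀ {a b}, R a b → a ≤ b
  meas : MeasurableSet {z : ℝ × ℝ | R z.1 z.2}

lemma isCmp_lt : IsCmp (· < ·) :=
  ⟨fun h => h, fun h => le_of_lt h, measurableSet_lt measurable_fst measurable_snd⟩

lemma isCmp_le : IsCmp (· ≤ ·) :=
  ⟨fun h => le_of_lt h, fun h => h, measurableSet_le measurable_fst measurable_snd⟩

lemma IsCmp.of_le {R : ℝ → ℝ → Prop} (hR : IsCmp R) {a a' b : ℝ} (h : a' ≤ a) (hab : R a b) :
    R a' b := by
  rcases h.eq_or_lt with rfl | h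
  · exact hab
  · exact hR.of_lt (h.trans_le (hR.le hab))

/-- The strict and weak comparisons differ only at ties. Ties form a null set in the integrals
below, so the exponents do not depend on `R`. -/
lemma IsCmp.ind_eq {R : ℝ → ℝ → Prop} (hR : IsCmp R) {a b : ℝ} (h : b ≠ a) :
    ind (R a b) = ind (a < b) := by
  rcases h.lt_or_gt with h | h
  · rw [ind_false fun hh => absurd (hR.le hh) (not_le.2 h), ind_false (not_lt.2 h.le)]
  · rw [ind_true (hR.of_lt h), ind_true h]

lemma IsCmp.measurable {R : ℝ → ℝ → Prop} (hR : IsCmp R) {α : Type*} [MeasurableSpace α]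
    {f g : α → ℝ} (hf : Measurable f) (hg : Measurable g) :
    Measurable fun a => ind (R (f a) (g a)) :=
  measurable_ind (q := fun a => R (f a) (g a)) (hf.prodMk hg hR.meas)

lemma inv_one_add_ofReal {a : ℝ} (ha : 0 ≤ a) :
    (1 + ENNReal.ofReal a)⁻¹ = ENNReal.ofReal (1 / (1 + a)) := by
  rw [one_div, ENNReal.ofReal_inv_of_pos (by positivity), ENNReal.ofReal_add zero_le_one ha,
    ENNReal.ofReal_one]

lemma one_sub_inv_one_add_ofReal {a : ℝ} (ha : 0 ≤ a) :
    1 - (1 + ENNReal.ofReal a)⁻¹ = ENNReal.ofReal (1 - 1 / (1 + a)) := by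
  rw [inv_one_add_ofReal ha, ENNReal.ofReal_sub _ (by positivity), ENNReal.ofReal_one]

lemma inv_one_add_le_one (a : ℝ≥0∞) : (1 + a)⁻¹ ≤ 1 := ENNReal.inv_le_one.2 le_self_add

/-- A doubling inequality: the function a/(1+a) at most doubles when `a` does. It is the source of
the dichotomy in `continuousAt_levelE`. -/
lemma one_sub_inv_one_add_two_mul_le {a : ℝ} :
    1 - (1 + ENNReal.ofReal (2 * a))⁻¹ ≤ 2 * (1 - (1 + ENNReal.ofReal a)⁻¹) := by
  rcases le_or_gt a 0 with ha | ha
  · rw [ENNReal.ofReal_of_nonpos (by linarith : 2 * a ≤ 0)]; simp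
  · rw [one_sub_inv_one_add_ofReal (by positivity), one_sub_inv_one_add_ofReal ha.le,
      ← ENNReal.ofReal_ofNat, ← ENNReal.ofReal_mul zero_le_two]
    refine ENNReal.ofReal_le_ofReal ?_
    have h1 : 1 - 1 / (1 + 2 * a) = 2 * a / (1 + 2 * a) := by field_simp; ring
    have h2 : 2 * (1 - 1 / (1 + a)) = 2 * a / (1 + a) := by field_simp; ring
    rw [h1, h2]
    gcongr
    linarith

namespace Params

variable (p : Params)

lemma lobeProb_nonneg (d : Bool × Bool) : 0 ≤ p.lobeProb d := by
  have h1 := p.beamwidth_mem .sbs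
  have h2 := p.ueBeamwidth_mem
  unfold lobeProb
  refine div_nonneg (mul_nonneg ?_ ?_) (by positivity)
  · split_ifs; exacts [h1.1, sub_nonneg.2 h1.2]
  · split_ifs; exacts [h2.1, sub_nonneg.2 h2.2]

lemma lobeGain_nonneg (d : Bool × Bool) : 0 ≤ p.lobeGain d := by
  unfold lobeGain
  refine mul_nonneg ?_ ?_
  · split_ifs; exacts [(p.mainGain_pos _).le, p.sideGain_nonneg _]
  · split_ifs; exacts [p.ueMainGain_pos.le, p.ueSideGain_nonneg]

lemma sum_lobeProb : ∑ d, ENNReal.ofReal (p.lobeProb d) = 1 := by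
  rw [← ENNReal.ofReal_sum_of_nonneg fun d _ => p.lobeProb_nonneg d, ← ENNReal.ofReal_one]
  congr 1
  rw [Fintype.sum_prod_type]
  simp only [Fintype.sum_bool, lobeProb]
  have := Real.pi_pos.ne'
  simp
  field_simp
  ring

/-- Average over the antenna alignment of the Laplace transform of one interference term. -/
def intfK (c l z : ℝ) : ℝ≥0∞ :=
  ∑ d, ENNReal.ofReal (p.lobeProb d) * (1 + ENNReal.ofReal (c * p.lobeGain d * l / z))⁻¹

lemma intfK_le_one (c l z : ℝ) : p.intfK c l z ≤ 1 :=
  (Finset.sum_le_sum fun _ _ =>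
    mul_le_of_le_one_right' (inv_one_add_le_one _)).trans p.sum_lobeProb.le

lemma one_sub_intfK (c l z : ℝ) : 1 - p.intfK c l z = ∑ d, ENNReal.ofReal (p.lobeProb d) *
    (1 - (1 + ENNReal.ofReal (c * p.lobeGain d * l / z))⁻¹) := by
  have hle := p.intfK_le_one c l z
  symm
  refine ENNReal.eq_sub_of_add_eq (hle.trans_lt ENNReal.one_lt_top).ne ?_
  rw [intfK, ← Finset.sum_add_distrib]
  refine Eq.trans ?_ p.sum_lobeProb
  exact Finset.sum_congr rfl fun d _ => by
    rw [← mul_add, tsub_add_cancel_of_le (inv_one_add_le_one _), mul_one]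

/-- The factor by which a base station of tier `j` with pathloss `z` contributes to the Laplace
transform of the interference; macro base stations do not interfere. -/
def tierK (c : ℝ) (j : Tier) (l z : ℝ) : ℝ≥0∞ :=
  match j with
  | .mbs => 1
  | .sbs => p.intfK c l z

lemma tierK_le_one (c : ℝ) (j : Tier) (l z : ℝ) : p.tierK c j l z ≤ 1 := by
  cases j
  · exact le_rfl
  · exact p.intfK_le_one c l z

lemma tierK_antitone {c : ℝ} (hc : 0 ≤ c) (j : Tier) {z : ℝ} (hz : 0 ≤ z) :
    Antitone fun l => p.tierK c j l z := by
  intro l l' hl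
  cases j
  · exact le_rfl
  · show p.intfK c l' z ≤ p.intfK c l z
    refine Finset.sum_le_sum fun d _ => mul_le_mul' le_rfl ?_
    refine ENNReal.inv_le_inv.2 (add_le_add_right (ENNReal.ofReal_le_ofReal ?_) _)
    have := p.lobeGain_nonneg d
    gcongr

lemma measurable_tierK (c : ℝ) (j : Tier) :
    Measurable (Function.uncurry (p.tierK c j)) := by
  cases j
  · exact measurable_const
  · unfold Function.uncurry tierK intfK
    fun_prop

lemma continuous_tierK (c : ℝ) (j : Tier) (z : ℝ) : Continuous fun l => p.tierK c j l z := by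
  cases j
  · exact continuous_const
  · unfold tierK intfK
    refine continuous_finsetSum _ fun d _ => ?_
    refine ENNReal.continuous_const_mul (by simp) |>.comp (continuous_inv.comp ?_)
    exact continuous_const.add (ENNReal.continuous_ofReal.comp (by fun_prop))

lemma one_sub_tierK_two_mul (c : ℝ) (j : Tier) (l z : ℝ) :
    1 - p.tierK c j (2 * l) z ≤ 2 * (1 - p.tierK c j l z) := by
  cases j
  · simp [tierK]
  · simp only [tierK]
    rw [one_sub_intfK, one_sub_intfK, Finset.mul_sum]
    refine Finset.sum_le_sum fun d _ => ?_
    rw [mul_left_comm 2]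
    refine mul_le_mul' le_rfl ?_
    have : c * p.lobeGain d * (2 * l) / z = 2 * (c * p.lobeGain d * l / z) := by ring
    rw [this]
    exact one_sub_inv_one_add_two_mul_le

/-- Average over the link state of the contribution of a base station of tier `j` at distance `r`,
the serving base station being of tier `i` with pathloss `l`. -/
def levelF (R : ℝ → ℝ → Prop) (c : ℝ) (i j : Tier) (l r : ℝ) : ℝ≥0∞ :=
  ∑ s, ENNReal.ofReal (p.stateProb s r) *
    (ind (R (p.powerRatio j i * l) (r ^ p.pathlossExp .access j s)) *
      p.tierK c j l (r ^ p.pathlossExp .access j s))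

variable {R : ℝ → ℝ → Prop}

lemma levelF_le_one (R : ℝ → ℝ → Prop) (c : ℝ) (i j : Tier) (l : ℝ) {r : ℝ} (hr : 0 ≤ r) :
    p.levelF R c i j l r ≤ 1 :=
  (Finset.sum_le_sum fun _ _ => mul_le_of_le_one_right'
    (mul_le_one' (ind_le_one _) (p.tierK_le_one _ _ _ _))).trans (p.sum_stateProb hr).le

lemma levelF_antitone (hR : IsCmp R) {c : ℝ} (hc : 0 ≤ c) (i j : Tier) {r : ℝ} (hr : 0 ≤ r) :
    Antitone fun l => p.levelF R c i j l r := fun _ _ hl =>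
  Finset.sum_le_sum fun _ _ => mul_le_mul_right (mul_le_mul'
    (ind_mono (hR.of_le (mul_le_mul_of_nonneg_left hl (p.powerRatio_pos j i).le)))
    (p.tierK_antitone hc j (Real.rpow_nonneg hr _) hl)) _

lemma measurable_levelF (hR : IsCmp R) (c : ℝ) (i j : Tier) :
    Measurable fun z : ℝ × ℝ => p.levelF R c i j z.1 z.2 := by
  refine Finset.measurable_sum _ fun s _ => ?_
  have h1 := (p.continuous_stateProb s).measurable
  refine Measurable.mul (by fun_prop) ((hR.measurable (by fun_prop) (by fun_prop)).mul ?_)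
  exact (p.measurable_tierK c j).comp
    (f := fun z : ℝ × ℝ => (z.1, z.2 ^ p.pathlossExp .access j s)) (by fun_prop)

/-- Exponent contributed by tier `j` when the serving base station is of tier `i` with
pathloss `l`. -/
def levelE (c : ℝ) (i j : Tier) (l : ℝ) : ℝ≥0∞ :=
  ∫⁻ z in Ioi (0 : ℝ), (1 - ind (p.powerRatio j i * l < z) * p.tierK c j l z) *
    ENNReal.ofReal (p.pathlossDensity j z)

lemma measurable_levelE_integrand (hR : IsCmp R) (c : ℝ) (i j : Tier) (l : ℝ) :
    Measurable fun z => 1 - ind (R (p.powerRatio j i * l) z) * p.tierK c j l z :=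
  measurable_const.sub ((hR.measurable measurable_const measurable_id).mul
    (p.measurable_tierK c j).of_uncurry_left)

lemma lintegral_one_sub_levelF (hR : IsCmp R) (c : ℝ) (i j : Tier) (l : ℝ) :
    ENNReal.ofReal (p.density j) * ∫⁻ y : Plane, (1 - p.levelF R c i j l ‖y‖) =
      p.levelE c i j l := by
  have h := p.lintegral_pathloss j (p.measurable_levelE_integrand hR c i j l)
  simp_rw [levelF, fun y : Plane => p.one_sub_sum_stateProb (norm_nonneg y)
    (a := fun s => ind (R (p.powerRatio j i * l) (‖y‖ ^ p.pathlossExp .access j s)) *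
      p.tierK c j l (‖y‖ ^ p.pathlossExp .access j s))
    fun s => mul_le_one' (ind_le_one _) (p.tierK_le_one _ _ _ _)]
  rw [h, levelE]
  refine lintegral_congr_ae ?_
  have hne : ∀ᵐ z ∂(volume.restrict (Ioi (0 : ℝ))), z ≠ p.powerRatio j i * l :=
    ae_restrict_of_ae (by simp [ae_iff])
  filter_upwards [hne] with z hz
  rw [hR.ind_eq hz]

lemma levelE_mono {c : ℝ} (hc : 0 ≤ c) (i j : Tier) : Monotone (p.levelE c i j) := by
  intro l l' hl
  refine setLIntegral_mono' measurableSet_Ioi fun z hz => ?_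
  refine mul_le_mul_left (tsub_le_tsub_left (mul_le_mul' (ind_mono fun h => ?_)
    (p.tierK_antitone hc j (le_of_lt hz) hl)) _) _
  exact (mul_le_mul_of_nonneg_left hl (p.powerRatio_pos j i).le).trans_lt h

/-- Up to the larger exclusion level the integrand is at most 1 and contributes a finite pathloss
mass. Beyond it both indicators are 1 and the doubling inequality applies. -/
lemma levelE_two_mul (c : ℝ) (i j : Tier) {l : ℝ} (hl : 0 < l) :
    p.levelE c i j (2 * l) ≤ 2 * p.levelE c i j l +
      ENNReal.ofReal (p.pathlossMeasure j (p.powerRatio j i * (2 * l))) := by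
  have hΩ := p.powerRatio_pos j i
  have hm := p.measurable_pathlossDensity j
  have hm2 := p.measurable_levelE_integrand isCmp_lt c i j l
  rw [← (p.pathlossMeasure_spec j (by positivity : 0 ≤ p.powerRatio j i * (2 * l))).2, levelE,
    levelE, ← lintegral_const_mul _ (hm2.fun_mul hm.ennreal_ofReal),
    ← lintegral_add_left ((hm2.fun_mul hm.ennreal_ofReal).const_mul 2)]
  refine setLIntegral_mono' measurableSet_Ioi fun z hz => ?_
  refine (mul_le_mul' (?_ : _ ≤ 2 * (1 - ind (p.powerRatio j i * l < z) * p.tierK c j l z) +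
    ind (z ≤ p.powerRatio j i * (2 * l))) le_rfl).trans_eq (by rw [add_mul, mul_assoc])
  by_cases h : p.powerRatio j i * (2 * l) < z
  · have h' : p.powerRatio j i * l < z := by nlinarith
    rw [ind_true h, ind_true h', one_mul, one_mul]
    exact (p.one_sub_tierK_two_mul c j l z).trans le_self_add
  · rw [ind_true (not_lt.1 h)]
    exact tsub_le_self.trans le_add_self

/-- The pathloss exponents are arbitrary positive numbers, so the interference exponent may diverge.
If it is infinite at 2l, two applications of the doubling bound make it infinite at l/2, hence, by
monotonicity, constantly ∞ near l. Otherwise the integrand at 2l is an integrable bound near l. -/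
lemma continuousAt_levelE {c : ℝ} (hc : 0 ≤ c) (i j : Tier) {l : ℝ} (hl : 0 < l) :
    ContinuousAt (p.levelE c i j) l := by
  have hmono := p.levelE_mono hc i j
  by_cases htop : p.levelE c i j (2 * l) = ∞
  · have hhalf : ∀ a, 0 < a → p.levelE c i j (2 * a) = ∞ → p.levelE c i j a = ∞ := by
      intro a ha h
      have := p.levelE_two_mul c i j ha
      rw [h, top_le_iff, ENNReal.add_eq_top] at this
      rcases this with h1 | h1
      · by_contra h2
        exact ENNReal.mul_ne_top (by simp) h2 h1
      · simp at h1
    have h1 := hhalf l hl htop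
    have h2 := hhalf (l / 2) (by positivity) (by rwa [mul_div_cancel₀ l two_ne_zero])
    have hev : p.levelE c i j =ᶠ[𝓝 l] fun _ => ∞ := by
      filter_upwards [Ioi_mem_nhds (by linarith : l / 2 < l)] with a ha
      exact top_le_iff.1 (h2 ▸ hmono (le_of_lt ha))
    exact continuousAt_const.congr hev.symm
  · have hm := p.measurable_pathlossDensity j
    refine tendsto_lintegral_filter_of_dominated_convergence (fun z =>
      (1 - ind (p.powerRatio j i * (2 * l) < z) * p.tierK c j (2 * l) z) *
        ENNReal.ofReal (p.pathlossDensity j z)) ?_ ?_ htop ?_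
    · exact Eventually.of_forall fun a =>
        (p.measurable_levelE_integrand isCmp_lt c i j a).mul hm.ennreal_ofReal
    · filter_upwards [Iio_mem_nhds (by linarith : l < 2 * l)] with a ha
      filter_upwards [ae_restrict_mem measurableSet_Ioi] with z hz
      refine mul_le_mul_left (tsub_le_tsub_left (mul_le_mul' (ind_mono fun h => ?_)
        (p.tierK_antitone hc j (le_of_lt hz) (le_of_lt ha))) _) _
      exact (mul_le_mul_of_nonneg_left (le_of_lt ha) (p.powerRatio_pos j i).le).trans_lt h
    · have hne : ∀ᵐ z ∂(volume.restrict (Ioi (0 : ℝ))), z ≠ p.powerRatio j i * l :=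
        ae_restrict_of_ae (by simp [ae_iff])
      filter_upwards [hne] with z hz
      refine ENNReal.Tendsto.mul_const ?_ (Or.inr (by simp))
      refine ENNReal.Tendsto.sub tendsto_const_nhds ?_ (Or.inl (by simp))
      have hK := (p.continuous_tierK c j z).tendsto l
      -- Away from the single excluded value of z, the indicator is locally constant in the level.
      have hind : ∀ᶠ a in 𝓝 l, ind (p.powerRatio j i * a < z) = ind (p.powerRatio j i * l < z) := by
        have hcont : Tendsto (fun a => p.powerRatio j i * a) (𝓝 l) (𝓝 (p.powerRatio j i * l)) :=
          tendsto_id.const_mul _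
        rcases hz.lt_or_gt with h | h
        · filter_upwards [hcont.eventually (lt_mem_nhds h)] with a ha
          rw [ind_false (not_lt.2 (le_of_lt ha)), ind_false (not_lt.2 h.le)]
        · filter_upwards [hcont.eventually (gt_mem_nhds h)] with a ha
          rw [ind_true ha, ind_true h]
      refine (ENNReal.Tendsto.const_mul hK
        (Or.inr ((ind_le_one _).trans_lt ENNReal.one_lt_top).ne)).congr' ?_
      filter_upwards [hind] with a ha
      rw [ha]

lemma continuousAt_lintegral_levelF (hR : IsCmp R) {c : ℝ} (hc : 0 ≤ c) (i j : Tier) {l : ℝ}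
    (hl : 0 < l) : ContinuousAt (fun l => ∫⁻ y : Plane, (1 - p.levelF R c i j l ‖y‖)) l := by
  have h0 : ENNReal.ofReal (p.density j) ≠ 0 := by simpa using p.density_pos j
  have e : (fun l => ∫⁻ y : Plane, (1 - p.levelF R c i j l ‖y‖)) =
      fun l => (ENNReal.ofReal (p.density j))⁻¹ * p.levelE c i j l := by
    ext l
    rw [← p.lintegral_one_sub_levelF hR c i j l, ← mul_assoc,
      ENNReal.inv_mul_cancel h0 (by simp), one_mul]
  rw [e]
  exact ENNReal.Tendsto.const_mul (p.continuousAt_levelE hc i j hl) (Or.inr (by simpa using h0))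

lemma levelE_mbs (c : ℝ) (i : Tier) {l : ℝ} (hl : 0 ≤ l) :
    p.levelE c i .mbs l = ENNReal.ofReal (p.pathlossMeasure .mbs (p.powerRatio .mbs i * l)) := by
  rw [← (p.pathlossMeasure_spec .mbs (mul_nonneg (p.powerRatio_pos .mbs i).le hl)).2, levelE]
  refine lintegral_congr fun z => ?_
  congr 1
  by_cases h : p.powerRatio .mbs i * l < z
  · simp [ind_true h, ind_false (not_le.2 h), tierK]
  · simp [ind_false h, ind_true (not_lt.1 h)]

/-- The integrand 1 - 1[z > Ωl] K equals 1[z > Ωl](1 - K) + 1[z ≤ Ωl]: interference from beyond the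
exclusion level, and the void condition inside it. -/
lemma levelE_sbs {c : ℝ} (hc : 0 ≤ c) (i : Tier) {l : ℝ} (hl : 0 ≤ l) :
    p.levelE c i .sbs l =
      (∑ d : Bool × Bool, ∫⁻ z in Ioi (p.powerRatio .sbs i * l),
        ENNReal.ofReal ((1 - 1 / (1 + c * p.lobeGain d * l / z)) * p.lobeProb d *
          p.pathlossDensity .sbs z)) +
      ENNReal.ofReal (p.pathlossMeasure .sbs (p.powerRatio .sbs i * l)) := by
  have hL : 0 ≤ p.powerRatio .sbs i * l := mul_nonneg (p.powerRatio_pos .sbs i).le hl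
  have hm := p.measurable_pathlossDensity .sbs
  have hmK : Measurable fun z => p.intfK c l z :=
    (p.measurable_tierK c .sbs).of_uncurry_left
  have h1 : ∑ d : Bool × Bool, ∫⁻ z in Ioi (p.powerRatio .sbs i * l),
        ENNReal.ofReal ((1 - 1 / (1 + c * p.lobeGain d * l / z)) * p.lobeProb d *
          p.pathlossDensity .sbs z) =
      ∫⁻ z in Ioi (0 : ℝ), ind (p.powerRatio .sbs i * l < z) *
        ((1 - p.intfK c l z) * ENNReal.ofReal (p.pathlossDensity .sbs z)) := by
    rw [← lintegral_finsetSum _ fun d _ => by fun_prop, ← lintegral_indicator measurableSet_Ioi,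
      ← lintegral_indicator measurableSet_Ioi]
    refine lintegral_congr fun z => ?_
    by_cases hz : p.powerRatio .sbs i * l < z
    · have hz0 : 0 < z := hL.trans_lt hz
      rw [indicator_of_mem (mem_Ioi.2 hz), indicator_of_mem (mem_Ioi.2 hz0), ind_true hz, one_mul,
        one_sub_intfK, Finset.sum_mul]
      refine Finset.sum_congr rfl fun d _ => ?_
      have hg := p.lobeGain_nonneg d
      have ha : 0 ≤ c * p.lobeGain d * l / z := by positivity
      have ha1 : 0 ≤ 1 - 1 / (1 + c * p.lobeGain d * l / z) := by
        rw [sub_nonneg, div_le_one (by positivity)]; linarith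
      rw [one_sub_inv_one_add_ofReal ha, ENNReal.ofReal_mul (mul_nonneg ha1 (p.lobeProb_nonneg d)),
        ENNReal.ofReal_mul ha1, mul_comm (ENNReal.ofReal (p.lobeProb d))]
    · rw [indicator_of_notMem (s := Ioi (p.powerRatio .sbs i * l)) (by simpa using hz)]
      by_cases hz0 : 0 < z
      · rw [indicator_of_mem (mem_Ioi.2 hz0), ind_false hz, zero_mul]
      · rw [indicator_of_notMem (by simpa using hz0)]
  rw [h1, ← (p.pathlossMeasure_spec .sbs hL).2, ← lintegral_add_left, levelE]
  · refine lintegral_congr fun z => ?_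
    by_cases h : p.powerRatio .sbs i * l < z
    · simp [ind_true h, ind_false (not_le.2 h), tierK]
    · simp [ind_false h, ind_true (not_lt.1 h)]
  · exact (measurable_ind measurableSet_Ioi).mul
      ((measurable_const.sub hmK).mul hm.ennreal_ofReal)

end Params

end IAB

/-! ### Exponential fading, blocking marks and independence of the network components -/

namespace IAB

open Filter Topology

/-- Locations of the base stations of both tiers. -/
abbrev Locs : Type := Tier → ℕ → Plane

/-- A real number attached to each link. -/
abbrev Marks : Type := Link → ℝ

/-- Alignments of the small cell base stations. -/
abbrev Lobes : Type := ℕ → Bool × Bool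

variable {Ω : Type*} [MeasurableSpace Ω]

lemma lintegral_expMeasure (f : ℝ → ℝ≥0∞) :
    ∫⁻ x, f x ∂(expMeasure 1) = ∫⁻ x in Ioi (0 : ℝ), ENNReal.ofReal (Real.exp (-x)) * f x := by
  have hm : Measurable (gammaPDF 1 1) := (measurable_gammaPDFReal 1 1).ennreal_ofReal
  rw [expMeasure, gammaMeasure, lintegral_withDensity_eq_lintegral_mul_non_measurable _ hm
    (by simp [gammaPDF]), ← lintegral_indicator measurableSet_Ioi]
  have h0 : ∀ᵐ x : ℝ, x ≠ 0 := by simp [ae_iff]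
  refine lintegral_congr_ae ?_
  filter_upwards [h0] with x hx
  have hg : gammaPDF 1 1 x = ENNReal.ofReal (if 0 ≤ x then 1 * Real.exp (-(1 * x)) else 0) :=
    exponentialPDF_eq 1 x
  rcases hx.lt_or_gt with hx | hx
  · simp [hg, not_le.2 hx, hx.le]
  · simp [hg, hx.le, hx]

lemma lintegral_exp_neg_mul {a : ℝ} (ha : 0 < a) :
    ∫⁻ x in Ioi (0 : ℝ), ENNReal.ofReal (Real.exp (-(a * x))) = ENNReal.ofReal a⁻¹ := by
  have h := integral_exp_mul_Ioi (a := -a) (by linarith) 0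
  have hi := integrableOn_exp_mul_Ioi (a := -a) (by linarith) 0
  simp only [neg_mul] at h hi
  rw [← ofReal_integral_eq_lintegral_ofReal hi (ae_of_all _ fun x => (Real.exp_pos _).le), h]
  simp

lemma lintegral_expMeasure_expNeg (a : ℝ≥0∞) :
    ∫⁻ x, expNeg (a * ENNReal.ofReal x) ∂(expMeasure 1) = (1 + a)⁻¹ := by
  rw [lintegral_expMeasure]
  rcases eq_or_ne a ∞ with rfl | ha
  · rw [setLIntegral_congr_fun (g := fun _ => 0) measurableSet_Ioi fun x hx => ?_]
    · simp
    · rw [ENNReal.top_mul (by simpa using hx), expNeg_top, mul_zero]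
  · obtain ⟨b, hb, rfl⟩ : ∃ b : ℝ, 0 ≤ b ∧ a = ENNReal.ofReal b :=
      ⟨a.toReal, ENNReal.toReal_nonneg, (ENNReal.ofReal_toReal ha).symm⟩
    rw [inv_one_add_ofReal hb, one_div, ← lintegral_exp_neg_mul (by positivity)]
    refine setLIntegral_congr_fun measurableSet_Ioi fun x hx => ?_
    have hx' : 0 < x := hx
    rw [← ENNReal.ofReal_mul hb, expNeg_ofReal (by positivity),
      ← ENNReal.ofReal_mul (Real.exp_pos _).le, ← Real.exp_add]
    congr 2; ring

lemma lintegral_expMeasure_ind (T : ℝ≥0∞) :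
    ∫⁻ x, ind (T < ENNReal.ofReal x) ∂(expMeasure 1) = expNeg T := by
  rw [lintegral_expMeasure]
  rcases eq_or_ne T ∞ with rfl | hT
  · simp [ind, expNeg_top]
  · obtain ⟨t, ht, rfl⟩ : ∃ b : ℝ, 0 ≤ b ∧ T = ENNReal.ofReal b :=
      ⟨T.toReal, ENNReal.toReal_nonneg, (ENNReal.ofReal_toReal hT).symm⟩
    have h := integral_exp_mul_Ioi (a := -1) (by linarith) t
    have hi := integrableOn_exp_mul_Ioi (a := -1) (by linarith) t
    simp only [neg_mul, one_mul] at h hi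
    have h2 := ofReal_integral_eq_lintegral_ofReal hi (ae_of_all _ fun x => (Real.exp_pos _).le)
    rw [h] at h2
    rw [expNeg_ofReal ht]
    refine Eq.trans ?_ (h2.symm.trans (by simp))
    rw [← lintegral_indicator measurableSet_Ioi, ← lintegral_indicator measurableSet_Ioi]
    refine lintegral_congr fun x => ?_
    by_cases hx : t < x
    · have hx0 : 0 < x := ht.trans_lt hx
      rw [indicator_of_mem (mem_Ioi.2 hx), indicator_of_mem (mem_Ioi.2 hx0),
        ind_true ((ENNReal.ofReal_lt_ofReal_iff hx0).2 hx), mul_one]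
    · rw [indicator_of_notMem (s := Ioi t) (by simpa using hx)]
      by_cases hx0 : 0 < x
      · rw [indicator_of_mem (mem_Ioi.2 hx0),
          ind_false (not_lt.2 (ENNReal.ofReal_le_ofReal (not_lt.1 hx))), mul_zero]
      · rw [indicator_of_notMem (by simpa using hx0)]

/-- Overwriting one coordinate by 0 keeps the index type while making the family a function of the
other coordinates only. -/
lemma indepFun_erase {ι : Type*} [DecidableEq ι] {P : Measure Ω} {Z : ι → Ω → ℝ}
    (hZ : ∀ i, Measurable (Z i)) (h : iIndepFun Z P) (i₀ : ι) :
    IndepFun (fun ω i => if i = i₀ then 0 else Z i ω) (Z i₀) P := by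
  have key := (indepFun_restrict_compl hZ h {i₀}).symm
  have hφ : Measurable fun (w : (({i₀} : Set ι)ᶜ : Set ι) → ℝ) (i : ι) =>
      if hi : i = i₀ then (0 : ℝ) else w ⟨i, hi⟩ := by
    refine measurable_pi_iff.2 fun i => ?_
    by_cases hi : i = i₀
    · simp only [hi, dite_true]; exact measurable_const
    · simp only [hi, dite_false]; exact measurable_pi_apply _
  have hψ : Measurable fun w : ({i₀} : Set ι) → ℝ => w ⟨i₀, rfl⟩ := measurable_pi_apply _
  have e : (fun ω i => if i = i₀ then 0 else Z i ω) =
      (fun (w : (({i₀} : Set ι)ᶜ : Set ι) → ℝ) (i : ι) =>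
        if hi : i = i₀ then (0 : ℝ) else w ⟨i, hi⟩) ∘ fun ω i => Z i ω := by
    ext ω i
    by_cases hi : i = i₀ <;> simp [hi]
  rw [e]
  exact key.comp hφ hψ

namespace Params

variable (p : Params)

/-- Pathloss of a link of length `r` whose blocking mark is `u`. -/
def linkLoss (k : LinkType) (i : Tier) (u r : ℝ) : ℝ :=
  r ^ p.pathlossExp k i (if u ≤ p.losProb r then .los else .nlos)

lemma linkLoss_eq (k : LinkType) (i : Tier) (u r : ℝ) : p.linkLoss k i u r =
    if u ≤ p.losProb r then r ^ p.pathlossExp k i .los else r ^ p.pathlossExp k i .nlos := by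
  unfold linkLoss; split_ifs <;> rfl

lemma measurable_linkLoss (k : LinkType) (i : Tier) :
    Measurable (Function.uncurry (p.linkLoss k i)) := by
  have : Function.uncurry (p.linkLoss k i) = fun z : ℝ × ℝ => if z.1 ≤ p.losProb z.2 then
      z.2 ^ p.pathlossExp k i .los else z.2 ^ p.pathlossExp k i .nlos := by
    ext z; exact p.linkLoss_eq k i z.1 z.2
  rw [this]
  have h := p.continuous_losProb.measurable
  exact Measurable.ite (measurableSet_le measurable_fst (by fun_prop)) (by fun_prop) (by fun_prop)

/-- Pathloss of each link, given the locations and the blocking marks. -/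
def loss (x : Locs) (u : Marks) : Link → ℝ
  | .access i n => p.linkLoss .access i (u (.access i n)) ‖x i n‖
  | .backhaul n k => p.linkLoss .backhaul .mbs (u (.backhaul n k)) ‖x .mbs n - x .sbs k‖

lemma measurable_loss (e : Link) : Measurable fun z : Locs × Marks => p.loss z.1 z.2 e := by
  cases e with
  | access i n =>
    exact (p.measurable_linkLoss .access i).comp
      (f := fun z : Locs × Marks => (z.2 (.access i n), ‖z.1 i n‖)) (by fun_prop)
  | backhaul n k =>
    exact (p.measurable_linkLoss .backhaul .mbs).comp
      (f := fun z : Locs × Marks => (z.2 (.backhaul n k), ‖z.1 .mbs n - z.1 .sbs k‖))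
      (by fun_prop)

end Params

namespace Network

variable {p : Params} {P : Measure Ω} (N : Network p P)

/-- The locations of all base stations. -/
def locs (ω : Ω) : Locs := fun i n => N.loc i n ω

/-- The blocking marks of all links. -/
def marks (ω : Ω) : Marks := fun e => N.blockMark e ω

/-- The fading gains of all links. -/
def gains (ω : Ω) : Marks := fun e => N.fading e ω

/-- The alignments of all small cell base stations. -/
def lobes (ω : Ω) : Lobes := fun n => N.lobe n ω

lemma pathloss_eq (ω : Ω) (e : Link) : N.pathloss ω e = p.loss (N.locs ω) (N.marks ω) e := by
  cases e <;> rfl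

@[fun_prop]
lemma measurable_locs : Measurable N.locs :=
  measurable_pi_iff.2 fun i => measurable_pi_iff.2 fun n => (N.poisson i).measurable n

@[fun_prop]
lemma measurable_marks : Measurable N.marks := measurable_pi_iff.2 N.blockMark_measurable

@[fun_prop]
lemma measurable_gains : Measurable N.gains := measurable_pi_iff.2 N.fading_measurable

@[fun_prop]
lemma measurable_lobes : Measurable N.lobes := measurable_pi_iff.2 N.lobe_measurable

lemma lintegral_blockMark (e : Link) {g : ℝ → ℝ≥0∞} (hg : Measurable g) :
    ∫⁻ ω, g (N.blockMark e ω) ∂P = ∫⁻ u in Icc (0 : ℝ) 1, g u := by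
  rw [← N.blockMark_law e, lintegral_map hg (N.blockMark_measurable e)]

/-- The uniform mark falls below the LOS probability with exactly that probability, so averaging
over the mark averages over the link state. -/
lemma lintegral_linkLoss (e : Link) (k : LinkType) (i : Tier) {r : ℝ} (hr : 0 ≤ r)
    {φ : ℝ → ℝ≥0∞} (hφ : Measurable φ) :
    ∫⁻ ω, φ (p.linkLoss k i (N.blockMark e ω) r) ∂P =
      ∑ s, ENNReal.ofReal (p.stateProb s r) * φ (r ^ p.pathlossExp k i s) := by
  rw [N.lintegral_blockMark e (g := fun u => φ (p.linkLoss k i u r))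
    (hφ.comp (p.measurable_linkLoss k i).of_uncurry_right), sum_linkState]
  have h0 := p.losProb_nonneg r
  have h1 := p.losProb_le_one hr
  have hsplit : Icc (0 : ℝ) 1 = Icc 0 (p.losProb r) ∪ Ioc (p.losProb r) 1 :=
    (Icc_union_Ioc_eq_Icc h0 h1).symm
  rw [hsplit, lintegral_union measurableSet_Ioc
    (Set.disjoint_left.2 fun x hx hx' => absurd hx.2 (not_le.2 hx'.1))]
  congr 1
  · rw [setLIntegral_congr_fun (g := fun _ => φ (r ^ p.pathlossExp k i .los)) measurableSet_Icc
      fun u hu => by rw [p.linkLoss_eq, if_pos hu.2], setLIntegral_const, Real.volume_Icc, sub_zero,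
      mul_comm]
    rfl
  · rw [setLIntegral_congr_fun (g := fun _ => φ (r ^ p.pathlossExp k i .nlos)) measurableSet_Ioc
      fun u hu => by rw [p.linkLoss_eq, if_neg (not_le.2 hu.1)], setLIntegral_const, Real.volume_Ioc,
      mul_comm]
    rfl

lemma lintegral_lobe (n : ℕ) (φ : Bool × Bool → ℝ≥0∞) :
    ∫⁻ ω, φ (N.lobe n ω) ∂P = ∑ d, ENNReal.ofReal (p.lobeProb d) * φ d := by
  rw [← lintegral_map (measurable_of_finite φ) (N.lobe_measurable n), lintegral_fintype]
  refine Finset.sum_congr rfl fun d _ => ?_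
  rw [Measure.map_apply (N.lobe_measurable n) (measurableSet_singleton d), mul_comm,
    ← N.lobe_law n d]
  rfl

lemma lintegral_fading (e : Link) {g : ℝ → ℝ≥0∞} (hg : Measurable g) :
    ∫⁻ ω, g (N.fading e ω) ∂P = ∫⁻ x, g x ∂(expMeasure 1) := by
  rw [← N.fading_law e, lintegral_map hg (N.fading_measurable e)]

lemma measurable_ind_lt {α : Type*} [MeasurableSpace α] {f g : α → ℝ≥0∞} (hf : Measurable f)
    (hg : Measurable g) : Measurable fun a => ind (f a < g a) :=
  measurable_ind (q := fun a => f a < g a) (measurableSet_lt hf hg)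

variable [IsProbabilityMeasure P]

/-- Alignments, fading and blocking are split off successively, as the independence assumptions are
nested. The swaps then put fading innermost and alignments next, the order in which they are
averaged. -/
lemma lintegral_independent {f : Locs → Marks → Marks → Lobes → ℝ≥0∞}
    (hf : Measurable fun z : ((Locs × Marks) × Marks) × Lobes => f z.1.1.1 z.1.1.2 z.1.2 z.2) :
    ∫⁻ ω, f (N.locs ω) (N.marks ω) (N.gains ω) (N.lobes ω) ∂P =
      ∫⁻ ω₁, ∫⁻ ω₂, ∫⁻ ω₃, ∫⁻ ω₄, f (N.locs ω₁) (N.marks ω₂) (N.gains ω₄) (N.lobes ω₃)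
        ∂P ∂P ∂P ∂P := by
  have h4 : Measurable fun z : (Locs × Marks) × Lobes =>
      ∫⁻ ω₄, f z.1.1 z.1.2 (N.gains ω₄) z.2 ∂P :=
    Measurable.lintegral_prod_right' (f := fun z : ((Locs × Marks) × Lobes) × Ω =>
      f z.1.1.1 z.1.1.2 (N.gains z.2) z.1.2) (hf.comp
      (f := fun z : ((Locs × Marks) × Lobes) × Ω => ((z.1.1, N.gains z.2), z.1.2)) (by fun_prop))
  have h2 : Measurable fun z : Locs × Lobes =>
      ∫⁻ ω₂, ∫⁻ ω₄, f z.1 (N.marks ω₂) (N.gains ω₄) z.2 ∂P ∂P :=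
    Measurable.lintegral_prod_right' (f := fun z : (Locs × Lobes) × Ω =>
      ∫⁻ ω₄, f z.1.1 (N.marks z.2) (N.gains ω₄) z.1.2 ∂P) (h4.comp
      (f := fun z : (Locs × Lobes) × Ω => ((z.1.1, N.marks z.2), z.1.2)) (by fun_prop))
  calc ∫⁻ ω, f (N.locs ω) (N.marks ω) (N.gains ω) (N.lobes ω) ∂P
      = ∫⁻ ω, ∫⁻ ω₃, f (N.locs ω) (N.marks ω) (N.gains ω) (N.lobes ω₃) ∂P ∂P :=
        lintegral_comp_indepFun (A := fun ω => (N.locs ω, N.marks ω, N.gains ω)) (B := N.lobes)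
          (f := fun a d => f a.1 a.2.1 a.2.2 d) (by fun_prop) (by fun_prop) N.indep_lobe
          (hf.comp (f := fun z : (Locs × Marks × Marks) × Lobes =>
            (((z.1.1, z.1.2.1), z.1.2.2), z.2)) (by fun_prop))
    _ = ∫⁻ ω₃, ∫⁻ ω, f (N.locs ω) (N.marks ω) (N.gains ω) (N.lobes ω₃) ∂P ∂P :=
        lintegral_lintegral_swap (Measurable.aemeasurable (hf.comp (f := fun z : Ω × Ω =>
            (((N.locs z.1, N.marks z.1), N.gains z.1), N.lobes z.2)) (by fun_prop)))
    _ = ∫⁻ ω₃, ∫⁻ ω, ∫⁻ ω₄, f (N.locs ω) (N.marks ω) (N.gains ω₄) (N.lobes ω₃) ∂P ∂P ∂P :=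
        lintegral_congr fun ω₃ => lintegral_comp_indepFun
          (A := fun ω => (N.locs ω, N.marks ω)) (B := N.gains)
          (f := fun a h => f a.1 a.2 h (N.lobes ω₃)) (by fun_prop) (by fun_prop) N.indep_fading
          (hf.comp (f := fun z : (Locs × Marks) × Marks => (z, N.lobes ω₃)) (by fun_prop))
    _ = ∫⁻ ω₃, ∫⁻ ω₁, ∫⁻ ω₂, ∫⁻ ω₄,
          f (N.locs ω₁) (N.marks ω₂) (N.gains ω₄) (N.lobes ω₃) ∂P ∂P ∂P ∂P :=
        lintegral_congr fun ω₃ => lintegral_comp_indepFun (A := N.locs) (B := N.marks)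
          (f := fun x u => ∫⁻ ω₄, f x u (N.gains ω₄) (N.lobes ω₃) ∂P) (by fun_prop) (by fun_prop)
          N.indep_blockMark (h4.comp (f := fun z : Locs × Marks => (z, N.lobes ω₃)) (by fun_prop))
    _ = ∫⁻ ω₁, ∫⁻ ω₃, ∫⁻ ω₂, ∫⁻ ω₄,
          f (N.locs ω₁) (N.marks ω₂) (N.gains ω₄) (N.lobes ω₃) ∂P ∂P ∂P ∂P :=
        lintegral_lintegral_swap (Measurable.aemeasurable (h2.comp
          (f := fun z : Ω × Ω => (N.locs z.2, N.lobes z.1)) (by fun_prop)))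
    _ = _ := lintegral_congr fun ω₁ => lintegral_lintegral_swap (Measurable.aemeasurable
        (h4.comp (f := fun z : Ω × Ω => ((N.locs ω₁, N.marks z.2), N.lobes z.1)) (by fun_prop)))

/-- Joint tail of the signal to interference and noise ratios under independent exponential fading
gains of the serving access link, of the interfering links and of a backhaul link. -/
lemma lintegral_coverage (b : Tier × ℕ) (n k : ℕ) (T t : ℝ≥0∞) (a : ℕ → ℝ≥0∞)
    (ha : ∀ m, (Tier.sbs, m) = b → a m = 0) :
    ∫⁻ ω, ind (T + ∑' m, a m * ENNReal.ofReal (N.fading (.access .sbs m) ω) <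
          ENNReal.ofReal (N.fading (.access b.1 b.2) ω)) *
        ind (t < ENNReal.ofReal (N.fading (.backhaul n k) ω)) ∂P =
      expNeg T * expNeg t * iprod fun m => (1 + a m)⁻¹ := by
  classical
  have hmf := N.fading_measurable
  -- The serving link has coefficient 0 in the interference, so its gain may be overwritten by 0
  -- there. The interference becomes a function of the other gains, independent of the serving one.
  have e1 : ∀ ω m, a m * ENNReal.ofReal (N.fading (.access .sbs m) ω) = a m * ENNReal.ofReal
      (if Link.access .sbs m = .access b.1 b.2 then 0 else N.fading (.access .sbs m) ω) := by
    intro ω m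
    split_ifs with h
    · rw [ha m (by cases b; simp at h ⊢; exact h)]; simp
    · rfl
  have hsum : Measurable fun w : Marks => T + ∑' m, a m * ENNReal.ofReal (w (.access .sbs m)) :=
    measurable_const.add (Measurable.tsum fun m => by fun_prop)
  have hw : Measurable fun w : Marks => ind (t < ENNReal.ofReal (w (.backhaul n k))) :=
    measurable_ind_lt measurable_const (by fun_prop)
  have step := lintegral_comp_indepFun (P := P)
    (A := fun ω e => if e = Link.access b.1 b.2 then 0 else N.fading e ω)
    (B := N.fading (.access b.1 b.2))
    (f := fun w x => ind (T + ∑' m, a m * ENNReal.ofReal (w (.access .sbs m)) <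
      ENNReal.ofReal x) * ind (t < ENNReal.ofReal (w (.backhaul n k))))
    (measurable_pi_iff.2 fun e => by split_ifs <;> [exact measurable_const; exact hmf e])
    (hmf _) (indepFun_erase hmf N.fading_indep _)
    ((measurable_ind_lt (hsum.comp measurable_fst) (by fun_prop)).mul (hw.comp measurable_fst))
  have hbk : ∀ ω, (if Link.backhaul n k = Link.access b.1 b.2 then 0 else
    N.fading (.backhaul n k) ω) = N.fading (.backhaul n k) ω := fun ω => if_neg (by simp)
  simp only [← e1, hbk] at step
  rw [step]
  have e2 : ∀ T' t' : ℝ≥0∞, ∫⁻ ω', ind (T' < ENNReal.ofReal (N.fading (.access b.1 b.2) ω')) * t' ∂P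
      = expNeg T' * t' := fun T' t' => by
    rw [lintegral_mul_const _ (measurable_ind_lt measurable_const (by fun_prop)),
      N.lintegral_fading (.access b.1 b.2) (g := fun x => ind (T' < ENNReal.ofReal x))
      (measurable_ind_lt measurable_const (by fun_prop)), lintegral_expMeasure_ind]
  simp_rw [e2, expNeg_add, expNeg_tsum]
  -- With the serving gain integrated out, the exponential of the interference is a product over
  -- independent gains. The backhaul gain is kept as the conditioning coordinate.
  have step2 := lintegral_mul_prod_iprod_indep (P := P) (κ := Unit) hmf N.fading_indep
    {Link.backhaul n k} (W := fun w => w ⟨Link.backhaul n k, rfl⟩) (measurable_pi_apply _)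
    (fun j => Link.access .sbs j.2) (fun j j' h => by simpa [Prod.ext_iff] using h)
    (G := fun x => expNeg T * ind (t < ENNReal.ofReal x))
    (measurable_const.mul (measurable_ind_lt measurable_const (by fun_prop)))
    (fun w => mul_le_one' (expNeg_le_one _) (ind_le_one _))
    (f := fun _ m _ z => expNeg (a m * ENNReal.ofReal z))
    (fun _ m => by unfold Function.uncurry; fun_prop) (fun _ _ _ _ => expNeg_le_one _)
    (fun _ _ h => by simp at h)
  have e3 : ∀ m, ∫⁻ ω, expNeg (a m * ENNReal.ofReal (N.fading (.access .sbs m) ω)) ∂P =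
      (1 + a m)⁻¹ := fun m => by
    rw [N.lintegral_fading _ (g := fun x => expNeg (a m * ENNReal.ofReal x)) (by fun_prop),
      lintegral_expMeasure_expNeg]
  simp only [Finset.univ_unique, Finset.prod_singleton, e3] at step2
  have hm4 : Measurable fun ω => ind (t < ENNReal.ofReal (N.fading (.backhaul n k) ω)) :=
    measurable_ind_lt measurable_const (by fun_prop)
  calc _ = ∫⁻ ω, expNeg T * ind (t < ENNReal.ofReal (N.fading (.backhaul n k) ω)) *
        iprod fun m => expNeg (a m * ENNReal.ofReal (N.fading (.access .sbs m) ω)) ∂P :=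
        lintegral_congr fun ω => by ring
    _ = _ := step2
    _ = _ := by
      rw [lintegral_mul_const _ (hm4.const_mul _), lintegral_const_mul _ hm4,
        N.lintegral_fading (.backhaul n k) (g := fun x => ind (t < ENNReal.ofReal x))
        (measurable_ind_lt measurable_const (by fun_prop)), lintegral_expMeasure_ind]

end Network

end IAB

/-! ### Averaging over fading, antenna alignments and blocking marks -/

namespace IAB

open Filter Topology

variable {Ω : Type*} [MeasurableSpace Ω]

lemma measurable_ite_index {α : Type*} [MeasurableSpace α] {β : Type*} [DecidableEq β] (a b : β)
    {f : α → ℝ≥0∞} (hf : Measurable f) : Measurable fun z => if a = b then 1 else f z := by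
  split_ifs
  exacts [measurable_const, hf]

namespace Params

variable (p : Params) {R : ℝ → ℝ → Prop}

/-- Contribution of a base station of tier `j` with pathloss `z` when the serving base station is of
tier `i` with pathloss `l`: it must not be preferred to the serving one, and it interferes. -/
def levelG (R : ℝ → ℝ → Prop) (c : ℝ) (i j : Tier) (l z : ℝ) : ℝ≥0∞ :=
  ind (R (p.powerRatio j i * l) z) * p.tierK c j l z

lemma levelG_le_one (R : ℝ → ℝ → Prop) (c : ℝ) (i j : Tier) (l z : ℝ) :
    p.levelG R c i j l z ≤ 1 := mul_le_one' (ind_le_one _) (p.tierK_le_one _ _ _ _)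

lemma measurable_levelG (hR : IsCmp R) (c : ℝ) (i j : Tier) :
    Measurable (Function.uncurry (p.levelG R c i j)) :=
  (hR.measurable (f := fun z : ℝ × ℝ => p.powerRatio j i * z.1) (g := Prod.snd)
    (by fun_prop) (by fun_prop)).mul (p.measurable_tierK c j)

lemma measurable_levelF_level (hR : IsCmp R) (c : ℝ) (i j : Tier) (r : ℝ) :
    Measurable fun l => p.levelF R c i j l r :=
  (p.measurable_levelF hR c i j).comp (f := fun l : ℝ => (l, r)) (by fun_prop)

/-- Average over the link state of the event that a macro base station at distance `r` is not
preferred to an anchor whose backhaul pathloss is `l`. -/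
def backF (R : ℝ → ℝ → Prop) (l r : ℝ) : ℝ≥0∞ :=
  ∑ s, ENNReal.ofReal (p.stateProb s r) * ind (R l (r ^ p.pathlossExp .backhaul .mbs s))

lemma backF_le_one (R : ℝ → ℝ → Prop) (l : ℝ) {r : ℝ} (hr : 0 ≤ r) : p.backF R l r ≤ 1 :=
  (Finset.sum_le_sum fun _ _ => mul_le_of_le_one_right' (ind_le_one _)).trans
    (p.sum_stateProb hr).le

lemma measurable_backF (hR : IsCmp R) : Measurable (Function.uncurry (p.backF R)) := by
  unfold Function.uncurry backF
  refine Finset.measurable_sum _ fun s _ => ?_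
  have h1 := (p.continuous_stateProb s).measurable
  exact Measurable.mul (by fun_prop) (hR.measurable (by fun_prop) (by fun_prop))

/-- Indicator of the event that no base station is preferred to `b`. -/
def servingInd (R : ℝ → ℝ → Prop) (b : Tier × ℕ) (x : Locs) (u : Marks) : ℝ≥0∞ :=
  ∏ j, iprod fun m => if (j, m) = b then 1 else
    ind (R (p.powerRatio j b.1 * p.loss x u (.access b.1 b.2)) (p.loss x u (.access j m)))

/-- Indicator of the event that no macro base station is preferred to `n` as anchor of `k`. -/
def anchorInd (R : ℝ → ℝ → Prop) (n k : ℕ) (x : Locs) (u : Marks) : ℝ≥0∞ :=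
  iprod fun m => if m = n then 1 else
    ind (R (p.loss x u (.backhaul n k)) (p.loss x u (.backhaul m k)))

/-- Normalized interference power at the user when it is served by `b`. -/
def interf (c : ℝ) (b : Tier × ℕ) (x : Locs) (u h : Marks) (d : Lobes) : ℝ≥0∞ :=
  ∑' m, (if (Tier.sbs, m) = b then 0 else ENNReal.ofReal
    (c * p.lobeGain (d m) * p.loss x u (.access b.1 b.2) / p.loss x u (.access .sbs m))) *
      ENNReal.ofReal (h (.access .sbs m))

/-- Indicator of the event that the access link to `b` is above the threshold. -/
def coverInd (κ c : ℝ) (b : Tier × ℕ) (x : Locs) (u h : Marks) (d : Lobes) : ℝ≥0∞ :=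
  ind (ENNReal.ofReal (κ * p.loss x u (.access b.1 b.2)) + p.interf c b x u h d <
    ENNReal.ofReal (h (.access b.1 b.2)))

@[fun_prop]
lemma measurable_loss_comp {α : Type*} [MeasurableSpace α] {x : α → Locs} {u : α → Marks}
    (hx : Measurable x) (hu : Measurable u) (e : Link) :
    Measurable fun a => p.loss (x a) (u a) e :=
  (p.measurable_loss e).comp (f := fun a => (x a, u a)) (hx.prodMk hu)

lemma measurable_servingInd (hR : IsCmp R) (b : Tier × ℕ) :
    Measurable (Function.uncurry (p.servingInd R b)) := by
  unfold Function.uncurry Params.servingInd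
  exact Finset.measurable_prod _ fun _ _ => Measurable.iprod fun _ =>
    measurable_ite_index _ _ (hR.measurable (by fun_prop) (by fun_prop))

lemma measurable_anchorInd (hR : IsCmp R) (n k : ℕ) :
    Measurable (Function.uncurry (p.anchorInd R n k)) :=
  Measurable.iprod fun _ =>
    measurable_ite_index _ _ (hR.measurable (by fun_prop) (by fun_prop))

@[fun_prop]
lemma measurable_lobeGain : Measurable p.lobeGain := measurable_of_finite _

lemma measurable_coverInd (κ c : ℝ) (b : Tier × ℕ) :
    Measurable fun z : ((Locs × Marks) × Marks) × Lobes =>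
      p.coverInd κ c b z.1.1.1 z.1.1.2 z.1.2 z.2 := by
  unfold coverInd interf
  refine Network.measurable_ind_lt (Measurable.fun_add (by fun_prop) (Measurable.tsum fun m => ?_))
    (by fun_prop)
  split_ifs <;> fun_prop

/-- Product over all interfering base stations of the averaged interference factors. -/
def interfProd (c : ℝ) (b : Tier × ℕ) (x : Locs) (u : Marks) : ℝ≥0∞ :=
  iprod fun m => if (Tier.sbs, m) = b then 1 else
    p.intfK c (p.loss x u (.access b.1 b.2)) (p.loss x u (.access .sbs m))

/-- Losing the association and interfering are both functions of the station's own pathloss. They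
merge into one factor per station, the form required by independence of the marks and by Mecke's
formula. -/
lemma servingInd_mul_interfProd (R : ℝ → ℝ → Prop) (c : ℝ) (b : Tier × ℕ) (x : Locs) (u : Marks) :
    p.servingInd R b x u * p.interfProd c b x u = ∏ j, iprod fun m => if (j, m) = b then 1 else
      p.levelG R c b.1 j (p.loss x u (.access b.1 b.2)) (p.loss x u (.access j m)) := by
  rw [servingInd, interfProd, prod_tier, prod_tier, mul_assoc]
  congr 1
  · congr 1; ext m
    simp [levelG, tierK]
  · rw [← iprod_mul]
    · congr 1; ext m
      split_ifs
      · simp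
      · rfl
    · intro m; split_ifs <;> simp [ind_le_one]
    · intro m; split_ifs <;> simp [intfK_le_one]

end Params

namespace Network

variable {p : Params} {P : Measure Ω} (N : Network p P) {R : ℝ → ℝ → Prop}

lemma lintegral_levelG (hR : IsCmp R) (c : ℝ) (i j : Tier) (l : ℝ) (e : Link) {r : ℝ}
    (hr : 0 ≤ r) : ∫⁻ ω, p.levelG R c i j l (p.linkLoss .access j (N.blockMark e ω) r) ∂P =
      p.levelF R c i j l r :=
  N.lintegral_linkLoss e .access j hr (p.measurable_levelG hR c i j).of_uncurry_left

variable [IsProbabilityMeasure P]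

/-- `Φ` stands for the association and anchor indicators, which involve neither fading nor
alignments and pass through these two averages. The alignments are averaged after the fading, factor
by factor. -/
lemma lintegral_coverInd (κ c : ℝ) (b : Tier × ℕ) (n k : ℕ) {Φ t : Locs → Marks → ℝ≥0∞}
    (hΦ : Measurable (Function.uncurry Φ)) (ht : Measurable (Function.uncurry t)) :
    ∫⁻ ω, Φ (N.locs ω) (N.marks ω) *
        (p.coverInd κ c b (N.locs ω) (N.marks ω) (N.gains ω) (N.lobes ω) *
          ind (t (N.locs ω) (N.marks ω) < ENNReal.ofReal (N.gains ω (.backhaul n k)))) ∂P =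
      ∫⁻ ω₁, ∫⁻ ω₂, Φ (N.locs ω₁) (N.marks ω₂) *
        (expNeg (ENNReal.ofReal (κ * p.loss (N.locs ω₁) (N.marks ω₂) (.access b.1 b.2))) *
          expNeg (t (N.locs ω₁) (N.marks ω₂)) *
            p.interfProd c b (N.locs ω₁) (N.marks ω₂)) ∂P ∂P := by
  have hc := p.measurable_coverInd κ c b
  have hi : Measurable fun z : ((Locs × Marks) × Marks) × Lobes =>
      ind (t z.1.1.1 z.1.1.2 < ENNReal.ofReal (z.1.2 (.backhaul n k))) :=
    measurable_ind_lt (ht.comp (f := fun z : ((Locs × Marks) × Marks) × Lobes => z.1.1)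
      (by fun_prop)) (by fun_prop)
  have hΦ' : Measurable fun z : ((Locs × Marks) × Marks) × Lobes => Φ z.1.1.1 z.1.1.2 :=
    hΦ.comp (f := fun z : ((Locs × Marks) × Marks) × Lobes => z.1.1) (by fun_prop)
  rw [N.lintegral_independent (f := fun x u h d => Φ x u *
    (p.coverInd κ c b x u h d * ind (t x u < ENNReal.ofReal (h (.backhaul n k)))))
    (hΦ'.mul (hc.mul hi))]
  refine lintegral_congr fun ω₁ => lintegral_congr fun ω₂ => ?_
  set x := N.locs ω₁
  set u := N.marks ω₂
  have h1 : ∀ d : Lobes, ∫⁻ ω₄, Φ x u * (p.coverInd κ c b x u (N.gains ω₄) d *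
      ind (t x u < ENNReal.ofReal (N.gains ω₄ (.backhaul n k)))) ∂P =
      Φ x u * (expNeg (ENNReal.ofReal (κ * p.loss x u (.access b.1 b.2))) *
          expNeg (t x u) * iprod fun m => (1 + if (Tier.sbs, m) = b then 0 else ENNReal.ofReal
    (c * p.lobeGain (d m) * p.loss x u (.access b.1 b.2) / p.loss x u (.access .sbs m)))⁻¹) := by
    intro d
    have hm : Measurable fun ω₄ => p.coverInd κ c b x u (N.gains ω₄) d *
        ind (t x u < ENNReal.ofReal (N.gains ω₄ (.backhaul n k))) :=
      (hc.mul hi).comp (f := fun ω₄ => (((x, u), N.gains ω₄), d)) (by fun_prop)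
    rw [lintegral_const_mul _ hm, ← N.lintegral_coverage b n k _ _ _ fun m hm => if_pos hm]
    rfl
  simp_rw [h1]
  have hm1 : ∀ m, Measurable fun d : Bool × Bool => (1 + if (Tier.sbs, m) = b then 0 else
    ENNReal.ofReal (c * p.lobeGain d * p.loss x u (.access b.1 b.2) /
      p.loss x u (.access .sbs m)))⁻¹ := fun m => measurable_of_finite _
  have hm2 : Measurable fun ω => iprod fun m => (1 + if (Tier.sbs, m) = b then 0 else
    ENNReal.ofReal (c * p.lobeGain (N.lobe m ω) * p.loss x u (.access b.1 b.2) /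
      p.loss x u (.access .sbs m)))⁻¹ :=
    Measurable.iprod fun m => (hm1 m).comp (N.lobe_measurable m)
  have h2 := lintegral_iprod_indep N.lobe_measurable N.lobe_indep hm1
    fun _ _ => inv_one_add_le_one _
  have hm3 := hm2.const_mul (expNeg (ENNReal.ofReal (κ * p.loss x u (.access b.1 b.2))) *
    expNeg (t x u))
  refine (lintegral_const_mul _ hm3).trans ?_
  congr 1
  refine (lintegral_const_mul _ hm2).trans ?_
  congr 1
  refine h2.trans ?_
  unfold Params.interfProd
  congr 1; ext m
  refine (N.lintegral_lobe m fun d => (1 + if (Tier.sbs, m) = b then 0 else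
    ENNReal.ofReal (c * p.lobeGain d * p.loss x u (.access b.1 b.2) /
      p.loss x u (.access .sbs m)))⁻¹).trans ?_
  split_ifs with h
  · simpa using p.sum_lobeProb
  · rfl

/-- Average over the blocking marks of the indicator that the user is served by `b`. -/
lemma lintegral_marks_serving (hR : IsCmp R) (κ c : ℝ) (b : Tier × ℕ) (x : Locs) :
    ∫⁻ ω, p.servingInd R b x (N.marks ω) *
        (expNeg (ENNReal.ofReal (κ * p.loss x (N.marks ω) (.access b.1 b.2))) *
          p.interfProd c b x (N.marks ω)) ∂P =
      ∑ s, ENNReal.ofReal (p.stateProb s ‖x b.1 b.2‖) *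
        (expNeg (ENNReal.ofReal (κ * ‖x b.1 b.2‖ ^ p.pathlossExp .access b.1 s)) *
          ∏ j, iprod fun m => if (j, m) = b then 1 else
            p.levelF R c b.1 j (‖x b.1 b.2‖ ^ p.pathlossExp .access b.1 s) ‖x j m‖) := by
  simp_rw [mul_left_comm (p.servingInd R b x _), p.servingInd_mul_interfProd]
  have hl : Measurable fun w : ℝ => p.linkLoss .access b.1 w ‖x b.1 b.2‖ :=
    (p.measurable_linkLoss _ _).of_uncurry_right
  -- The mark of the serving access link is frozen; those of the other access links are averaged
  -- independently of it.
  have step := lintegral_mul_prod_iprod_indep (P := P) (κ := Tier) N.blockMark_measurable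
    N.blockMark_indep {Link.access b.1 b.2} (W := fun w => w ⟨Link.access b.1 b.2, rfl⟩)
    (measurable_pi_apply _) (fun j => Link.access j.1 j.2)
    (fun j j' h => by simpa [Prod.ext_iff] using h)
    (G := fun w => expNeg (ENNReal.ofReal (κ * p.linkLoss .access b.1 w ‖x b.1 b.2‖)))
    (by fun_prop) (fun w => expNeg_le_one _)
    (f := fun j m w z => if (j, m) = b then 1 else p.levelG R c b.1 j
      (p.linkLoss .access b.1 w ‖x b.1 b.2‖) (p.linkLoss .access j z ‖x j m‖))
    (fun j m => measurable_ite_index _ _ ((p.measurable_levelG hR c b.1 j).comp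
      (f := fun z : ℝ × ℝ => (p.linkLoss .access b.1 z.1 ‖x b.1 b.2‖,
        p.linkLoss .access j z.2 ‖x j m‖)) ((hl.comp measurable_fst).prodMk
          ((p.measurable_linkLoss .access j).of_uncurry_right.comp measurable_snd))))
    (fun j m w z => by split_ifs; exacts [le_rfl, p.levelG_le_one _ _ _ _ _ _])
    (fun j m h w z => if_pos (by simpa [Prod.ext_iff] using h))
  refine Eq.trans ?_ (step.trans ?_)
  · rfl
  · have h2 : ∀ l j m, ∫⁻ ω, (if (j, m) = b then 1 else p.levelG R c b.1 j l
        (p.linkLoss .access j (N.blockMark (.access j m) ω) ‖x j m‖)) ∂P =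
        if (j, m) = b then 1 else p.levelF R c b.1 j l ‖x j m‖ := by
      intro l j m
      split_ifs
      · simp
      · exact N.lintegral_levelG hR c b.1 j l _ (norm_nonneg _)
    simp_rw [h2]
    exact N.lintegral_linkLoss (.access b.1 b.2) .access b.1 (norm_nonneg _)
      (φ := fun l => expNeg (ENNReal.ofReal (κ * l)) * ∏ j, iprod fun m =>
        if (j, m) = b then 1 else p.levelF R c b.1 j l ‖x j m‖)
      (Measurable.mul (by fun_prop) (Finset.measurable_prod _ fun j _ => Measurable.iprod fun m =>
        measurable_ite_index _ _ (p.measurable_levelF_level hR c b.1 j _)))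

/-- Average over the blocking marks of the indicator that the user is served by the `k`-th small
cell base station, anchored to the `n`-th macro base station. -/
lemma lintegral_marks_anchor (hR : IsCmp R) (κ κ' c : ℝ) (n k : ℕ) (x : Locs) :
    ∫⁻ ω, p.servingInd R (.sbs, k) x (N.marks ω) * p.anchorInd R n k x (N.marks ω) *
        (expNeg (ENNReal.ofReal (κ * p.loss x (N.marks ω) (.access .sbs k))) *
          expNeg (ENNReal.ofReal (κ' * p.loss x (N.marks ω) (.backhaul n k))) *
            p.interfProd c (.sbs, k) x (N.marks ω)) ∂P =
      ∑ t, ENNReal.ofReal (p.stateProb t ‖x .sbs k‖) *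
        ∑ s, ENNReal.ofReal (p.stateProb s ‖x .mbs n - x .sbs k‖) *
          (expNeg (ENNReal.ofReal (κ * ‖x .sbs k‖ ^ p.pathlossExp .access .sbs t)) *
            expNeg (ENNReal.ofReal
              (κ' * ‖x .mbs n - x .sbs k‖ ^ p.pathlossExp .backhaul .mbs s)) *
          ((iprod fun m => if m = n then 1 else
            p.backF R (‖x .mbs n - x .sbs k‖ ^ p.pathlossExp .backhaul .mbs s)
              ‖x .mbs m - x .sbs k‖) *
          ∏ j, iprod fun m => if (j, m) = (Tier.sbs, k) then 1 else
            p.levelF R c .sbs j (‖x .sbs k‖ ^ p.pathlossExp .access .sbs t) ‖x j m‖)) := by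
  have hl : ∀ k i r, Measurable fun w : ℝ => p.linkLoss k i w r := fun k i r =>
    (p.measurable_linkLoss _ _).of_uncurry_right
  have hre : ∀ a b c d e : ℝ≥0∞, a * b * (c * d * e) = c * d * (b * (a * e)) := by
    intros; ring
  simp_rw [hre, p.servingInd_mul_interfProd]
  have hmf := N.blockMark_measurable
  -- Three families of links occur: `none` indexes the backhaul links to the `k`-th small cell,
  -- `some i` the access links of tier `i`.
  let e : Option Tier × ℕ → Link := fun j =>
    match j.1 with
    | none => .backhaul j.2 k
    | some i => .access i j.2
  have he : Function.Injective e := by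
    rintro ⟨_ | i, m⟩ ⟨_ | i', m'⟩ h <;> simp [e] at h ⊢ <;> exact h
  let f : Option Tier → ℕ → ℝ × ℝ → ℝ → ℝ≥0∞ := fun j m w z =>
    match j with
    | none => if m = n then 1 else ind (R (p.linkLoss .backhaul .mbs w.2 ‖x .mbs n - x .sbs k‖)
        (p.linkLoss .backhaul .mbs z ‖x .mbs m - x .sbs k‖))
    | some j => if (j, m) = (Tier.sbs, k) then 1 else p.levelG R c .sbs j
      (p.linkLoss .access .sbs w.1 ‖x .sbs k‖) (p.linkLoss .access j z ‖x j m‖)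
  have hf : ∀ j m, Measurable (Function.uncurry (f j m)) := by
    rintro (_ | j) m
    · exact measurable_ite_index _ _ (hR.measurable
        ((hl _ _ _).comp (measurable_snd.comp measurable_fst)) ((hl _ _ _).comp measurable_snd))
    · exact measurable_ite_index _ _ ((p.measurable_levelG hR c .sbs j).comp
        (((hl _ _ _).comp (measurable_fst.comp measurable_fst)).prodMk
          ((hl _ _ _).comp measurable_snd)))
  have hf1 : ∀ j m w z, f j m w z ≤ 1 := by
    rintro (_ | j) m w z <;> simp only [f] <;> split_ifs
    exacts [le_rfl, ind_le_one _, le_rfl, p.levelG_le_one _ _ _ _ _ _]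
  -- The marks of the two tagged links, access of `k` and backhaul from `n` to `k`, are frozen. They
  -- are independent of each other and are averaged at the end.
  have step := lintegral_mul_prod_iprod_indep (P := P) (κ := Option Tier) hmf
    N.blockMark_indep {Link.access .sbs k, Link.backhaul n k}
    (W := fun w => (w ⟨Link.access .sbs k, by simp⟩, w ⟨Link.backhaul n k, by simp⟩))
    (by fun_prop) e he
    (G := fun w : ℝ × ℝ => expNeg (ENNReal.ofReal (κ * p.linkLoss .access .sbs w.1 ‖x .sbs k‖)) *
      expNeg (ENNReal.ofReal (κ' * p.linkLoss .backhaul .mbs w.2 ‖x .mbs n - x .sbs k‖)))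
    (by
      have h1 := (hl .access .sbs ‖x .sbs k‖)
      have h2 := (hl .backhaul .mbs ‖x .mbs n - x .sbs k‖)
      fun_prop) (fun w => mul_le_one' (expNeg_le_one _) (expNeg_le_one _))
    (f := f) hf hf1
    (by
      rintro (_ | j) m h w z
      · exact if_pos (by simpa [e] using h)
      · exact if_pos (by simpa [e] using h))
  simp only [Fintype.prod_option] at step
  refine Eq.trans ?_ (step.trans ?_)
  · rfl
  · have h1 : ∀ w m, ∫⁻ ω, f none m w (N.blockMark (e (none, m)) ω) ∂P =
        if m = n then 1 else p.backF R (p.linkLoss .backhaul .mbs w.2 ‖x .mbs n - x .sbs k‖)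
          ‖x .mbs m - x .sbs k‖ := by
      intro w m
      simp only [f]
      split_ifs
      · simp
      · exact N.lintegral_linkLoss _ .backhaul .mbs (norm_nonneg _)
          (φ := fun z => ind (R (p.linkLoss .backhaul .mbs w.2 ‖x .mbs n - x .sbs k‖) z))
          (hR.measurable measurable_const measurable_id)
    have h2 : ∀ w j m, ∫⁻ ω, f (some j) m w (N.blockMark (e (some j, m)) ω) ∂P =
        if (j, m) = (Tier.sbs, k) then 1 else
          p.levelF R c .sbs j (p.linkLoss .access .sbs w.1 ‖x .sbs k‖) ‖x j m‖ := by
      intro w j m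
      simp only [f]
      split_ifs
      · simp
      · exact N.lintegral_levelG hR c .sbs j _ _ (norm_nonneg _)
    simp_rw [h1, h2]
    obtain ⟨Ψ, hΨe⟩ : ∃ Ψ : ℝ → ℝ → ℝ≥0∞, ∀ l₀ l, expNeg (ENNReal.ofReal (κ * l₀)) *
      expNeg (ENNReal.ofReal (κ' * l)) *
        ((iprod fun m => if m = n then 1 else p.backF R l ‖x .mbs m - x .sbs k‖) *
          ∏ j, iprod fun m => if (j, m) = (Tier.sbs, k) then 1 else
            p.levelF R c .sbs j l₀ ‖x j m‖) = Ψ l₀ l := ⟨_, fun _ _ => rfl⟩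
    have hΨ : Measurable (Function.uncurry Ψ) := by
      unfold Function.uncurry
      simp_rw [← hΨe]
      refine Measurable.mul (by fun_prop) (Measurable.mul (Measurable.iprod fun m =>
        measurable_ite_index _ _ ?_) (Finset.measurable_prod _ fun j _ => Measurable.iprod
          fun m => measurable_ite_index _ _ ?_))
      · exact (p.measurable_backF hR).comp
          (f := fun z : ℝ × ℝ => (z.2, ‖x .mbs m - x .sbs k‖)) (by fun_prop)
      · exact (p.measurable_levelF_level hR c .sbs j _).comp measurable_fst
    simp_rw [hΨe]
    have hind : IndepFun (N.blockMark (.access .sbs k)) (N.blockMark (.backhaul n k)) P :=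
      N.blockMark_indep.indepFun (by simp)
    have step2 := lintegral_comp_indepFun (hmf _) (hmf _) hind
      (f := fun a b => Ψ (p.linkLoss .access .sbs a ‖x .sbs k‖)
        (p.linkLoss .backhaul .mbs b ‖x .mbs n - x .sbs k‖))
      (hΨ.comp (f := fun z : ℝ × ℝ => (p.linkLoss .access .sbs z.1 ‖x .sbs k‖,
        p.linkLoss .backhaul .mbs z.2 ‖x .mbs n - x .sbs k‖))
        (((hl _ _ _).comp measurable_fst).prodMk ((hl _ _ _).comp measurable_snd)))
    refine step2.trans ?_
    simp_rw [fun l₀ => N.lintegral_linkLoss (.backhaul n k) .backhaul .mbs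
      (norm_nonneg (x .mbs n - x .sbs k)) (φ := Ψ l₀) hΨ.of_uncurry_left]
    exact N.lintegral_linkLoss (.access .sbs k) .access .sbs (norm_nonneg _)
      (φ := fun l₀ => ∑ s, ENNReal.ofReal (p.stateProb s ‖x .mbs n - x .sbs k‖) *
        Ψ l₀ (‖x .mbs n - x .sbs k‖ ^ p.pathlossExp .backhaul .mbs s))
      (Finset.measurable_sum _ fun s _ => hΨ.of_uncurry_right.const_mul _)

end Network

end IAB

/-! ### Averaging over locations: the serving station -/

namespace IAB

open Filter Topology

variable {Ω : Type*} [MeasurableSpace Ω]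

/-- The other tier. -/
def Tier.other : Tier → Tier
  | .mbs => .sbs
  | .sbs => .mbs

lemma Tier.other_ne (i : Tier) : i.other ≠ i := by cases i <;> simp [Tier.other]

lemma prod_tier_other {M : Type*} [CommMonoid M] (i : Tier) (f : Tier → M) :
    ∏ j, f j = f i * f i.other := by
  cases i <;> simp [prod_tier, Tier.other, mul_comm]

lemma iprod_split {f : ℕ → ℝ≥0∞} (hf : ∀ m, f m ≤ 1) (n : ℕ) :
    iprod f = f n * iprod fun m => if m = n then 1 else f m := by
  have h : iprod (fun m => if m = n then f n else 1) = f n := by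
    rw [iprod_eq_prod (fun m => by split_ifs <;> simp [hf]) {n} fun m hm => by
      simp at hm; simp [hm]]
    simp
  conv_rhs => rw [← h]
  rw [← iprod_mul (fun m => by split_ifs <;> simp [hf]) fun m => by split_ifs <;> simp [hf]]
  congr 1; ext m
  split_ifs with hm <;> simp [hm]

/-- The Mecke formula for a decreasing family of test functions and an arbitrary weight. -/
lemma IsPoissonProcess.mecke_level_of_measurable {X : ℕ → Ω → Plane} {P : Measure Ω}
    [IsProbabilityMeasure P] {lam : ℝ} (h : IsPoissonProcess X lam P) (hlam : 0 ≤ lam)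
    {ℓ : Plane → ℝ} (hℓ : Measurable ℓ) {F : ℝ → Plane → ℝ≥0∞}
    (hF : Measurable (Function.uncurry F)) (hF1 : ∀ l y, F l y ≤ 1)
    (hanti : ∀ y, Antitone fun l => F l y) {w : Plane → ℝ≥0∞} (hw : Measurable w)
    (hc : ∀ᵐ x, ContinuousAt (fun l => ∫⁻ y, (1 - F l y)) (ℓ x)) :
    ∑' n, ∫⁻ ω, w (X n ω) * iprod (fun m => if m = n then 1 else F (ℓ (X n ω)) (X m ω)) ∂P =
      ENNReal.ofReal lam * ∫⁻ x, w x * expNeg (ENNReal.ofReal lam * ∫⁻ y, (1 - F (ℓ x) y)) := by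
  have hg : ∀ n, Measurable fun ω =>
      iprod (fun m => if m = n then 1 else F (ℓ (X n ω)) (X m ω)) := fun n =>
    Measurable.iprod fun m => measurable_ite_index _ _
      (hF.comp ((hℓ.comp (h.measurable n)).prodMk (h.measurable m)))
  have he : Measurable fun x => expNeg (ENNReal.ofReal lam * ∫⁻ y, (1 - F (ℓ x) y)) :=
    (measurable_expNeg_lintegral hF lam).comp hℓ
  let ν : Measure Plane := Measure.sum fun n => (P.withDensity fun ω =>
    iprod (fun m => if m = n then 1 else F (ℓ (X n ω)) (X m ω))).map (X n)
  let ν' : Measure Plane := ENNReal.ofReal lam • (volume.withDensity fun x =>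
    expNeg (ENNReal.ofReal lam * ∫⁻ y, (1 - F (ℓ x) y)))
  have h1 : ∀ v : Plane → ℝ≥0∞, Measurable v → ∫⁻ x, v x ∂ν = ∑' n, ∫⁻ ω, v (X n ω) *
      iprod (fun m => if m = n then 1 else F (ℓ (X n ω)) (X m ω)) ∂P := by
    intro v hv
    rw [lintegral_sum_measure]
    refine tsum_congr fun n => ?_
    rw [lintegral_map hv (h.measurable n)]
    refine (lintegral_withDensity_eq_lintegral_mul _ (hg n) (hv.comp (h.measurable n))).trans ?_
    exact lintegral_congr fun ω => mul_comm _ _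
  have h2 : ∀ v : Plane → ℝ≥0∞, Measurable v → ∫⁻ x, v x ∂ν' = ENNReal.ofReal lam *
      ∫⁻ x, v x * expNeg (ENNReal.ofReal lam * ∫⁻ y, (1 - F (ℓ x) y)) := by
    intro v hv
    rw [lintegral_smul_measure, lintegral_withDensity_eq_lintegral_mul _ he hv, smul_eq_mul]
    congr 1
    exact lintegral_congr fun ω => mul_comm _ _
  -- Both sides are measures evaluated at `w`. They agree on indicators, which satisfy the bound
  -- required by `mecke_level`, and so on every measurable weight.
  have h3 : ν = ν' := by
    refine Measure.ext fun B hB => ?_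
    have hB' := measurable_ind_mem hB
    rw [← lintegral_ind_mem ν hB, ← lintegral_ind_mem ν' hB, h1 _ hB', h2 _ hB']
    exact h.mecke_level hlam hℓ hF hF1 hanti hB' (fun x => ind_le_one _) hc
  rw [← h1 w hw, ← h2 w hw, h3]

/-- A prescribed pathloss confines the point to a sphere, which is Lebesgue null. -/
lemma ae_norm_sub_rpow_ne (y : Plane) {α : ℝ} (hα : 0 < α) (a : ℝ) :
    ∀ᵐ x : Plane, ‖x - y‖ ^ α ≠ a := by
  rw [ae_iff]
  refine measure_mono_null (fun x hx => ?_) (Measure.addHaar_sphere volume y (a ^ (1 / α)))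
  simp only [ne_eq, not_not, mem_ofPred_eq] at hx
  rw [mem_sphere_iff_norm, ← hx, ← Real.rpow_mul (norm_nonneg _), mul_one_div_cancel hα.ne',
    Real.rpow_one]

namespace Params

variable (p : Params) {R : ℝ → ℝ → Prop}

lemma measurable_levelE {c : ℝ} (hc : 0 ≤ c) (i j : Tier) : Measurable (p.levelE c i j) :=
  (p.levelE_mono hc i j).measurable

/-- Macro stations do not interfere, so their factor is just the probability of losing the
association. Multiplied by the density, it is the intensity of the macro process thinned by the fact
that a small cell serves. -/
lemma levelF_mbs_ae (hR : IsCmp R) (c : ℝ) {l : ℝ} (hl : 0 ≤ l) : ∀ᵐ x : Plane,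
    ENNReal.ofReal (p.density .mbs) * p.levelF R c .sbs .mbs l ‖x‖ =
      ENNReal.ofReal (p.condDensityUser l ‖x‖) := by
  have hall : ∀ᵐ x : Plane, ∀ s, ‖x‖ ^ p.pathlossExp .access .mbs s ≠
      p.powerRatio .mbs .sbs * l := ae_all_iff.2 fun s => by
    simpa using ae_norm_sub_rpow_ne 0 (p.pathlossExp_pos .access .mbs s)
      (p.powerRatio .mbs .sbs * l)
  filter_upwards [hall] with x hx
  have hΩ := p.powerRatio_pos .mbs .sbs
  have hq := fun s => p.stateProb_nonneg s (norm_nonneg x)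
  rw [condDensityUser_eq, ENNReal.ofReal_mul (p.density_pos _).le, levelF,
    ENNReal.ofReal_sum_of_nonneg fun s _ => by split_ifs <;> simp [hq]]
  congr 1
  refine Finset.sum_congr rfl fun s _ => ?_
  rw [hR.ind_eq (hx s), ENNReal.ofReal_mul (hq s)]
  have hiff := rpow_le_iff_le (p.pathlossExp_pos .access .mbs s) (norm_nonneg x)
    (by positivity : 0 ≤ p.powerRatio .mbs .sbs * l)
  by_cases h : p.powerRatio .mbs .sbs * l < ‖x‖ ^ p.pathlossExp .access .mbs s
  · rw [if_pos (not_le.1 fun h' => absurd (hiff.2 h') (not_le.2 h)), ind_true h]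
    simp [tierK]
  · rw [if_neg (not_lt.2 (hiff.1 (not_lt.1 h))), ind_false h]
    simp

lemma one_sub_backF_ae (hR : IsCmp R) (y : Plane) (l : ℝ) : ∀ᵐ x : Plane,
    1 - p.backF R l ‖x - y‖ = ∑ s, ENNReal.ofReal (p.stateProb s ‖x - y‖) *
      ind (‖x - y‖ ^ p.pathlossExp .backhaul .mbs s ≤ l) := by
  have hall : ∀ᵐ x : Plane, ∀ s, ‖x - y‖ ^ p.pathlossExp .backhaul .mbs s ≠ l :=
    ae_all_iff.2 fun s => ae_norm_sub_rpow_ne y (p.pathlossExp_pos .backhaul .mbs s) l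
  filter_upwards [hall] with x hx
  rw [backF, p.one_sub_sum_stateProb (norm_nonneg _) fun s => ind_le_one _]
  refine Finset.sum_congr rfl fun s _ => ?_
  rw [hR.ind_eq (hx s)]
  by_cases h : l < ‖x - y‖ ^ p.pathlossExp .backhaul .mbs s
  · rw [ind_true h, ind_false (not_le.2 h), tsub_self]
  · rw [ind_false h, ind_true (not_lt.1 h), tsub_zero]

/-- Mean number of macro base stations with backhaul pathloss at most `l` at the small cell base
station at `y`, given that its access pathloss is `L`. -/
def backMass (L : ℝ) (y : Plane) (l : ℝ) : ℝ≥0∞ :=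
  ∫⁻ x : Plane, ENNReal.ofReal (p.condDensityUser L ‖x‖) *
    ∑ s, ENNReal.ofReal (p.stateProb s ‖x - y‖) *
      ind (‖x - y‖ ^ p.pathlossExp .backhaul .mbs s ≤ l)

lemma backMass_mono (L : ℝ) (y : Plane) : Monotone (p.backMass L y) := fun _ _ h =>
  lintegral_mono fun _ => mul_le_mul' le_rfl (Finset.sum_le_sum fun _ _ =>
    mul_le_mul' le_rfl (ind_mono fun h' => h'.trans h))

lemma measurable_backMass_integrand (L : ℝ) (y : Plane) (l : ℝ) : Measurable fun x : Plane =>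
    ENNReal.ofReal (p.condDensityUser L ‖x‖) * ∑ s, ENNReal.ofReal (p.stateProb s ‖x - y‖) *
      ind (‖x - y‖ ^ p.pathlossExp .backhaul .mbs s ≤ l) := by
  have h1 := p.measurable_condDensityUser L
  refine Measurable.mul (by fun_prop) (Finset.measurable_sum _ fun s _ => ?_)
  have h2 := (p.continuous_stateProb s).measurable
  exact Measurable.mul (by fun_prop) (measurable_ind (measurableSet_le (by fun_prop) (by fun_prop)))

/-- The integrand at 2l dominates for levels near l. Off a null set of spheres it is locally
constant in the level. -/
lemma continuousAt_backMass {L : ℝ} {y : Plane} {l : ℝ} (hl : 0 < l)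
    (hfin : p.backMass L y (2 * l) ≠ ∞) : ContinuousAt (p.backMass L y) l := by
  refine tendsto_lintegral_filter_of_dominated_convergence (fun x =>
    ENNReal.ofReal (p.condDensityUser L ‖x‖) * ∑ s, ENNReal.ofReal (p.stateProb s ‖x - y‖) *
      ind (‖x - y‖ ^ p.pathlossExp .backhaul .mbs s ≤ 2 * l))
    (Eventually.of_forall fun a => p.measurable_backMass_integrand L y a) ?_ hfin ?_
  · filter_upwards [Iio_mem_nhds (by linarith : l < 2 * l)] with a ha
    exact ae_of_all _ fun x => mul_le_mul' le_rfl (Finset.sum_le_sum fun s _ =>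
      mul_le_mul' le_rfl (ind_mono fun h' => h'.trans (le_of_lt ha)))
  · have hall : ∀ᵐ x : Plane, ∀ s, ‖x - y‖ ^ p.pathlossExp .backhaul .mbs s ≠ l :=
      ae_all_iff.2 fun s => ae_norm_sub_rpow_ne y (p.pathlossExp_pos .backhaul .mbs s) l
    filter_upwards [hall] with x hx
    refine tendsto_const_nhds.congr' ?_
    have hev : ∀ s, ∀ᶠ a in 𝓝 l, ind (‖x - y‖ ^ p.pathlossExp .backhaul .mbs s ≤ l) =
        ind (‖x - y‖ ^ p.pathlossExp .backhaul .mbs s ≤ a) := by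
      intro s
      rcases (hx s).lt_or_gt with h | h
      · filter_upwards [lt_mem_nhds h] with a ha
        rw [ind_true h.le, ind_true (le_of_lt ha)]
      · filter_upwards [gt_mem_nhds h] with a ha
        rw [ind_false (not_le.2 h), ind_false (not_le.2 ha)]
    filter_upwards [eventually_all.2 hev] with a ha
    simp_rw [ha]

/-- By 1 - BF = (1 - F) + F(1 - B), a macro station is excluded either because the user prefers it
or, having lost the association, because the small cell prefers it to the anchor. The second part is
a mass under the thinned intensity. -/
lemma lintegral_one_sub_backF_mul_levelF (hR : IsCmp R) (c : ℝ) {L : ℝ} (hL : 0 ≤ L) (y : Plane)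
    (l : ℝ) : ENNReal.ofReal (p.density .mbs) * ∫⁻ x : Plane,
        (1 - p.backF R l ‖x - y‖ * p.levelF R c .sbs .mbs L ‖x‖) =
      p.levelE c .sbs .mbs L + p.backMass L y l := by
  have hmF : Measurable fun x : Plane => p.levelF R c .sbs .mbs L ‖x‖ :=
    (p.measurable_levelF hR c .sbs .mbs).comp (f := fun x : Plane => (L, ‖x‖)) (by fun_prop)
  have hmB : Measurable fun x : Plane => p.backF R l ‖x - y‖ :=
    (p.measurable_backF hR).comp (f := fun x : Plane => (l, ‖x - y‖)) (by fun_prop)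
  have hsplit : ∀ x : Plane, 1 - p.backF R l ‖x - y‖ * p.levelF R c .sbs .mbs L ‖x‖ =
      (1 - p.levelF R c .sbs .mbs L ‖x‖) +
        p.levelF R c .sbs .mbs L ‖x‖ * (1 - p.backF R l ‖x - y‖) := by
    intro x
    have hb := p.backF_le_one R l (norm_nonneg (x - y))
    have hf := p.levelF_le_one R c .sbs .mbs L (norm_nonneg x)
    have hft := (hf.trans_lt ENNReal.one_lt_top).ne
    rw [ENNReal.mul_sub fun _ _ => hft, mul_one, mul_comm (p.backF _ _ _)]
    exact (tsub_add_tsub_cancel hf (mul_le_of_le_one_right' hb)).symm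
  simp_rw [hsplit]
  rw [lintegral_add_left (measurable_const.fun_sub hmF), mul_add, p.lintegral_one_sub_levelF hR]
  congr 1
  rw [← lintegral_const_mul _ (hmF.fun_mul (measurable_const.fun_sub hmB))]
  refine lintegral_congr_ae ?_
  filter_upwards [p.levelF_mbs_ae hR c hL, p.one_sub_backF_ae hR y l] with x h1 h2
  rw [← mul_assoc, h1, h2]

end Params

namespace Network

variable {p : Params} {P : Measure Ω} (N : Network p P) {R : ℝ → ℝ → Prop}

lemma indep_other (i : Tier) :
    IndepFun (fun ω n => N.loc i n ω) (fun ω n => N.loc i.other n ω) P := by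
  cases i
  exacts [N.indep_loc, N.indep_loc.symm]

lemma measurable_loc (i : Tier) (n : ℕ) : Measurable (N.loc i n) := (N.poisson i).measurable n

variable [IsProbabilityMeasure P]

lemma lintegral_iprod_levelF (hR : IsCmp R) (c : ℝ) (i j : Tier) (l : ℝ) :
    ∫⁻ ω, iprod (fun m => p.levelF R c i j l ‖N.loc j m ω‖) ∂P = expNeg (p.levelE c i j l) := by
  rw [(N.poisson j).laplace (p.density_pos j).le (f := fun y => p.levelF R c i j l ‖y‖)
    ((p.measurable_levelF hR c i j).comp (f := fun x : Plane => (l, ‖x‖)) (by fun_prop))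
    (fun y => p.levelF_le_one R c i j l (norm_nonneg y)), p.lintegral_one_sub_levelF hR]

/-- The Mecke formula for the serving base station within its tier. -/
lemma mecke_serving (hR : IsCmp R) {c : ℝ} (hc : 0 ≤ c) (i : Tier) (s : LinkState)
    {w : Plane → ℝ≥0∞} (hw : Measurable w) :
    ∑' n, ∫⁻ ω, w (N.loc i n ω) * iprod (fun m => if m = n then 1 else p.levelF R c i i
        (‖N.loc i n ω‖ ^ p.pathlossExp .access i s) ‖N.loc i m ω‖) ∂P =
      ENNReal.ofReal (p.density i) * ∫⁻ x, w x *
        expNeg (p.levelE c i i (‖x‖ ^ p.pathlossExp .access i s)) := by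
  have h := (N.poisson i).mecke_level_of_measurable (p.density_pos i).le
    (ℓ := fun x => ‖x‖ ^ p.pathlossExp .access i s) (by fun_prop)
    (F := fun l y => p.levelF R c i i l ‖y‖)
    ((p.measurable_levelF hR c i i).comp (f := fun z : ℝ × Plane => (z.1, ‖z.2‖)) (by fun_prop))
    (fun l y => p.levelF_le_one R c i i l (norm_nonneg y))
    (fun y => p.levelF_antitone hR hc i i (norm_nonneg y)) hw ?_
  · simp_rw [p.lintegral_one_sub_levelF hR] at h
    exact h
  · have h0 : ∀ᵐ x : Plane, x ≠ 0 := by simp [ae_iff]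
    filter_upwards [h0] with x hx
    exact p.continuousAt_lintegral_levelF hR hc i i (Real.rpow_pos_of_pos (norm_pos_iff.2 hx) _)

/-- The tier of the tagged station is handled by Mecke's formula and the other, independent, tier by
its Laplace functional. -/
lemma lintegral_locs_serving (hR : IsCmp R) (κ : ℝ) {c : ℝ} (hc : 0 ≤ c) (i : Tier) :
    ∑' n, ∫⁻ ω, ∑ s, ENNReal.ofReal (p.stateProb s ‖N.loc i n ω‖) *
        (expNeg (ENNReal.ofReal (κ * ‖N.loc i n ω‖ ^ p.pathlossExp .access i s)) *
          ∏ j, iprod fun m => if (j, m) = (i, n) then 1 else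
            p.levelF R c i j (‖N.loc i n ω‖ ^ p.pathlossExp .access i s) ‖N.loc j m ω‖) ∂P =
      ∫⁻ l in Ioi (0 : ℝ), expNeg (ENNReal.ofReal (κ * l)) * (∏ j, expNeg (p.levelE c i j l)) *
        ENNReal.ofReal (p.pathlossDensity i l) := by
  have hml := N.measurable_loc
  have hq : ∀ s, Measurable (p.stateProb s) := fun s => (p.continuous_stateProb s).measurable
  have hmE := fun j => p.measurable_levelE hc i j
  have hFm : ∀ (j : Tier) (s : LinkState) (n m : ℕ), Measurable fun z : (ℕ → Plane) × (ℕ → Plane) =>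
      p.levelF R c i j (‖z.1 n‖ ^ p.pathlossExp .access i s) ‖z.2 m‖ := fun j s n m =>
    (p.measurable_levelF hR c i j).comp (f := fun z : (ℕ → Plane) × (ℕ → Plane) =>
      (‖z.1 n‖ ^ p.pathlossExp .access i s, ‖z.2 m‖)) (by fun_prop)
  let f : LinkState → ℕ → (ℕ → Plane) → (ℕ → Plane) → ℝ≥0∞ := fun s n a b =>
    ENNReal.ofReal (p.stateProb s ‖a n‖) *
      expNeg (ENNReal.ofReal (κ * ‖a n‖ ^ p.pathlossExp .access i s)) *
      (iprod fun m => if m = n then 1 else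
        p.levelF R c i i (‖a n‖ ^ p.pathlossExp .access i s) ‖a m‖) *
      (iprod fun m => p.levelF R c i i.other (‖a n‖ ^ p.pathlossExp .access i s) ‖b m‖)
  have hf : ∀ s n, Measurable (Function.uncurry (f s n)) := by
    intro s n
    have h1 := hq s
    refine Measurable.mul (Measurable.mul ?_ (Measurable.iprod fun m =>
      measurable_ite_index _ _ ?_)) (Measurable.iprod fun m => hFm i.other s n m)
    · fun_prop
    · exact (hFm i s n m).comp (f := fun z : (ℕ → Plane) × (ℕ → Plane) => (z.1, z.1))
        (by fun_prop)
  have e1 : ∀ n ω s, ENNReal.ofReal (p.stateProb s ‖N.loc i n ω‖) *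
        (expNeg (ENNReal.ofReal (κ * ‖N.loc i n ω‖ ^ p.pathlossExp .access i s)) *
          ∏ j, iprod fun m => if (j, m) = (i, n) then 1 else
            p.levelF R c i j (‖N.loc i n ω‖ ^ p.pathlossExp .access i s) ‖N.loc j m ω‖) =
      f s n (fun m => N.loc i m ω) (fun m => N.loc i.other m ω) := by
    intro n ω s
    rw [prod_tier_other i]
    simp only [f, Prod.mk.injEq, true_and, i.other_ne, false_and, if_false]
    ring
  have hX : ∀ j, Measurable fun ω m => N.loc j m ω := fun j => measurable_pi_iff.2 (hml j)
  simp_rw [e1]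
  -- The other tier is integrated first, the serving tier being frozen.
  have e2 : ∀ n, ∫⁻ ω, ∑ s, f s n (fun m => N.loc i m ω) (fun m => N.loc i.other m ω) ∂P =
      ∑ s, ∫⁻ ω, ENNReal.ofReal (p.stateProb s ‖N.loc i n ω‖) *
        expNeg (ENNReal.ofReal (κ * ‖N.loc i n ω‖ ^ p.pathlossExp .access i s)) *
        expNeg (p.levelE c i i.other (‖N.loc i n ω‖ ^ p.pathlossExp .access i s)) *
        (iprod fun m => if m = n then 1 else
          p.levelF R c i i (‖N.loc i n ω‖ ^ p.pathlossExp .access i s) ‖N.loc i m ω‖) ∂P := by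
    intro n
    refine (lintegral_finsetSum _ fun s _ => (hf s n).comp ((hX i).prodMk (hX i.other))).trans ?_
    refine Finset.sum_congr rfl fun s _ => ?_
    refine (lintegral_comp_indepFun (hX i) (hX i.other) (N.indep_other i) (hf s n)).trans ?_
    refine lintegral_congr fun ω => ?_
    simp only [f]
    rw [lintegral_const_mul, N.lintegral_iprod_levelF hR]
    · ring
    · exact Measurable.iprod fun m => (p.measurable_levelF hR c i i.other).comp
        (f := fun ω' => (‖N.loc i n ω‖ ^ p.pathlossExp .access i s, ‖N.loc i.other m ω'‖))
        (by have := hml i.other m; fun_prop)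
  simp_rw [e2]
  rw [Summable.tsum_finsetSum fun s _ => ENNReal.summable]
  have e3 : ∀ s, _ := fun s => N.mecke_serving hR hc i s
    (w := fun x => ENNReal.ofReal (p.stateProb s ‖x‖) *
        expNeg (ENNReal.ofReal (κ * ‖x‖ ^ p.pathlossExp .access i s)) *
        expNeg (p.levelE c i i.other (‖x‖ ^ p.pathlossExp .access i s)))
    (by have := hq s; have := hmE i.other; fun_prop)
  simp_rw [e3]
  have e4 : ∀ s, ENNReal.ofReal (p.density i) * ∫⁻ x : Plane, ENNReal.ofReal (p.stateProb s ‖x‖) *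
        expNeg (ENNReal.ofReal (κ * ‖x‖ ^ p.pathlossExp .access i s)) *
        expNeg (p.levelE c i i.other (‖x‖ ^ p.pathlossExp .access i s)) *
        expNeg (p.levelE c i i (‖x‖ ^ p.pathlossExp .access i s)) =
      ∫⁻ l in Ioi (0 : ℝ), expNeg (ENNReal.ofReal (κ * l)) * (∏ j, expNeg (p.levelE c i j l)) *
        ENNReal.ofReal (p.pathlossDensityState i s l) := by
    intro s
    rw [← p.lintegral_pathloss_state i s]
    · congr 1
      refine lintegral_congr fun x => ?_
      rw [prod_tier_other i]
      ring
    · exact Measurable.mul (by fun_prop) (Finset.measurable_prod _ fun j _ => (hmE j).expNeg)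
  simp_rw [e4]
  rw [← lintegral_finsetSum _ fun s _ => Measurable.fun_mul (Measurable.fun_mul (by fun_prop)
    (Finset.measurable_prod _ fun j _ => (hmE j).expNeg))
    (p.measurable_pathlossDensityState i s).ennreal_ofReal]
  refine setLIntegral_congr_fun measurableSet_Ioi fun l hl => ?_
  rw [p.ofReal_pathlossDensity i (le_of_lt hl), Finset.mul_sum]

end Network

end IAB

/-! ### Averaging over locations: the anchor -/

namespace IAB

open Filter Topology

variable {Ω : Type*} [MeasurableSpace Ω]

namespace Params

variable (p : Params) {R : ℝ → ℝ → Prop}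

lemma backF_antitone (hR : IsCmp R) {r : ℝ} : Antitone fun l => p.backF R l r := fun _ _ hl =>
  Finset.sum_le_sum fun _ _ => mul_le_mul' le_rfl (ind_mono (hR.of_le hl))

lemma backMass_eq (t : LinkState) {L : ℝ} {y : Plane}
    (hy : ‖y‖ = L ^ (1 / p.pathlossExp .access .sbs t)) {l : ℝ} (hl : 0 ≤ l) :
    p.backMass L y l = ENNReal.ofReal (p.condPathlossMeasure t l L 0) :=
  (p.condPathlossMeasure_spec t hl hy).2

/-- Contribution of the locations of the small cell base stations to the event that the `k`-th of
them serves the user through an access link in state `t`. -/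
def servingTerm (R : ℝ → ℝ → Prop) (κ c : ℝ) (t : LinkState) (k : ℕ) (a : ℕ → Plane) : ℝ≥0∞ :=
  ENNReal.ofReal (p.stateProb t ‖a k‖) *
    expNeg (ENNReal.ofReal (κ * ‖a k‖ ^ p.pathlossExp .access .sbs t)) *
    iprod fun m => if m = k then 1 else
      p.levelF R c .sbs .sbs (‖a k‖ ^ p.pathlossExp .access .sbs t) ‖a m‖

/-- Contribution of the locations of the macro base stations to the event that the `n`-th of them is
the anchor, over a link in state `s`, of the serving small cell base station at `y`. -/
def anchorTerm (R : ℝ → ℝ → Prop) (κ c : ℝ) (t s : LinkState) (n : ℕ) (y : Plane)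
    (b : ℕ → Plane) : ℝ≥0∞ :=
  ENNReal.ofReal (p.stateProb s ‖b n - y‖) *
    expNeg (ENNReal.ofReal (κ * ‖b n - y‖ ^ p.pathlossExp .backhaul .mbs s)) *
    ((iprod fun m => if m = n then 1 else
      p.backF R (‖b n - y‖ ^ p.pathlossExp .backhaul .mbs s) ‖b m - y‖) *
    iprod fun m => p.levelF R c .sbs .mbs (‖y‖ ^ p.pathlossExp .access .sbs t) ‖b m‖)

lemma measurable_servingTerm (hR : IsCmp R) (κ c : ℝ) (t : LinkState) (k : ℕ) :
    Measurable (p.servingTerm R κ c t k) := by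
  have h1 := (p.continuous_stateProb t).measurable
  unfold servingTerm
  refine Measurable.mul (by fun_prop) (Measurable.iprod fun m => measurable_ite_index _ _ ?_)
  exact (p.measurable_levelF hR c .sbs .sbs).comp (f := fun a : ℕ → Plane =>
    (‖a k‖ ^ p.pathlossExp .access .sbs t, ‖a m‖)) (by fun_prop)

lemma measurable_anchorTerm (hR : IsCmp R) (κ c : ℝ) (t s : LinkState) (n : ℕ) {α : Type*}
    [MeasurableSpace α] {y : α → Plane} {b : α → ℕ → Plane} (hy : Measurable y)
    (hb : Measurable b) : Measurable fun a => p.anchorTerm R κ c t s n (y a) (b a) := by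
  have h1 := (p.continuous_stateProb s).measurable
  have hbm : ∀ m, Measurable fun a => b a m := fun m => by fun_prop
  have hbn := hbm n
  unfold anchorTerm
  refine Measurable.mul (by fun_prop) (Measurable.mul (Measurable.iprod fun m =>
    measurable_ite_index _ _ ?_) (Measurable.iprod fun m => ?_))
  · have hm := hbm m
    exact (p.measurable_backF hR).comp (f := fun a =>
      (‖b a n - y a‖ ^ p.pathlossExp .backhaul .mbs s, ‖b a m - y a‖)) (by fun_prop)
  · have hm := hbm m
    exact (p.measurable_levelF hR c .sbs .mbs).comp (f := fun a =>
      (‖y a‖ ^ p.pathlossExp .access .sbs t, ‖b a m‖)) (by fun_prop)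

/-- Conditional probability that the backhaul link is above the threshold, given the access
pathloss `L`; the access link of the serving base station is in state `t`. -/
def backhaulIntegral (κ : ℝ) (t : LinkState) (L : ℝ) : ℝ≥0∞ :=
  ∫⁻ l in Ioi (0 : ℝ), expNeg (ENNReal.ofReal (κ * l)) *
    expNeg (ENNReal.ofReal (p.condPathlossMeasure t l L 0)) *
      ENNReal.ofReal (p.condPathlossDensity t l L 0)

end Params

namespace Network

variable {p : Params} {P : Measure Ω} (N : Network p P) {R : ℝ → ℝ → Prop}

/-- Sum over all macro base stations of `anchorTerm`, averaged over their locations. -/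
def anchorMean (R : ℝ → ℝ → Prop) (κ c : ℝ) (t : LinkState) (y : Plane) : ℝ≥0∞ :=
  ∑ s, ∑' n, ∫⁻ ω, p.anchorTerm R κ c t s n y (fun m => N.loc .mbs m ω) ∂P

lemma measurable_locSeq (i : Tier) : Measurable fun ω m => N.loc i m ω :=
  measurable_pi_iff.2 fun m => N.measurable_loc i m

variable [IsProbabilityMeasure P]

lemma measurable_anchorMean (hR : IsCmp R) (κ c : ℝ) (t : LinkState) :
    Measurable (N.anchorMean R κ c t) := by
  unfold anchorMean
  refine Finset.measurable_sum _ fun s _ => Measurable.tsum fun n => ?_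
  exact Measurable.lintegral_prod_right' (f := fun z : Plane × Ω =>
    p.anchorTerm R κ c t s n z.1 (fun m => N.loc .mbs m z.2))
    (p.measurable_anchorTerm hR κ c t s n measurable_fst
      ((N.measurable_locSeq .mbs).comp measurable_snd))

/-- The Mecke formula for the anchor of the small cell base station at `y`. -/
lemma mecke_anchor (hR : IsCmp R) (c : ℝ) (t s : LinkState) {L : ℝ} (hL : 0 ≤ L) {y : Plane}
    (hy : ‖y‖ = L ^ (1 / p.pathlossExp .access .sbs t)) {w : Plane → ℝ≥0∞} (hw : Measurable w) :
    ∑' n, ∫⁻ ω, w (N.loc .mbs n ω) * iprod (fun m => if m = n then 1 else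
        p.backF R (‖N.loc .mbs n ω - y‖ ^ p.pathlossExp .backhaul .mbs s) ‖N.loc .mbs m ω - y‖ *
          p.levelF R c .sbs .mbs L ‖N.loc .mbs m ω‖) ∂P =
      ENNReal.ofReal (p.density .mbs) * ∫⁻ x, w x * expNeg (p.levelE c .sbs .mbs L +
        p.backMass L y (‖x - y‖ ^ p.pathlossExp .backhaul .mbs s)) := by
  have hd : ENNReal.ofReal (p.density .mbs) ≠ 0 := by simpa using p.density_pos .mbs
  have hF : Measurable (Function.uncurry fun l (x : Plane) =>
      p.backF R l ‖x - y‖ * p.levelF R c .sbs .mbs L ‖x‖) := by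
    refine Measurable.mul ?_ ?_
    · exact (p.measurable_backF hR).comp (f := fun z : ℝ × Plane => (z.1, ‖z.2 - y‖))
        (by fun_prop)
    · exact (p.measurable_levelF hR c .sbs .mbs).comp (f := fun z : ℝ × Plane => (L, ‖z.2‖))
        (by fun_prop)
  have hℓ : Measurable fun x : Plane => ‖x - y‖ ^ p.pathlossExp .backhaul .mbs s := by fun_prop
  have h := (N.poisson .mbs).mecke_level_of_measurable (p.density_pos .mbs).le hℓ hF
    (fun l x => mul_le_one' (p.backF_le_one R l (norm_nonneg _))
      (p.levelF_le_one R c .sbs .mbs L (norm_nonneg x)))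
    (fun x l l' hl => mul_le_mul' (p.backF_antitone hR hl) le_rfl) hw ?_
  · simp_rw [p.lintegral_one_sub_backF_mul_levelF hR c hL y] at h
    exact h
  · have h0 : ∀ᵐ x : Plane, x ≠ y := by simp [ae_iff]
    filter_upwards [h0] with x hx
    have hpos : 0 < ‖x - y‖ ^ p.pathlossExp .backhaul .mbs s :=
      Real.rpow_pos_of_pos (norm_pos_iff.2 (sub_ne_zero.2 hx)) _
    have e : (fun l => ∫⁻ x : Plane, (1 - p.backF R l ‖x - y‖ * p.levelF R c .sbs .mbs L ‖x‖)) =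
        fun l => (ENNReal.ofReal (p.density .mbs))⁻¹ *
          (p.levelE c .sbs .mbs L + p.backMass L y l) := by
      ext l
      rw [← p.lintegral_one_sub_backF_mul_levelF hR c hL y l, ← mul_assoc,
        ENNReal.inv_mul_cancel hd (by simp), one_mul]
    rw [e]
    refine ENNReal.Tendsto.const_mul ?_ (Or.inr (by simpa using hd))
    -- The association exponent does not depend on the anchor's level. Only the mass varies, and it
    -- is finite at every level.
    refine tendsto_const_nhds.add (p.continuousAt_backMass hpos ?_)
    rw [p.backMass_eq t hy (by positivity)]
    simp

/-- The sum over anchors is Mecke's formula for the thinned macro process seen from `y`. The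
untagged part of the exponent splits off as the probability that no macro station is preferred by
the user, and the rest depends on `y` only through `L` and `t`. -/
lemma anchorMean_eq (hR : IsCmp R) (κ c : ℝ) (t : LinkState) {L : ℝ} (hL : 0 ≤ L) {y : Plane}
    (hy : ‖y‖ = L ^ (1 / p.pathlossExp .access .sbs t)) :
    N.anchorMean R κ c t y = expNeg (p.levelE c .sbs .mbs L) * p.backhaulIntegral κ t L := by
  have hyL : ‖y‖ ^ p.pathlossExp .access .sbs t = L := by
    rw [hy, ← Real.rpow_mul hL, one_div_mul_cancel (p.pathlossExp_pos _ _ _).ne', Real.rpow_one]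
  have hmF : Measurable fun x : Plane => p.levelF R c .sbs .mbs L ‖x‖ :=
    (p.measurable_levelF hR c .sbs .mbs).comp (f := fun x : Plane => (L, ‖x‖)) (by fun_prop)
  have hq : ∀ s, Measurable (p.stateProb s) := fun s => (p.continuous_stateProb s).measurable
  have hmM : Measurable (p.backMass L y) := (p.backMass_mono L y).measurable
  have hmD := p.measurable_condDensityUser L
  -- The anchor must lose the association like any macro station. Its factor is moved into the
  -- weight, where it turns the density into the thinned intensity.
  have e1 : ∀ s n (b : ℕ → Plane), p.anchorTerm R κ c t s n y b =
      (ENNReal.ofReal (p.stateProb s ‖b n - y‖) *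
        expNeg (ENNReal.ofReal (κ * ‖b n - y‖ ^ p.pathlossExp .backhaul .mbs s)) *
        p.levelF R c .sbs .mbs L ‖b n‖) * iprod (fun m => if m = n then 1 else
          p.backF R (‖b n - y‖ ^ p.pathlossExp .backhaul .mbs s) ‖b m - y‖ *
            p.levelF R c .sbs .mbs L ‖b m‖) := by
    intro s n b
    have hF1 : ∀ m, p.levelF R c .sbs .mbs L ‖b m‖ ≤ 1 := fun m =>
      p.levelF_le_one R c .sbs .mbs L (norm_nonneg _)
    have hB1 : ∀ l m, p.backF R l ‖b m - y‖ ≤ 1 := fun l m => p.backF_le_one R l (norm_nonneg _)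
    have h1 : ∀ m, (if m = n then 1 else p.backF R (‖b n - y‖ ^ p.pathlossExp .backhaul .mbs s)
          ‖b m - y‖ * p.levelF R c .sbs .mbs L ‖b m‖) =
        (if m = n then 1 else p.backF R (‖b n - y‖ ^ p.pathlossExp .backhaul .mbs s) ‖b m - y‖) *
          if m = n then 1 else p.levelF R c .sbs .mbs L ‖b m‖ := by
      intro m; split_ifs <;> simp
    simp_rw [h1]
    rw [Params.anchorTerm, hyL, iprod_split hF1 n, iprod_mul]
    · ring
    · intro m; split_ifs <;> simp [hB1]
    · intro m; split_ifs <;> simp [hF1]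
  have e2 : ∀ s, ∑' n, ∫⁻ ω, p.anchorTerm R κ c t s n y (fun m => N.loc .mbs m ω) ∂P =
      ∫⁻ x : Plane, ENNReal.ofReal (p.condDensityUser L ‖x‖) *
        (ENNReal.ofReal (p.stateProb s ‖x - y‖) *
        (expNeg (ENNReal.ofReal (κ * ‖x - y‖ ^ p.pathlossExp .backhaul .mbs s)) *
        expNeg (p.levelE c .sbs .mbs L +
          p.backMass L y (‖x - y‖ ^ p.pathlossExp .backhaul .mbs s)))) := by
    intro s
    have hs := hq s
    simp_rw [e1]
    rw [N.mecke_anchor hR c t s hL hy (w := fun x => ENNReal.ofReal (p.stateProb s ‖x - y‖) *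
        expNeg (ENNReal.ofReal (κ * ‖x - y‖ ^ p.pathlossExp .backhaul .mbs s)) *
        p.levelF R c .sbs .mbs L ‖x‖) (by fun_prop), ← lintegral_const_mul _ (by fun_prop)]
    refine lintegral_congr_ae ?_
    filter_upwards [p.levelF_mbs_ae hR c hL] with x hx
    rw [← hx]
    ring
  unfold anchorMean
  simp_rw [e2]
  rw [← lintegral_finsetSum _ fun s _ => by have := hq s; fun_prop]
  simp_rw [← Finset.mul_sum]
  rw [p.condPathlossDensity_spec t hy (φ := fun l => expNeg (ENNReal.ofReal (κ * l)) *
    expNeg (p.levelE c .sbs .mbs L + p.backMass L y l)) (by fun_prop), Params.backhaulIntegral,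
    ← lintegral_const_mul' _ _ ((expNeg_le_one _).trans_lt ENNReal.one_lt_top).ne]
  refine setLIntegral_congr_fun measurableSet_Ioi fun l hl => ?_
  rw [expNeg_add, p.backMass_eq t hy (le_of_lt hl)]
  ring

/-- Given the small cells, the macro stations are integrated first and produce `anchorMean` at the
tagged location. That function then enters Mecke's formula for the small cells as part of an
arbitrary measurable weight, so no bound on it is required. -/
lemma lintegral_locs_anchor (hR : IsCmp R) (κ κ' : ℝ) {c : ℝ} (hc : 0 ≤ c) :
    ∑' k, ∑' n, ∫⁻ ω, ∑ t, ENNReal.ofReal (p.stateProb t ‖N.loc .sbs k ω‖) *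
        ∑ s, ENNReal.ofReal (p.stateProb s ‖N.loc .mbs n ω - N.loc .sbs k ω‖) *
          (expNeg (ENNReal.ofReal (κ * ‖N.loc .sbs k ω‖ ^ p.pathlossExp .access .sbs t)) *
            expNeg (ENNReal.ofReal
              (κ' * ‖N.loc .mbs n ω - N.loc .sbs k ω‖ ^ p.pathlossExp .backhaul .mbs s)) *
          ((iprod fun m => if m = n then 1 else
            p.backF R (‖N.loc .mbs n ω - N.loc .sbs k ω‖ ^ p.pathlossExp .backhaul .mbs s)
              ‖N.loc .mbs m ω - N.loc .sbs k ω‖) *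
          ∏ j, iprod fun m => if (j, m) = (Tier.sbs, k) then 1 else
            p.levelF R c .sbs j (‖N.loc .sbs k ω‖ ^ p.pathlossExp .access .sbs t)
              ‖N.loc j m ω‖)) ∂P =
      ∑ t, ∫⁻ l in Ioi (0 : ℝ), expNeg (ENNReal.ofReal (κ * l)) *
        (∏ j, expNeg (p.levelE c .sbs j l)) * p.backhaulIntegral κ' t l *
          ENNReal.ofReal (p.pathlossDensityState .sbs t l) := by
  have hX := N.measurable_locSeq
  have hmE := fun j => p.measurable_levelE hc .sbs j
  have hmS := p.measurable_servingTerm hR κ c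
  have hmM := N.measurable_anchorMean hR κ' c
  have e1 : ∀ k n ω, ∑ t, ENNReal.ofReal (p.stateProb t ‖N.loc .sbs k ω‖) *
        ∑ s, ENNReal.ofReal (p.stateProb s ‖N.loc .mbs n ω - N.loc .sbs k ω‖) *
          (expNeg (ENNReal.ofReal (κ * ‖N.loc .sbs k ω‖ ^ p.pathlossExp .access .sbs t)) *
            expNeg (ENNReal.ofReal
              (κ' * ‖N.loc .mbs n ω - N.loc .sbs k ω‖ ^ p.pathlossExp .backhaul .mbs s)) *
          ((iprod fun m => if m = n then 1 else
            p.backF R (‖N.loc .mbs n ω - N.loc .sbs k ω‖ ^ p.pathlossExp .backhaul .mbs s)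
              ‖N.loc .mbs m ω - N.loc .sbs k ω‖) *
          ∏ j, iprod fun m => if (j, m) = (Tier.sbs, k) then 1 else
            p.levelF R c .sbs j (‖N.loc .sbs k ω‖ ^ p.pathlossExp .access .sbs t)
              ‖N.loc j m ω‖)) =
      ∑ t, ∑ s, p.servingTerm R κ c t k (fun m => N.loc .sbs m ω) *
        p.anchorTerm R κ' c t s n (N.loc .sbs k ω) (fun m => N.loc .mbs m ω) := by
    intro k n ω
    refine Finset.sum_congr rfl fun t _ => ?_
    rw [Finset.mul_sum]
    refine Finset.sum_congr rfl fun s _ => ?_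
    rw [prod_tier, Params.servingTerm, Params.anchorTerm]
    simp only [Prod.mk.injEq, true_and, reduceCtorEq, false_and, if_false]
    ring
  simp_rw [e1]
  have hm2 : ∀ t s k n, Measurable fun ω => p.servingTerm R κ c t k (fun m => N.loc .sbs m ω) *
      p.anchorTerm R κ' c t s n (N.loc .sbs k ω) (fun m => N.loc .mbs m ω) := fun t s k n =>
    ((hmS t k).comp (hX .sbs)).mul
      (p.measurable_anchorTerm hR κ' c t s n (N.measurable_loc .sbs k) (hX .mbs))
  have e2 : ∀ k n, ∫⁻ ω, ∑ t, ∑ s, p.servingTerm R κ c t k (fun m => N.loc .sbs m ω) *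
        p.anchorTerm R κ' c t s n (N.loc .sbs k ω) (fun m => N.loc .mbs m ω) ∂P =
      ∑ t, ∑ s, ∫⁻ ω, p.servingTerm R κ c t k (fun m => N.loc .sbs m ω) *
        ∫⁻ ω', p.anchorTerm R κ' c t s n (N.loc .sbs k ω) (fun m => N.loc .mbs m ω') ∂P ∂P := by
    intro k n
    rw [lintegral_finsetSum _ fun t _ => Finset.measurable_sum _ fun s _ => hm2 t s k n]
    refine Finset.sum_congr rfl fun t _ => ?_
    rw [lintegral_finsetSum _ fun s _ => hm2 t s k n]
    refine Finset.sum_congr rfl fun s _ => ?_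
    refine (lintegral_comp_indepFun (hX .sbs) (hX .mbs) N.indep_loc.symm
      (f := fun a b => p.servingTerm R κ c t k a * p.anchorTerm R κ' c t s n (a k) b)
      (((hmS t k).comp measurable_fst).mul (p.measurable_anchorTerm hR κ' c t s n
        (y := fun z : (ℕ → Plane) × (ℕ → Plane) => z.1 k) (by fun_prop) measurable_snd))).trans ?_
    refine lintegral_congr fun ω => ?_
    rw [lintegral_const_mul _ (p.measurable_anchorTerm hR κ' c t s n measurable_const (hX .mbs))]
  have hm3 : ∀ t s k n, Measurable fun ω => p.servingTerm R κ c t k (fun m => N.loc .sbs m ω) *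
        ∫⁻ ω', p.anchorTerm R κ' c t s n (N.loc .sbs k ω) (fun m => N.loc .mbs m ω') ∂P := by
    intro t s k n
    refine ((hmS t k).comp (hX .sbs)).mul ?_
    exact Measurable.lintegral_prod_right' (f := fun z : Ω × Ω =>
      p.anchorTerm R κ' c t s n (N.loc .sbs k z.1) (fun m => N.loc .mbs m z.2))
      (p.measurable_anchorTerm hR κ' c t s n ((N.measurable_loc .sbs k).comp measurable_fst)
        ((hX .mbs).comp measurable_snd))
  have e3 : ∀ k, ∑' n, ∫⁻ ω, ∑ t, ∑ s, p.servingTerm R κ c t k (fun m => N.loc .sbs m ω) *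
        p.anchorTerm R κ' c t s n (N.loc .sbs k ω) (fun m => N.loc .mbs m ω) ∂P =
      ∑ t, ∫⁻ ω, p.servingTerm R κ c t k (fun m => N.loc .sbs m ω) *
        N.anchorMean R κ' c t (N.loc .sbs k ω) ∂P := by
    intro k
    simp_rw [e2 k]
    rw [Summable.tsum_finsetSum fun t _ => ENNReal.summable]
    refine Finset.sum_congr rfl fun t _ => ?_
    rw [Summable.tsum_finsetSum fun t _ => ENNReal.summable]
    simp_rw [anchorMean, Finset.mul_sum, ← ENNReal.tsum_mul_left]
    rw [lintegral_finsetSum _ fun s _ => Measurable.tsum fun n => hm3 t s k n]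
    exact Finset.sum_congr rfl fun s _ =>
      (lintegral_tsum fun n => (hm3 t s k n).aemeasurable).symm
  simp_rw [e3]
  rw [Summable.tsum_finsetSum fun t _ => ENNReal.summable]
  refine Finset.sum_congr rfl fun t _ => ?_
  have hqt := (p.continuous_stateProb t).measurable
  have hw : Measurable fun x : Plane => ENNReal.ofReal (p.stateProb t ‖x‖) *
      expNeg (ENNReal.ofReal (κ * ‖x‖ ^ p.pathlossExp .access .sbs t)) *
        N.anchorMean R κ' c t x := by
    have := hmM t
    fun_prop
  have e4 : ∀ k ω, p.servingTerm R κ c t k (fun m => N.loc .sbs m ω) *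
        N.anchorMean R κ' c t (N.loc .sbs k ω) =
      (ENNReal.ofReal (p.stateProb t ‖N.loc .sbs k ω‖) *
        expNeg (ENNReal.ofReal (κ * ‖N.loc .sbs k ω‖ ^ p.pathlossExp .access .sbs t)) *
        N.anchorMean R κ' c t (N.loc .sbs k ω)) * iprod fun m => if m = k then 1 else
          p.levelF R c .sbs .sbs (‖N.loc .sbs k ω‖ ^ p.pathlossExp .access .sbs t)
            ‖N.loc .sbs m ω‖ := by
    intro k ω
    rw [Params.servingTerm]
    ring
  simp_rw [e4]
  rw [N.mecke_serving hR hc .sbs t hw]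
  have hα := p.pathlossExp_pos .access .sbs t
  -- To express the weight through the pathloss alone, `anchorMean` is evaluated at a point of the
  -- first axis at the distance that corresponds to `L`; any point of that norm gives the same
  -- value.
  have hpt : ∀ L : ℝ, 0 ≤ L →
      ‖(EuclideanSpace.single 0 (L ^ (1 / p.pathlossExp .access .sbs t)) : Plane)‖ =
        L ^ (1 / p.pathlossExp .access .sbs t) := fun L hL => by
    rw [PiLp.norm_single, Real.norm_of_nonneg (Real.rpow_nonneg hL _)]
  have hmφ : Measurable fun L : ℝ => expNeg (ENNReal.ofReal (κ * L)) *
      N.anchorMean R κ' c t (EuclideanSpace.single 0 (L ^ (1 / p.pathlossExp .access .sbs t))) *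
        expNeg (p.levelE c .sbs .sbs L) := by
    have h1 := hmE .sbs
    have h2 : Measurable fun r : ℝ => (EuclideanSpace.single 0 r : Plane) := by
      have : Continuous fun r : ℝ => (EuclideanSpace.single 0 r : Plane) :=
        (isometry_iff_dist_eq.2 fun a b => PiLp.dist_single_same 2 (fun _ => ℝ) 0 a b).continuous
      exact this.measurable
    have h3 := (hmM t).comp (h2.comp (by fun_prop :
      Measurable fun L : ℝ => L ^ (1 / p.pathlossExp .access .sbs t)))
    exact Measurable.mul (Measurable.mul (by fun_prop) h3) (by fun_prop)
  have key := p.lintegral_pathloss_state .sbs t hmφ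
  refine Eq.trans ?_ (key.trans ?_)
  · congr 1
    refine lintegral_congr fun x => ?_
    have hL : 0 ≤ ‖x‖ ^ p.pathlossExp .access .sbs t := by positivity
    have hx : ‖x‖ = (‖x‖ ^ p.pathlossExp .access .sbs t) ^
        (1 / p.pathlossExp .access .sbs t) := by
      rw [← Real.rpow_mul (norm_nonneg x), mul_one_div_cancel hα.ne', Real.rpow_one]
    rw [N.anchorMean_eq hR κ' c t hL (hpt _ hL), N.anchorMean_eq hR κ' c t hL hx]
    ring
  · refine setLIntegral_congr_fun measurableSet_Ioi fun l hl => ?_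
    rw [N.anchorMean_eq hR κ' c t (le_of_lt hl) (hpt _ (le_of_lt hl)), prod_tier]
    ring

end Network

end IAB

/-! ### Absence of ties -/

namespace IAB

open Filter Topology

variable {Ω : Type*} [MeasurableSpace Ω]

lemma ae_eq_of_tsum_lintegral {ι : Type*} [Countable ι] {P : Measure Ω} {f g : ι → Ω → ℝ≥0∞}
    (hg : ∀ i, Measurable (g i)) (hle : ∀ i ω, f i ω ≤ g i ω)
    (hsum : ∑' i, ∫⁻ ω, g i ω ∂P = ∑' i, ∫⁻ ω, f i ω ∂P) (hfin : ∑' i, ∫⁻ ω, f i ω ∂P ≠ ∞) :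
    ∀ᵐ ω ∂P, ∀ i, f i ω = g i ω := by
  refine ae_all_iff.2 fun i => ?_
  have hi : ∫⁻ ω, g i ω ∂P ≤ ∫⁻ ω, f i ω ∂P := by
    by_contra hlt
    exact absurd hsum.symm (ENNReal.tsum_lt_tsum hfin (fun i => lintegral_mono (hle i))
      (not_le.1 hlt)).ne
  exact ae_eq_of_ae_le_of_lintegral_le (ae_of_all _ (hle i))
    (ENNReal.ne_top_of_tsum_ne_top hfin i) (hg i).aemeasurable hi

lemma tsum_le_one_of_unique {ι : Type*} {f : ι → ℝ≥0∞} (h1 : ∀ i, f i ≤ 1)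
    (h : ∀ i j, f i ≠ 0 → f j ≠ 0 → i = j) : ∑' i, f i ≤ 1 := by
  by_cases h0 : ∃ i, f i ≠ 0
  · obtain ⟨i, hi⟩ := h0
    rw [tsum_eq_single i fun j hj => by_contra fun hj' => hj (h j i hj' hi)]
    exact h1 i
  · push Not at h0
    simp [h0]

/-- Events defined through an arbitrary maximizer need not be measurable. Agreement almost
everywhere with a measurable function gives null measurability and the value of the measure. -/
lemma measure_eq_lintegral_of_ind_ae {P : Measure Ω} {q : Ω → Prop} {g : Ω → ℝ≥0∞}
    (hg : Measurable g) (h : ∀ᵐ ω ∂P, ind (q ω) = g ω) :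
    NullMeasurableSet {ω | q ω} P ∧ P {ω | q ω} = ∫⁻ ω, g ω ∂P := by
  have hm : MeasurableSet {ω | g ω = 1} := hg (measurableSet_singleton 1)
  have hae : {ω | q ω} =ᵐ[P] {ω | g ω = 1} := by
    filter_upwards [h] with ω hω
    refine propext ⟨fun hq : q ω => ?_, fun hq : g ω = 1 => ?_⟩
    · change g ω = 1
      rw [← hω, ind_true hq]
    · change q ω
      by_contra hn
      rw [← hω, ind_false hn] at hq
      exact zero_ne_one hq
  refine ⟨hm.nullMeasurableSet.congr hae.symm, ?_⟩
  rw [measure_congr hae, ← lintegral_ind P hm]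
  refine lintegral_congr_ae ?_
  filter_upwards [h] with ω hω
  by_cases hq : q ω
  · rw [← hω, ind_true hq, ind_true rfl]
  · rw [← hω, ind_false hq, ind_false (by simp)]

lemma ite_ind (a b : Prop) [Decidable a] : (if a then 1 else ind b) = ind (¬ a → b) := by
  by_cases ha : a
  · rw [if_pos ha, ind_true fun h => absurd ha h]
  · rw [if_neg ha]
    exact congrArg ind (propext ⟨fun h _ => h, fun h => h ha⟩)

lemma ind_ne_zero {q : Prop} (h : ind q ≠ 0) : q := by
  by_contra hq
  exact h (ind_false hq)

lemma argmax_spec {ι : Type*} [Nonempty ι] {f : ι → ℝ} (h : ∃ b, ∀ c, f c ≤ f b) :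
    ∀ c, f c ≤ f (argmax f) := Classical.epsilon_spec h

/-- Only the finitely many indices at least as good as a given one compete. -/
lemma exists_max_of_finite {ι : Type*} [Nonempty ι] {f : ι → ℝ}
    (h : ∀ b₀, {b | f b₀ ≤ f b}.Finite) : ∃ b, ∀ c, f c ≤ f b := by
  obtain ⟨b₀⟩ := ‹Nonempty ι›
  obtain ⟨b, hb, hmax⟩ := Set.exists_max_image _ f (h b₀) ⟨b₀, le_refl (f b₀)⟩
  refine ⟨b, fun c => ?_⟩
  by_cases hc : f b₀ ≤ f c
  · exact hmax c hc
  · exact (le_of_lt (not_le.1 hc)).trans hb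

namespace Params

variable (p : Params) {R : ℝ → ℝ → Prop}

lemma servingInd_eq (R : ℝ → ℝ → Prop) (b : Tier × ℕ) (x : Locs) (u : Marks) :
    p.servingInd R b x u = ind (∀ j m, (j, m) ≠ b →
      R (p.powerRatio j b.1 * p.loss x u (.access b.1 b.2)) (p.loss x u (.access j m))) := by
  unfold servingInd
  simp_rw [ite_ind, iprod_ind]
  rw [prod_tier, ← ind_and]
  congr 1
  refine propext ⟨fun h j => ?_, fun h => ⟨h .mbs, h .sbs⟩⟩
  cases j
  exacts [h.1, h.2]

lemma anchorInd_eq (R : ℝ → ℝ → Prop) (n k : ℕ) (x : Locs) (u : Marks) :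
    p.anchorInd R n k x u = ind (∀ m, m ≠ n →
      R (p.loss x u (.backhaul n k)) (p.loss x u (.backhaul m k))) := by
  unfold anchorInd
  simp_rw [ite_ind, iprod_ind]

lemma powerRatio_mul (i j : Tier) : p.powerRatio i j * p.powerRatio j i = 1 := by
  have h := fun i => (mul_pos (mul_pos (mul_pos (p.power_pos i) (p.bias_pos i))
    (p.refLoss_pos .access i)) (p.mainGain_pos i)).ne'
  unfold powerRatio
  rw [div_mul_div_comm, mul_comm, div_self (mul_ne_zero (h _) (h _))]

lemma servingInd_mono (b : Tier × ℕ) (x : Locs) (u : Marks) :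
    p.servingInd (· < ·) b x u ≤ p.servingInd (· ≤ ·) b x u := by
  rw [servingInd_eq, servingInd_eq]
  exact ind_mono fun h j m hm => (h j m hm).le

lemma anchorInd_mono (n k : ℕ) (x : Locs) (u : Marks) :
    p.anchorInd (· < ·) n k x u ≤ p.anchorInd (· ≤ ·) n k x u := by
  rw [anchorInd_eq, anchorInd_eq]
  exact ind_mono fun h m hm => (h m hm).le

/-- A strict winner beats every other station strictly. Since the two power ratios are reciprocal,
no other station can weakly beat it. -/
lemma eq_of_servingInd_lt {b b' : Tier × ℕ} {x : Locs} {u : Marks}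
    (h : p.servingInd (· < ·) b x u ≠ 0) (h' : p.servingInd (· ≤ ·) b' x u ≠ 0) : b = b' := by
  by_contra hne
  rw [servingInd_eq] at h h'
  have h1 := ind_ne_zero h b'.1 b'.2 (Ne.symm hne)
  have h2 := ind_ne_zero h' b.1 b.2 hne
  have h3 := mul_lt_mul_of_pos_left h1 (p.powerRatio_pos b.1 b'.1)
  rw [← mul_assoc, p.powerRatio_mul, one_mul] at h3
  exact absurd h2 (not_le.2 h3)

lemma eq_of_anchorInd_lt {n n' k : ℕ} {x : Locs} {u : Marks}
    (h : p.anchorInd (· < ·) n k x u ≠ 0) (h' : p.anchorInd (· ≤ ·) n' k x u ≠ 0) : n = n' := by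
  by_contra hne
  rw [anchorInd_eq] at h h'
  have h1 := ind_ne_zero h n' (Ne.symm hne)
  have h2 := ind_ne_zero h' n hne
  exact absurd h2 (not_le.2 h1)

end Params

namespace Network

variable {p : Params} {P : Measure Ω} (N : Network p P) {R : ℝ → ℝ → Prop}

lemma ae_fading_pos (e : Link) : ∀ᵐ ω ∂P, 0 < N.fading e ω := by
  have h : ∀ᵐ x ∂(expMeasure 1), 0 < x := by
    have h0 : MeasurableSet {x : ℝ | ¬ 0 < x} := measurableSet_Ioi.compl
    rw [ae_iff, ← lintegral_ind _ h0, lintegral_expMeasure]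
    rw [setLIntegral_congr_fun (g := fun _ => 0) measurableSet_Ioi fun x hx => ?_]
    · simp
    · rw [ind_false (by simpa using hx), mul_zero]
  rw [← N.fading_law e] at h
  exact ae_of_ae_map (N.fading_measurable e).aemeasurable h

/-- Mean number of base stations of tier `i` that serve the user above the threshold. -/
def servingIntegral (p : Params) (κ c : ℝ) (i : Tier) : ℝ≥0∞ :=
  ∫⁻ l in Ioi (0 : ℝ), expNeg (ENNReal.ofReal (κ * l)) * (∏ j, expNeg (p.levelE c i j l)) *
    ENNReal.ofReal (p.pathlossDensity i l)

/-- Mean number of pairs of a serving small cell base station and its anchor with both links above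
the thresholds. -/
def anchorIntegral (p : Params) (κ κ' c : ℝ) : ℝ≥0∞ :=
  ∑ t, ∫⁻ l in Ioi (0 : ℝ), expNeg (ENNReal.ofReal (κ * l)) *
    (∏ j, expNeg (p.levelE c .sbs j l)) * p.backhaulIntegral κ' t l *
      ENNReal.ofReal (p.pathlossDensityState .sbs t l)

/-- Indicator that `b` serves the user. -/
def servingAt (R : ℝ → ℝ → Prop) (b : Tier × ℕ) (ω : Ω) : ℝ≥0∞ :=
  p.servingInd R b (N.locs ω) (N.marks ω)

/-- Indicator that `n` is the anchor of `k`. -/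
def anchorAt (R : ℝ → ℝ → Prop) (n k : ℕ) (ω : Ω) : ℝ≥0∞ :=
  p.anchorInd R n k (N.locs ω) (N.marks ω)

/-- Indicator that the access link to `b` is above the threshold. -/
def coverAt (κ c : ℝ) (b : Tier × ℕ) (ω : Ω) : ℝ≥0∞ :=
  p.coverInd κ c b (N.locs ω) (N.marks ω) (N.gains ω) (N.lobes ω)

/-- Indicator that the backhaul link from `n` to `k` is above the threshold. -/
def backAt (κ : ℝ) (n k : ℕ) (ω : Ω) : ℝ≥0∞ :=
  ind (ENNReal.ofReal (κ * p.loss (N.locs ω) (N.marks ω) (.backhaul n k)) <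
    ENNReal.ofReal (N.gains ω (.backhaul n k)))

lemma measurable_servingAt (hR : IsCmp R) (b : Tier × ℕ) : Measurable (N.servingAt R b) :=
  (p.measurable_servingInd hR b).comp (f := fun ω => (N.locs ω, N.marks ω)) (by fun_prop)

lemma measurable_anchorAt (hR : IsCmp R) (n k : ℕ) : Measurable (N.anchorAt R n k) :=
  (p.measurable_anchorInd hR n k).comp (f := fun ω => (N.locs ω, N.marks ω)) (by fun_prop)

lemma measurable_coverAt (κ c : ℝ) (b : Tier × ℕ) : Measurable (N.coverAt κ c b) :=
  (p.measurable_coverInd κ c b).comp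
    (f := fun ω => (((N.locs ω, N.marks ω), N.gains ω), N.lobes ω)) (by fun_prop)

lemma measurable_backAt (κ : ℝ) (n k : ℕ) : Measurable (N.backAt κ n k) :=
  measurable_ind_lt (by fun_prop) (by fun_prop)

/-- Fading gains are almost surely positive, so zero thresholds are met automatically. Association
is thus the case κ = c = 0 of the coverage computation. -/
lemma coverAt_zero (b : Tier × ℕ) : ∀ᵐ ω ∂P, N.coverAt 0 0 b ω = 1 := by
  filter_upwards [N.ae_fading_pos (.access b.1 b.2)] with ω hω
  refine ind_true ?_
  simpa [Params.interf, gains] using hω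

lemma backAt_zero (n k : ℕ) : ∀ᵐ ω ∂P, N.backAt 0 n k ω = 1 := by
  filter_upwards [N.ae_fading_pos (.backhaul n k)] with ω hω
  refine ind_true ?_
  simpa [gains] using hω

variable [IsProbabilityMeasure P]

lemma tsum_lintegral_servingAt_cover (hR : IsCmp R) (κ : ℝ) {c : ℝ} (hc : 0 ≤ c) (i : Tier) :
    ∑' n, ∫⁻ ω, N.servingAt R (i, n) ω * N.coverAt κ c (i, n) ω ∂P =
      servingIntegral p κ c i := by
  rw [servingIntegral, ← N.lintegral_locs_serving hR κ hc i]
  refine tsum_congr fun n => ?_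
  have h := N.lintegral_coverInd κ c (i, n) 0 0 (p.measurable_servingInd hR (i, n))
    (t := fun _ _ => 0) measurable_const
  refine Eq.trans ?_ (h.trans ?_)
  · refine lintegral_congr_ae ?_
    filter_upwards [N.backAt_zero 0 0] with ω hω
    have : ind (0 < ENNReal.ofReal (N.gains ω (.backhaul 0 0))) = 1 := by
      simpa [backAt] using hω
    rw [this, mul_one]
    rfl
  · refine lintegral_congr fun ω => ?_
    simp_rw [expNeg_zero, mul_one]
    exact N.lintegral_marks_serving hR κ c (i, n) (N.locs ω)

lemma tsum_lintegral_anchorAt_cover (hR : IsCmp R) (κ κ' : ℝ) {c : ℝ} (hc : 0 ≤ c) :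
    ∑' k, ∑' n, ∫⁻ ω, N.servingAt R (.sbs, k) ω * N.anchorAt R n k ω *
        (N.coverAt κ c (.sbs, k) ω * N.backAt κ' n k ω) ∂P = anchorIntegral p κ κ' c := by
  rw [anchorIntegral, ← N.lintegral_locs_anchor hR κ κ' hc]
  refine tsum_congr fun k => tsum_congr fun n => ?_
  have h := N.lintegral_coverInd κ c (.sbs, k) n k
    (Φ := fun x u => p.servingInd R (.sbs, k) x u * p.anchorInd R n k x u)
    ((p.measurable_servingInd hR (.sbs, k)).mul (p.measurable_anchorInd hR n k))
    (t := fun x u => ENNReal.ofReal (κ' * p.loss x u (.backhaul n k)))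
    (by unfold Function.uncurry; fun_prop)
  refine Eq.trans rfl (h.trans ?_)
  exact lintegral_congr fun ω => N.lintegral_marks_anchor hR κ κ' c n k (N.locs ω)

lemma tsum_lintegral_servingAt (hR : IsCmp R) (i : Tier) :
    ∑' n, ∫⁻ ω, N.servingAt R (i, n) ω ∂P = servingIntegral p 0 0 i := by
  rw [← N.tsum_lintegral_servingAt_cover hR 0 le_rfl i]
  refine tsum_congr fun n => lintegral_congr_ae ?_
  filter_upwards [N.coverAt_zero (i, n)] with ω hω
  rw [hω, mul_one]

lemma tsum_lintegral_anchorAt (hR : IsCmp R) :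
    ∑' k, ∑' n, ∫⁻ ω, N.servingAt R (.sbs, k) ω * N.anchorAt R n k ω ∂P =
      anchorIntegral p 0 0 0 := by
  rw [← N.tsum_lintegral_anchorAt_cover hR 0 0 le_rfl]
  refine tsum_congr fun k => tsum_congr fun n => lintegral_congr_ae ?_
  filter_upwards [N.coverAt_zero (.sbs, k), N.backAt_zero n k] with ω hω hω'
  rw [hω, hω', mul_one, mul_one]

/-- Almost surely no base station ties with the serving one. -/
lemma ae_servingAt_lt_eq_le :
    ∀ᵐ ω ∂P, ∀ b, N.servingAt (· < ·) b ω = N.servingAt (· ≤ ·) b ω := by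
  have h : ∀ i, ∀ᵐ ω ∂P, ∀ n, N.servingAt (· < ·) (i, n) ω = N.servingAt (· ≤ ·) (i, n) ω := by
    intro i
    -- The mean numbers of strict and of weak winners are the same integral. It is finite because a
    -- strict winner is unique.
    refine ae_eq_of_tsum_lintegral (fun n => N.measurable_servingAt isCmp_le (i, n))
      (fun n ω => p.servingInd_mono _ _ _) ?_ ?_
    · rw [N.tsum_lintegral_servingAt isCmp_le, N.tsum_lintegral_servingAt isCmp_lt]
    · rw [← lintegral_tsum fun n => (N.measurable_servingAt isCmp_lt (i, n)).aemeasurable]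
      refine ((lintegral_mono (g := fun _ => 1) fun ω => tsum_le_one_of_unique (fun n => ?_)
        fun n n' h h' => ?_).trans_lt (by simp)).ne
      · rw [servingAt, Params.servingInd_eq]; exact ind_le_one _
      · have := p.eq_of_servingInd_lt h
          (ne_of_gt ((pos_iff_ne_zero.2 h').trans_le (p.servingInd_mono _ _ _)))
        simpa using this
  filter_upwards [h .mbs, h .sbs] with ω h1 h2
  rintro ⟨_ | _, n⟩
  exacts [h1 n, h2 n]

/-- Almost surely no macro base station ties with the anchor. -/
lemma ae_anchorAt_lt_eq_le : ∀ᵐ ω ∂P, ∀ k n,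
    N.servingAt (· < ·) (.sbs, k) ω * N.anchorAt (· < ·) n k ω =
      N.servingAt (· ≤ ·) (.sbs, k) ω * N.anchorAt (· ≤ ·) n k ω := by
  have hm : ∀ {R}, IsCmp R → ∀ z : ℕ × ℕ, Measurable fun ω =>
      N.servingAt R (.sbs, z.1) ω * N.anchorAt R z.2 z.1 ω := fun hR z =>
    (N.measurable_servingAt hR _).mul (N.measurable_anchorAt hR _ _)
  have h : ∀ᵐ ω ∂P, ∀ z : ℕ × ℕ,
      N.servingAt (· < ·) (.sbs, z.1) ω * N.anchorAt (· < ·) z.2 z.1 ω =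
        N.servingAt (· ≤ ·) (.sbs, z.1) ω * N.anchorAt (· ≤ ·) z.2 z.1 ω := by
    -- The same argument for pairs (small cell, anchor). The serving indicator is kept, since the
    -- mean was computed only on the event that the small cell serves.
    refine ae_eq_of_tsum_lintegral (hm isCmp_le)
      (fun z ω => mul_le_mul' (p.servingInd_mono _ _ _) (p.anchorInd_mono _ _ _ _)) ?_ ?_
    · rw [ENNReal.tsum_prod (f := fun k n => ∫⁻ ω, N.servingAt (· ≤ ·) (.sbs, k) ω *
          N.anchorAt (· ≤ ·) n k ω ∂P), ENNReal.tsum_prod (f := fun k n =>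
          ∫⁻ ω, N.servingAt (· < ·) (.sbs, k) ω * N.anchorAt (· < ·) n k ω ∂P),
        N.tsum_lintegral_anchorAt isCmp_le, N.tsum_lintegral_anchorAt isCmp_lt]
    · rw [← lintegral_tsum fun z => (hm isCmp_lt z).aemeasurable]
      refine ((lintegral_mono (g := fun _ => 1) fun ω => tsum_le_one_of_unique (fun z => ?_)
        fun z z' h h' => ?_).trans_lt (by simp)).ne
      · rw [servingAt, Params.servingInd_eq, anchorAt, Params.anchorInd_eq]
        exact mul_le_one' (ind_le_one _) (ind_le_one _)
      · have hk := p.eq_of_servingInd_lt (left_ne_zero_of_mul h)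
          (ne_of_gt ((pos_iff_ne_zero.2 (left_ne_zero_of_mul h')).trans_le
            (p.servingInd_mono _ _ _)))
        have hk' : z.1 = z'.1 := by simpa using hk
        have h2 := right_ne_zero_of_mul h'
        rw [← hk'] at h2
        have hn := p.eq_of_anchorInd_lt (right_ne_zero_of_mul h)
          (ne_of_gt ((pos_iff_ne_zero.2 h2).trans_le (p.anchorInd_mono _ _ _ _)))
        exact Prod.ext hk' hn
  filter_upwards [h] with ω hω k n
  exact hω (k, n)

end Network

end IAB

/-! ### Identification of the serving station and of its anchor -/

namespace IAB

open Filter Topology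

variable {Ω : Type*} [MeasurableSpace Ω]

namespace Params

variable (p : Params)

lemma linkLoss_pos (k : LinkType) (i : Tier) (u : ℝ) {r : ℝ} (hr : 0 < r) :
    0 < p.linkLoss k i u r := Real.rpow_pos_of_pos hr _

lemma loss_nonneg (x : Locs) (u : Marks) (e : Link) : 0 ≤ p.loss x u e := by
  cases e <;> exact Real.rpow_nonneg (norm_nonneg _) _

lemma le_of_linkLoss_le {k : LinkType} {i : Tier} {u r l : ℝ} (hr : 0 ≤ r) (hl : 0 ≤ l)
    (h : p.linkLoss k i u r ≤ l) :
    r ≤ max (l ^ (1 / p.pathlossExp k i .los)) (l ^ (1 / p.pathlossExp k i .nlos)) := by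
  rw [linkLoss_eq] at h
  split_ifs at h
  · exact le_max_of_le_left ((rpow_le_iff_le (p.pathlossExp_pos _ _ _) hr hl).1 h)
  · exact le_max_of_le_right ((rpow_le_iff_le (p.pathlossExp_pos _ _ _) hr hl).1 h)

/-- Biased power of the base stations of each tier, as used for the association. -/
def biasedPower (i : Tier) : ℝ :=
  p.power i * p.bias i * p.refLoss .access i * p.mainGain i * p.ueMainGain

/-- Received signal power over an access link with unit fading and pathloss. -/
def signal (i : Tier) : ℝ := p.power i * p.mainGain i * p.ueMainGain * p.refLoss .access i

/-- Received signal power over a backhaul link with unit fading and pathloss. -/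
def backSignal : ℝ :=
  p.power .mbs * p.mainGain .mbs * p.mainGain .sbs * p.refLoss .backhaul .mbs

lemma biasedPower_pos (i : Tier) : 0 < p.biasedPower i :=
  mul_pos (mul_pos (mul_pos (mul_pos (p.power_pos i) (p.bias_pos i)) (p.refLoss_pos _ i))
    (p.mainGain_pos i)) p.ueMainGain_pos

lemma signal_pos (i : Tier) : 0 < p.signal i :=
  mul_pos (mul_pos (mul_pos (p.power_pos i) (p.mainGain_pos i)) p.ueMainGain_pos)
    (p.refLoss_pos _ i)

lemma backSignal_pos : 0 < p.backSignal :=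
  mul_pos (mul_pos (mul_pos (p.power_pos _) (p.mainGain_pos _)) (p.mainGain_pos _))
    (p.refLoss_pos _ _)

lemma noise_pos : 0 < p.noise := mul_pos p.noiseDensity_pos p.bandwidth_pos

lemma powerRatio_eq (i j : Tier) : p.powerRatio j i = p.biasedPower j / p.biasedPower i := by
  rw [powerRatio, biasedPower, biasedPower, mul_div_mul_right _ _ p.ueMainGain_pos.ne']

lemma biasedPower_le_iff (i j : Tier) {a b : ℝ} (ha : 0 < a) (hb : 0 < b) :
    p.biasedPower j * b⁻¹ ≤ p.biasedPower i * a⁻¹ ↔ p.powerRatio j i * a ≤ b := by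
  have h1 := p.biasedPower_pos i
  rw [powerRatio_eq, ← div_eq_mul_inv, ← div_eq_mul_inv, div_le_div_iff₀ hb ha, div_mul_eq_mul_div,
    div_le_iff₀ h1, mul_comm (p.biasedPower i)]

end Params

namespace Network

variable {p : Params} {P : Measure Ω} (N : Network p P)

/-- No base station is at the origin or at the location of one of the other tier, and there are
finitely many base stations in each disk. -/
def Regular (ω : Ω) : Prop :=
  (∀ i n, N.loc i n ω ≠ 0) ∧ (∀ n k, N.loc .mbs n ω ≠ N.loc .sbs k ω) ∧
    ∀ (i : Tier) (r : ℝ), {n | ‖N.loc i n ω‖ ≤ r}.Finite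

variable {N} {ω : Ω}

/-- The association maximizes L⁻¹ and 0⁻¹ = 0, so comparing inverses matches comparing pathlosses
only when these are positive. -/
lemma Regular.loss_pos (h : N.Regular ω) (e : Link) : 0 < p.loss (N.locs ω) (N.marks ω) e := by
  cases e with
  | access i n => exact p.linkLoss_pos _ _ _ (norm_pos_iff.2 (h.1 i n))
  | backhaul n k => exact p.linkLoss_pos _ _ _ (norm_pos_iff.2 (sub_ne_zero.2 (h.2.1 n k)))

lemma Regular.finite_access (h : N.Regular ω) (i : Tier) {l : ℝ} (hl : 0 ≤ l) :
    {n | p.loss (N.locs ω) (N.marks ω) (.access i n) ≤ l}.Finite :=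
  (h.2.2 i _).subset fun _ hn => p.le_of_linkLoss_le (norm_nonneg _) hl hn

lemma Regular.finite_backhaul (h : N.Regular ω) (k : ℕ) {l : ℝ} (hl : 0 ≤ l) :
    {n | p.loss (N.locs ω) (N.marks ω) (.backhaul n k) ≤ l}.Finite := by
  refine (h.2.2 .mbs (max (l ^ (1 / p.pathlossExp .backhaul .mbs .los))
    (l ^ (1 / p.pathlossExp .backhaul .mbs .nlos)) + ‖N.loc .sbs k ω‖)).subset fun n hn => ?_
  have h1 := p.le_of_linkLoss_le (norm_nonneg _) hl hn
  have h2 := norm_sub_norm_le (N.loc .mbs n ω) (N.loc .sbs k ω)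
  change ‖N.loc .mbs n ω - N.loc .sbs k ω‖ ≤ _ at h1
  change ‖N.loc .mbs n ω‖ ≤ _
  linarith

/-- Stations at least as good as a given one have bounded pathloss, hence are finitely many, and a
maximizer exists. The chosen one might be tied, so only the weak comparison is available here. -/
lemma Regular.servingAt_serving (h : N.Regular ω) : N.servingAt (· ≤ ·) (N.serving ω) ω = 1 := by
  have hA := h.loss_pos
  have hserv : N.serving ω = argmax fun b : Tier × ℕ =>
      p.biasedPower b.1 * (p.loss (N.locs ω) (N.marks ω) (.access b.1 b.2))⁻¹ := by
    unfold serving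
    simp_rw [pathloss_eq]
    rfl
  have hspec := argmax_spec (f := fun b : Tier × ℕ =>
    p.biasedPower b.1 * (p.loss (N.locs ω) (N.marks ω) (.access b.1 b.2))⁻¹)
    (exists_max_of_finite fun b₀ => by
      set v := p.biasedPower b₀.1 * (p.loss (N.locs ω) (N.marks ω) (.access b₀.1 b₀.2))⁻¹
      have hv : 0 < v := mul_pos (p.biasedPower_pos _) (inv_pos.2 (hA _))
      refine (Set.finite_iUnion fun i : Tier => (h.finite_access i
        (l := p.biasedPower i / v) (div_nonneg (p.biasedPower_pos i).le hv.le)).image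
          (Prod.mk i)).subset fun b hb => ?_
      refine mem_iUnion.2 ⟨b.1, b.2, ?_, rfl⟩
      have hb' : v ≤ p.biasedPower b.1 *
        (p.loss (N.locs ω) (N.marks ω) (.access b.1 b.2))⁻¹ := hb
      change p.loss (N.locs ω) (N.marks ω) (.access b.1 b.2) ≤ _
      rw [← div_eq_mul_inv, le_div_iff₀ (hA _)] at hb'
      rwa [le_div_iff₀ hv, mul_comm])
  rw [← hserv] at hspec
  rw [servingAt, Params.servingInd_eq]
  exact ind_true fun j m _ =>
    (p.biasedPower_le_iff (N.serving ω).1 j (hA _) (hA _)).1 (hspec (j, m))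

lemma Regular.anchorAt_anchor (h : N.Regular ω) :
    N.anchorAt (· ≤ ·) (N.anchor ω) (N.serving ω).2 ω = 1 := by
  have hA := h.loss_pos
  set k := (N.serving ω).2
  set C := p.power .mbs * p.refLoss .backhaul .mbs * p.mainGain .mbs * p.mainGain .sbs with hC
  have hC0 : 0 < C := mul_pos (mul_pos (mul_pos (p.power_pos _) (p.refLoss_pos _ _))
    (p.mainGain_pos _)) (p.mainGain_pos _)
  have hanch : N.anchor ω = argmax fun n : ℕ =>
      C * (p.loss (N.locs ω) (N.marks ω) (.backhaul n k))⁻¹ := by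
    unfold anchor
    simp_rw [pathloss_eq]
    rfl
  have hiff : ∀ m n, C * (p.loss (N.locs ω) (N.marks ω) (.backhaul m k))⁻¹ ≤
      C * (p.loss (N.locs ω) (N.marks ω) (.backhaul n k))⁻¹ ↔
      p.loss (N.locs ω) (N.marks ω) (.backhaul n k) ≤
        p.loss (N.locs ω) (N.marks ω) (.backhaul m k) := fun m n => by
    rw [mul_le_mul_iff_right₀ hC0, inv_le_inv₀ (hA _) (hA _)]
  have hspec := argmax_spec (f := fun n : ℕ =>
    C * (p.loss (N.locs ω) (N.marks ω) (.backhaul n k))⁻¹)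
    (exists_max_of_finite fun n₀ =>
      (h.finite_backhaul k (hA (.backhaul n₀ k)).le).subset fun n hn => (hiff _ _).1 hn)
  rw [← hanch] at hspec
  rw [anchorAt, Params.anchorInd_eq]
  exact ind_true fun m _ => (hiff _ _).1 (hspec m)

/-- With A the pathloss and S the signal power at unit loss and fading, multiplying τ(I + noise) <
signal by A/S isolates the serving gain. Noise and interference become the normalized quantities of
`coverInd`. -/
lemma Regular.ind_sinrAccess (h : N.Regular ω) {τ : ℝ} (hτ : 0 < τ) :
    ind (ENNReal.ofReal τ < N.sinrAccess ω) =
      N.coverAt (τ * p.noise / p.signal (N.serving ω).1)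
        (τ * p.power .sbs * p.refLoss .access .sbs / p.signal (N.serving ω).1)
        (N.serving ω) ω := by
  have hA := h.loss_pos
  unfold sinrAccess coverAt Params.coverInd
  simp only
  set b := N.serving ω with hb
  set A := p.loss (N.locs ω) (N.marks ω) (.access b.1 b.2) with hAdef
  have hA0 : 0 < A := hA _
  have hS := p.signal_pos b.1
  have hn := p.noise_pos
  set S := p.signal b.1 with hSdef
  have hr : 0 < A / S := by positivity
  have hr0 : ENNReal.ofReal (A / S) ≠ 0 := by simpa using hr
  have hnum : ENNReal.ofReal (p.power b.1 * p.mainGain b.1 * p.ueMainGain * p.refLoss .access b.1 *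
      N.fading (.access b.1 b.2) ω * (N.pathloss ω (.access b.1 b.2))⁻¹) =
      (ENNReal.ofReal (A / S))⁻¹ * ENNReal.ofReal (N.fading (.access b.1 b.2) ω) := by
    rw [← ENNReal.ofReal_inv_of_pos hr, ← ENNReal.ofReal_mul (by positivity), pathloss_eq, inv_div]
    congr 1
    change S * _ * A⁻¹ = _
    ring
  have hI : ENNReal.ofReal (A / S) * (ENNReal.ofReal τ *
      (N.interference ω + ENNReal.ofReal p.noise)) =
      ENNReal.ofReal (τ * p.noise / S * A) + p.interf
        (τ * p.power .sbs * p.refLoss .access .sbs / S) b (N.locs ω) (N.marks ω) (N.gains ω)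
        (N.lobes ω) := by
    rw [← mul_assoc, ← ENNReal.ofReal_mul hr.le, mul_add, add_comm,
      ← ENNReal.ofReal_mul (p := A / S * τ) (by positivity), interference,
      ← ENNReal.tsum_mul_left, Params.interf]
    congr 1
    · congr 1; ring
    · refine tsum_congr fun m => ?_
      rw [← hb]
      split_ifs with hm
      · simp
      · have h1 : 0 ≤ p.loss (N.locs ω) (N.marks ω) (.access .sbs m) := p.loss_nonneg _ _ _
        have h2 := p.lobeGain_nonneg (N.lobe m ω)
        have h3 := p.power_pos .sbs
        have h4 := p.refLoss_pos .access .sbs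
        rw [← ENNReal.ofReal_mul (by positivity), ← ENNReal.ofReal_mul (by
          change 0 ≤ _ * p.lobeGain (N.lobe m ω) * A / _; positivity), pathloss_eq]
        congr 1
        change _ = _ * p.lobeGain (N.lobe m ω) * A / _ * N.fading _ ω
        rw [div_eq_mul_inv _ (p.loss _ _ _)]
        ring
  -- The positive noise keeps the denominator nonzero, and τ > 0 covers an infinite denominator.
  rw [ENNReal.lt_div_iff_mul_lt (Or.inl (by simp [hn])) (Or.inr (by simp [hτ])), hnum, ← hI]
  congr 1
  refine propext ?_
  have hm := ENNReal.mul_lt_mul_iff_right (a := ENNReal.ofReal (A / S)) hr0 ENNReal.ofReal_ne_top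
    (b := ENNReal.ofReal τ * (N.interference ω + ENNReal.ofReal p.noise))
    (c := (ENNReal.ofReal (A / S))⁻¹ * ENNReal.ofReal (N.fading (.access b.1 b.2) ω))
  rw [← hm, ← mul_assoc (ENNReal.ofReal (A / S)) (ENNReal.ofReal (A / S))⁻¹,
    ENNReal.mul_inv_cancel hr0 ENNReal.ofReal_ne_top, one_mul]
  rfl

lemma Regular.ind_snrBackhaul (h : N.Regular ω) {τ : ℝ} (hτ : 0 < τ) :
    ind (ENNReal.ofReal τ < N.snrBackhaul ω) =
      N.backAt (τ * p.noise / p.backSignal) (N.anchor ω) (N.serving ω).2 ω := by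
  have hA := h.loss_pos (.backhaul (N.anchor ω) (N.serving ω).2)
  unfold snrBackhaul backAt
  simp only
  set A := p.loss (N.locs ω) (N.marks ω) (.backhaul (N.anchor ω) (N.serving ω).2) with hAdef
  have hS := p.backSignal_pos
  have hn := p.noise_pos
  rw [ENNReal.lt_div_iff_mul_lt (Or.inl (by simp [hn])) (Or.inr (by simp [hτ])),
    ← ENNReal.ofReal_mul hτ.le, pathloss_eq]
  congr 1
  refine propext ?_
  rw [ENNReal.ofReal_lt_ofReal_iff_of_nonneg (by positivity),
    ENNReal.ofReal_lt_ofReal_iff_of_nonneg (by positivity)]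
  change _ < p.backSignal * N.fading _ ω * A⁻¹ ↔ _ < N.fading _ ω
  rw [← div_eq_mul_inv, lt_div_iff₀ hA, div_mul_eq_mul_div, div_lt_iff₀ hS,
    mul_comm p.backSignal]

variable (N)

variable [IsProbabilityMeasure P]

/-- A single point has volume 0, so the number of stations there is Poisson of mean 0. -/
lemma ae_loc_ne (i : Tier) (n : ℕ) (y : Plane) : ∀ᵐ ω ∂P, N.loc i n ω ≠ y := by
  have hB : MeasurableSet ({y} : Set Plane) := measurableSet_singleton y
  have hlaw := (N.poisson i).law {y} hB (by simp) 0
  have hm : MeasurableSet {ω | countingMeasure (N.loc i) ω {y} = (0 : ℕ)} :=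
    (N.poisson i).measurable_count hB (measurableSet_singleton _)
  have hae : ∀ᵐ ω ∂P, countingMeasure (N.loc i) ω {y} = (0 : ℕ) := by
    rw [ae_iff, ← Set.compl_ofPred, prob_compl_eq_zero_iff hm, hlaw]
    simp
  filter_upwards [hae] with ω hω hn
  rw [countingMeasure_apply _ _ hB, Nat.cast_zero, ENNReal.tsum_eq_zero] at hω
  have := hω n
  rw [ind_true (by simpa using hn)] at this
  exact one_ne_zero this

/-- By independence the macro location may be frozen, which reduces to `ae_loc_ne`. -/
lemma ae_mbs_ne_sbs (n k : ℕ) : ∀ᵐ ω ∂P, N.loc .mbs n ω ≠ N.loc .sbs k ω := by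
  have hms : MeasurableSet {z : (ℕ → Plane) × (ℕ → Plane) | z.1 n = z.2 k} :=
    measurableSet_eq_fun (by fun_prop) (by fun_prop)
  have h := lintegral_comp_indepFun (N.measurable_locSeq .mbs) (N.measurable_locSeq .sbs)
    N.indep_loc (f := fun a b => ind (a n = b k)) (measurable_ind hms)
  have hml := N.measurable_loc
  rw [lintegral_ind _ (measurableSet_eq_fun (hml .mbs n) (hml .sbs k))] at h
  rw [ae_iff]
  simp only [ne_eq, not_not]
  rw [h]
  refine (lintegral_congr fun ω => ?_).trans lintegral_zero
  rw [lintegral_ind _ (measurableSet_eq_fun measurable_const (hml .sbs k))]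
  have := ae_iff.1 (N.ae_loc_ne .sbs k (N.loc .mbs n ω))
  simp only [ne_eq, not_not] at this
  simpa [eq_comm] using this

lemma ae_regular : ∀ᵐ ω ∂P, N.Regular ω := by
  have hfin : ∀ᵐ ω ∂P, ∀ (z : Tier × ℕ), ∃ k : ℕ,
      countingMeasure (N.loc z.1) ω (Metric.closedBall 0 (z.2 : ℝ)) = k :=
    ae_all_iff.2 fun z => (N.poisson z.1).ae_count (p.density_pos z.1).le
      Metric.isClosed_closedBall.measurableSet measure_closedBall_lt_top.ne
  have h0 : ∀ᵐ ω ∂P, ∀ z : Tier × ℕ, N.loc z.1 z.2 ω ≠ 0 :=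
    ae_all_iff.2 fun z => N.ae_loc_ne z.1 z.2 0
  have h1 : ∀ᵐ ω ∂P, ∀ z : ℕ × ℕ, N.loc .mbs z.1 ω ≠ N.loc .sbs z.2 ω :=
    ae_all_iff.2 fun z => N.ae_mbs_ne_sbs z.1 z.2
  filter_upwards [hfin, h0, h1] with ω hω h0 h1
  refine ⟨fun i n => h0 (i, n), fun n k => h1 (n, k), fun i r => ?_⟩
  obtain ⟨j, hj⟩ := exists_nat_ge r
  obtain ⟨k, hk⟩ := hω (i, j)
  refine (finite_of_countingMeasure_ne_top (N.loc i) ω (B := Metric.closedBall 0 (j : ℝ))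
    Metric.isClosed_closedBall.measurableSet (by rw [hk]; simp)).subset fun n hn => ?_
  exact mem_closedBall_zero_iff.2 (le_trans hn hj)

/-- The serving station is a weak winner, hence a strict one in the absence of ties, and every weak
winner coincides with a strict one. -/
lemma ae_servingAt_eq : ∀ᵐ ω ∂P, ∀ b, N.servingAt (· ≤ ·) b ω = ind (N.serving ω = b) := by
  filter_upwards [N.ae_regular, N.ae_servingAt_lt_eq_le] with ω hω hlt b
  by_cases hb : N.serving ω = b
  · rw [ind_true hb, ← hb, hω.servingAt_serving]
  · rw [ind_false hb]
    by_contra hne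
    refine hb (p.eq_of_servingInd_lt (x := N.locs ω) (u := N.marks ω) ?_ hne)
    have := hlt (N.serving ω)
    rw [hω.servingAt_serving] at this
    exact ne_of_eq_of_ne this one_ne_zero

lemma ae_anchorAt_eq : ∀ᵐ ω ∂P, ∀ k n,
    N.servingAt (· ≤ ·) (.sbs, k) ω * N.anchorAt (· ≤ ·) n k ω =
      ind (N.serving ω = (.sbs, k) ∧ N.anchor ω = n) := by
  filter_upwards [N.ae_regular, N.ae_servingAt_eq, N.ae_servingAt_lt_eq_le,
    N.ae_anchorAt_lt_eq_le] with ω hω hs hslt hlt k n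
  rw [hs, ind_and]
  by_cases hk : N.serving ω = (.sbs, k)
  · rw [ind_true hk, one_mul, one_mul]
    have h2 : (N.serving ω).2 = k := by rw [hk]
    have hanch := hω.anchorAt_anchor
    rw [h2] at hanch
    by_cases hn : N.anchor ω = n
    · rw [ind_true hn, ← hn, hanch]
    · rw [ind_false hn]
      by_contra hne
      refine hn (p.eq_of_anchorInd_lt (x := N.locs ω) (u := N.marks ω) (k := k) ?_ hne)
      have := hlt k (N.anchor ω)
      rw [hslt, hs, ind_true hk, one_mul, one_mul, hanch] at this
      exact ne_of_eq_of_ne this one_ne_zero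
  · rw [ind_false hk, zero_mul, zero_mul]

lemma tsum_ind_serving (i : Tier) (b : Tier × ℕ) (g : ℕ → ℝ≥0∞) :
    ∑' n, ind (b = (i, n)) * g n = ind (b.1 = i) * g b.2 := by
  obtain ⟨j, m⟩ := b
  by_cases hi : j = i
  · subst hi
    simp only [Prod.mk.injEq, true_and, ind_true trivial, one_mul]
    exact tsum_ind_eq m g
  · simp [hi, ind]

lemma ae_servedBy_ind (i : Tier) : ∀ᵐ ω ∂P,
    ind (ω ∈ N.servedBy i) = ∑' n, N.servingAt (· ≤ ·) (i, n) ω := by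
  filter_upwards [N.ae_servingAt_eq] with ω hω
  have := tsum_ind_serving i (N.serving ω) fun _ => 1
  simp only [mul_one] at this
  simp_rw [hω, this]
  rfl

lemma ae_coverage_ind (i : Tier) {τ : ℝ} (hτ : 0 < τ) : ∀ᵐ ω ∂P,
    ind (ENNReal.ofReal τ < N.sinrAccess ω ∧ ω ∈ N.servedBy i) =
      ∑' n, N.servingAt (· ≤ ·) (i, n) ω * N.coverAt (τ * p.noise / p.signal i)
        (τ * p.power .sbs * p.refLoss .access .sbs / p.signal i) (i, n) ω := by
  filter_upwards [N.ae_servingAt_eq, N.ae_regular] with ω hω hreg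
  simp_rw [hω, tsum_ind_serving i (N.serving ω), ind_and, hreg.ind_sinrAccess hτ]
  by_cases hi : (N.serving ω).1 = i
  · subst hi
    rw [mul_comm]
    rfl
  · rw [ind_false hi, zero_mul, ind_false (q := ω ∈ N.servedBy i) hi, mul_zero]

lemma ae_joint_coverage_ind {τ₁ τ₂ : ℝ} (hτ₁ : 0 < τ₁) (hτ₂ : 0 < τ₂) : ∀ᵐ ω ∂P,
    ind ((ENNReal.ofReal τ₁ < N.sinrAccess ω ∧ ENNReal.ofReal τ₂ < N.snrBackhaul ω) ∧
        ω ∈ N.servedBy .sbs) =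
      ∑' k, ∑' n, N.servingAt (· ≤ ·) (.sbs, k) ω * N.anchorAt (· ≤ ·) n k ω *
        (N.coverAt (τ₁ * p.noise / p.signal .sbs)
          (τ₁ * p.power .sbs * p.refLoss .access .sbs / p.signal .sbs) (.sbs, k) ω *
        N.backAt (τ₂ * p.noise / p.backSignal) n k ω) := by
  filter_upwards [N.ae_anchorAt_eq, N.ae_regular] with ω hω hreg
  simp_rw [hω, ind_and]
  have hre : ∀ a b c d : ℝ≥0∞, a * b * (c * d) = a * (b * (c * d)) := by intros; ring
  simp_rw [hre, ENNReal.tsum_mul_left, tsum_ind_eq]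
  rw [tsum_ind_serving .sbs (N.serving ω) fun k => N.coverAt (τ₁ * p.noise / p.signal .sbs)
      (τ₁ * p.power .sbs * p.refLoss .access .sbs / p.signal .sbs) (.sbs, k) ω *
        N.backAt (τ₂ * p.noise / p.backSignal) (N.anchor ω) k ω, hreg.ind_sinrAccess hτ₁, hreg.ind_snrBackhaul hτ₂]
  by_cases hi : (N.serving ω).1 = .sbs
  · have hb : N.serving ω = (.sbs, (N.serving ω).2) := Prod.ext hi rfl
    rw [ind_true hi, ind_true (q := ω ∈ N.servedBy .sbs) hi, one_mul, mul_one, ← hb, hi]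
  · rw [ind_false hi, zero_mul, ind_false (q := ω ∈ N.servedBy .sbs) hi, mul_zero]

lemma measure_servedBy (i : Tier) :
    NullMeasurableSet (N.servedBy i) P ∧ P (N.servedBy i) = servingIntegral p 0 0 i := by
  have hm := fun n => N.measurable_servingAt isCmp_le (i, n)
  obtain ⟨h1, h2⟩ := measure_eq_lintegral_of_ind_ae (Measurable.tsum hm) (N.ae_servedBy_ind i)
  rw [lintegral_tsum fun n => (hm n).aemeasurable, N.tsum_lintegral_servingAt isCmp_le] at h2
  exact ⟨h1, h2⟩

/-- Null measurability of the conditioning event is enough to evaluate the restricted measure on an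
arbitrary set. -/
lemma cond_servedBy (i : Tier) (q : Ω → Prop) :
    P[{ω | q ω} | N.servedBy i] =
      (P (N.servedBy i))⁻¹ * P {ω | q ω ∧ ω ∈ N.servedBy i} := by
  rw [ProbabilityTheory.cond, Measure.smul_apply, smul_eq_mul,
    Measure.restrict_apply₀' (N.measure_servedBy i).1]
  rfl

lemma measure_coverage (i : Tier) {τ : ℝ} (hτ : 0 < τ) :
    P {ω | ENNReal.ofReal τ < N.sinrAccess ω ∧ ω ∈ N.servedBy i} =
      servingIntegral p (τ * p.noise / p.signal i)
        (τ * p.power .sbs * p.refLoss .access .sbs / p.signal i) i := by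
  have hm := fun n => (N.measurable_servingAt isCmp_le (i, n)).mul
    (N.measurable_coverAt (τ * p.noise / p.signal i)
      (τ * p.power .sbs * p.refLoss .access .sbs / p.signal i) (i, n))
  have hc : 0 ≤ τ * p.power .sbs * p.refLoss .access .sbs / p.signal i := by
    have h1 := p.signal_pos i
    have h2 := p.power_pos .sbs
    have h3 := p.refLoss_pos .access .sbs
    positivity
  rw [(measure_eq_lintegral_of_ind_ae (Measurable.tsum hm) (N.ae_coverage_ind i hτ)).2,
    ← N.tsum_lintegral_servingAt_cover isCmp_le _ hc i]
  exact lintegral_tsum fun n => (hm n).aemeasurable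

lemma measure_joint_coverage {τ₁ τ₂ : ℝ} (hτ₁ : 0 < τ₁) (hτ₂ : 0 < τ₂) :
    P {ω | (ENNReal.ofReal τ₁ < N.sinrAccess ω ∧ ENNReal.ofReal τ₂ < N.snrBackhaul ω) ∧
        ω ∈ N.servedBy .sbs} =
      anchorIntegral p (τ₁ * p.noise / p.signal .sbs) (τ₂ * p.noise / p.backSignal)
        (τ₁ * p.power .sbs * p.refLoss .access .sbs / p.signal .sbs) := by
  have hm := fun k n => ((N.measurable_servingAt isCmp_le (.sbs, k)).mul
    (N.measurable_anchorAt isCmp_le n k)).mul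
    ((N.measurable_coverAt (τ₁ * p.noise / p.signal .sbs)
      (τ₁ * p.power .sbs * p.refLoss .access .sbs / p.signal .sbs) (.sbs, k)).mul
      (N.measurable_backAt (τ₂ * p.noise / p.backSignal) n k))
  have hc : 0 ≤ τ₁ * p.power .sbs * p.refLoss .access .sbs / p.signal .sbs := by
    have h1 := p.signal_pos .sbs
    have h2 := p.power_pos .sbs
    have h3 := p.refLoss_pos .access .sbs
    positivity
  rw [(measure_eq_lintegral_of_ind_ae (Measurable.tsum fun k => Measurable.tsum (hm k))
    (N.ae_joint_coverage_ind hτ₁ hτ₂)).2, ← N.tsum_lintegral_anchorAt_cover isCmp_le _ _ hc]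
  refine (lintegral_tsum fun k => (Measurable.tsum (hm k)).aemeasurable).trans ?_
  exact tsum_congr fun k => lintegral_tsum fun n => (hm k n).aemeasurable

end Network

end IAB

/-! ### Matching with the stated formulas -/

namespace IAB

open Filter Topology

/-- The first exponent may be ∞, but the second is a real number, so the subtraction never meets an
indeterminate form. -/
lemma exp_neg_sub_eq (a : ℝ≥0∞) {r : ℝ} (hr : 0 ≤ r) :
    EReal.exp (-(a : EReal) - (r : EReal)) = expNeg (a + ENNReal.ofReal r) := by
  rw [expNeg, EReal.coe_ennreal_add, EReal.coe_ennreal_ofReal, max_eq_left hr,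
    EReal.neg_add (by simp) (by simp)]

namespace Params

variable (p : Params)

lemma pathlossMeasure_nonneg (j i : Tier) {l : ℝ} (hl : 0 ≤ l) :
    0 ≤ p.pathlossMeasure j (p.powerRatio j i * l) :=
  (p.pathlossMeasure_spec j (mul_nonneg (p.powerRatio_pos j i).le hl)).1

lemma assocExponent_nonneg (i : Tier) {l : ℝ} (hl : 0 ≤ l) : 0 ≤ p.assocExponent i l :=
  Finset.sum_nonneg fun j _ => p.pathlossMeasure_nonneg j i hl

/-- Exponent contributed by the interference when the user is served by tier `i`. -/
def interfExponent (c : ℝ) (i : Tier) (l : ℝ) : ℝ≥0∞ :=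
  ∑ d : Bool × Bool, ∫⁻ z in Ioi (p.powerRatio .sbs i * l),
    ENNReal.ofReal ((1 - 1 / (1 + c * p.lobeGain d * l / z)) * p.lobeProb d *
      p.pathlossDensity .sbs z)

lemma prod_expNeg_levelE {c : ℝ} (hc : 0 ≤ c) (i : Tier) {l : ℝ} (hl : 0 ≤ l) :
    ∏ j, expNeg (p.levelE c i j l) =
      expNeg (p.interfExponent c i l + ENNReal.ofReal (p.assocExponent i l)) := by
  rw [prod_tier, p.levelE_mbs c i hl, p.levelE_sbs hc i hl, ← expNeg_add, assocExponent, sum_tier,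
    ENNReal.ofReal_add (p.pathlossMeasure_nonneg _ i hl) (p.pathlossMeasure_nonneg _ i hl),
    interfExponent]
  congr 1
  ring

lemma interfExponent_zero (i : Tier) (l : ℝ) : p.interfExponent 0 i l = 0 := by
  simp [interfExponent]

lemma assocProb_eq (i : Tier) : p.assocProb i = Network.servingIntegral p 0 0 i := by
  unfold assocProb Network.servingIntegral
  refine setLIntegral_congr_fun measurableSet_Ioi fun l hl => ?_
  have hl0 : 0 ≤ l := le_of_lt hl
  rw [p.prod_expNeg_levelE le_rfl i hl0, interfExponent_zero, zero_add, zero_mul,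
    ENNReal.ofReal_zero, expNeg_zero, one_mul, expNeg_ofReal (p.assocExponent_nonneg i hl0),
    ENNReal.ofReal_mul (Real.exp_pos _).le]

lemma pathlossDensity_pos (i : Tier) {l : ℝ} (hl : 0 < l) : 0 < p.pathlossDensity i l := by
  refine add_pos_of_pos_of_nonneg ?_ (p.pathlossDensityState_nonneg i .nlos hl.le)
  rw [pathlossDensityState_eq]
  have h1 := p.density_pos i
  have h2 := p.pathlossExp_pos .access i .los
  have h3 : 0 < p.stateProb .los (l ^ (1 / p.pathlossExp .access i .los)) := Real.exp_pos _
  have h4 := Real.pi_pos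
  positivity

lemma measurable_assocExponent (i : Tier) : Measurable (p.assocExponent i) := by
  unfold assocExponent pathlossMeasure
  fun_prop

/-- The integrand is positive on all of (0, ∞), already through the LOS part of the density. -/
lemma assocProb_pos (i : Tier) : 0 < p.assocProb i := by
  have h1 := p.measurable_assocExponent i
  have h2 := p.measurable_pathlossDensity i
  unfold assocProb
  rw [lintegral_pos_iff_support (by fun_prop)]
  refine lt_of_lt_of_le ?_ (measure_mono (s := Ioi 0) fun l hl => ?_)
  · rw [Measure.restrict_apply_self]; simp
  · have := p.pathlossDensity_pos i hl
    simp only [Function.mem_support, ne_eq, ENNReal.ofReal_eq_zero, not_le]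
    positivity

lemma powerRatio_self (i : Tier) : p.powerRatio i i = 1 := by
  rw [powerRatio_eq, div_self (p.biasedPower_pos i).ne']

end Params

end IAB

end

theorem mainTheorem2 {Ω : Type*} [MeasurableSpace Ω] (P : Measure Ω) [IsProbabilityMeasure P]
    (p : IAB.Params) (N : IAB.Network p P) :
    (∀ i : IAB.Tier, P (N.servedBy i) = p.assocProb i ∧ 0 < p.assocProb i) ∧
    (∀ τ : ℝ, 0 < τ →
      P[{ω | ENNReal.ofReal τ < N.sinrAccess ω} | N.servedBy .mbs] =
        (p.assocProb .mbs)⁻¹ * ∫⁻ l in Ioi (0 : ℝ),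
          EReal.exp (
            -((∑ d : Bool × Bool, ∫⁻ z in Ioi (p.powerRatio .sbs .mbs * l),
                ENNReal.ofReal ((1 - 1 / (1 +
                  τ * p.power .sbs * p.refLoss .access .sbs * p.lobeGain d * l /
                    (p.power .mbs * p.refLoss .access .mbs * p.mainGain .mbs * p.ueMainGain * z)))
                  * p.lobeProb d * p.pathlossDensity .sbs z) : ℝ≥0∞) : EReal)
            - ((τ * p.noise * l /
                  (p.power .mbs * p.refLoss .access .mbs * p.mainGain .mbs * p.ueMainGain)
                + p.assocExponent .mbs l : ℝ) : EReal))
          * ENNReal.ofReal (p.pathlossDensity .mbs l)) ∧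
    (∀ τ₁ τ₂ : ℝ, 0 < τ₁ → 0 < τ₂ →
      P[{ω | ENNReal.ofReal τ₁ < N.sinrAccess ω ∧ ENNReal.ofReal τ₂ < N.snrBackhaul ω} |
          N.servedBy .sbs] =
        (p.assocProb .sbs)⁻¹ * ∑ t : IAB.LinkState,
          ∫⁻ l₁ in Ioi (0 : ℝ), ∫⁻ l₂ in Ioi (0 : ℝ),
          EReal.exp (
            -((∑ d : Bool × Bool, ∫⁻ z in Ioi l₁,
                ENNReal.ofReal ((1 - 1 / (1 +
                  τ₁ * p.lobeGain d * l₁ / (p.mainGain .sbs * p.ueMainGain * z)))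
                  * p.lobeProb d * p.pathlossDensity .sbs z) : ℝ≥0∞) : EReal)
            - ((τ₁ * p.noise * l₁ /
                  (p.power .sbs * p.refLoss .access .sbs * p.mainGain .sbs * p.ueMainGain)
                + τ₂ * p.noise * l₂ /
                  (p.power .mbs * p.refLoss .backhaul .mbs * p.mainGain .mbs * p.mainGain .sbs)
                + p.condPathlossMeasure t l₂ l₁ 0
                + p.assocExponent .sbs l₁ : ℝ) : EReal))
          * ENNReal.ofReal (p.condPathlossDensity t l₂ l₁ 0)
          * ENNReal.ofReal (p.pathlossDensityState .sbs t l₁)) := by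
  have hprob : ∀ i, P (N.servedBy i) = p.assocProb i := fun i => by
    rw [(N.measure_servedBy i).2, p.assocProb_eq]
  have hn := p.noise_pos
  refine ⟨fun i => ⟨hprob i, p.assocProb_pos i⟩, fun τ hτ => ?_, fun τ₁ τ₂ hτ₁ hτ₂ => ?_⟩
  · rw [N.cond_servedBy, hprob, N.measure_coverage .mbs hτ]
    congr 1
    refine setLIntegral_congr_fun measurableSet_Ioi fun l hl => ?_
    have hl0 : 0 ≤ l := le_of_lt hl
    have hS := p.signal_pos .mbs
    have h2 := p.power_pos .sbs
    have h3 := p.refLoss_pos .access .sbs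
    have hS' : p.power .mbs * p.refLoss .access .mbs * p.mainGain .mbs * p.ueMainGain =
        p.signal .mbs := by rw [IAB.Params.signal]; ring
    have hA := p.assocExponent_nonneg .mbs hl0
    have hκ : 0 ≤ τ * p.noise * l / p.signal .mbs := by positivity
    have hI : (∑ d : Bool × Bool, ∫⁻ z in Ioi (p.powerRatio .sbs .mbs * l),
        ENNReal.ofReal ((1 - 1 / (1 + τ * p.power .sbs * p.refLoss .access .sbs * p.lobeGain d * l /
          (p.signal .mbs * z))) * p.lobeProb d * p.pathlossDensity .sbs z)) =
        p.interfExponent (τ * p.power .sbs * p.refLoss .access .sbs / p.signal .mbs) .mbs l := by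
      refine Finset.sum_congr rfl fun d _ => lintegral_congr fun z => ?_
      congr 5
      rw [← div_div]
      ring
    rw [hS', hI, IAB.exp_neg_sub_eq _ (add_nonneg hκ hA), p.prod_expNeg_levelE (by positivity) _ hl0,
      ← IAB.expNeg_add, ENNReal.ofReal_add hκ hA, div_mul_eq_mul_div]
    congr 2
    ring
  · rw [N.cond_servedBy, hprob, N.measure_joint_coverage hτ₁ hτ₂]
    congr 1
    refine Finset.sum_congr rfl fun t _ => setLIntegral_congr_fun measurableSet_Ioi fun l hl => ?_
    have hl0 : 0 ≤ l := le_of_lt hl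
    have hS := p.signal_pos .sbs
    have hB := p.backSignal_pos
    have h2 := p.power_pos .sbs
    have h3 := p.refLoss_pos .access .sbs
    have hS' : p.power .sbs * p.refLoss .access .sbs * p.mainGain .sbs * p.ueMainGain =
        p.signal .sbs := by rw [IAB.Params.signal]; ring
    have hB' : p.power .mbs * p.refLoss .backhaul .mbs * p.mainGain .mbs * p.mainGain .sbs =
        p.backSignal := by rw [IAB.Params.backSignal]; ring
    have hA := p.assocExponent_nonneg .sbs hl0
    have hκ : 0 ≤ τ₁ * p.noise * l / p.signal .sbs := by positivity
    -- Interferers and server belong to the same tier, so power and reference loss cancel and only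
    -- the antenna gains remain.
    have hc : τ₁ * p.power .sbs * p.refLoss .access .sbs / p.signal .sbs =
        τ₁ / (p.mainGain .sbs * p.ueMainGain) := by
      have h4 := p.mainGain_pos .sbs
      have h5 := p.ueMainGain_pos
      rw [IAB.Params.signal]
      field_simp
    have hI : (∑ d : Bool × Bool, ∫⁻ z in Ioi l,
        ENNReal.ofReal ((1 - 1 / (1 + τ₁ * p.lobeGain d * l /
          (p.mainGain .sbs * p.ueMainGain * z))) * p.lobeProb d * p.pathlossDensity .sbs z)) =
        p.interfExponent (τ₁ * p.power .sbs * p.refLoss .access .sbs / p.signal .sbs) .sbs l := by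
      rw [IAB.Params.interfExponent, p.powerRatio_self, one_mul, hc]
      refine Finset.sum_congr rfl fun d _ => lintegral_congr fun z => ?_
      congr 5
      rw [← div_div]
      ring
    rw [p.prod_expNeg_levelE (by positivity) _ hl0, hS', hB', hI, IAB.Params.backhaulIntegral,
      ← IAB.expNeg_add, div_mul_eq_mul_div,
      ← lintegral_const_mul' _ _ ((IAB.expNeg_le_one _).trans_lt ENNReal.one_lt_top).ne,
      ← lintegral_mul_const' _ _ ENNReal.ofReal_ne_top]
    refine setLIntegral_congr_fun measurableSet_Ioi fun l₂ hl₂ => ?_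
    have hl₂0 : 0 ≤ l₂ := le_of_lt hl₂
    have hκ₂ : 0 ≤ τ₂ * p.noise * l₂ / p.backSignal := by positivity
    -- Any point at the distance corresponding to `l` yields the nonnegativity of the mass.
    have hM := (p.condPathlossMeasure_spec t hl₂0 (L := l)
      (y := EuclideanSpace.single 0 (l ^ (1 / p.pathlossExp .access .sbs t))) (by
        rw [PiLp.norm_single, Real.norm_of_nonneg (Real.rpow_nonneg hl0 _)])).1
    rw [IAB.exp_neg_sub_eq _ (add_nonneg (add_nonneg (add_nonneg hκ hκ₂) hM) hA),
      ENNReal.ofReal_add (add_nonneg (add_nonneg hκ hκ₂) hM) hA,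
      ENNReal.ofReal_add (add_nonneg hκ hκ₂) hM, ENNReal.ofReal_add hκ hκ₂, div_mul_eq_mul_div]
    simp only [IAB.expNeg_add]
    ring
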